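/- **Setting.** Let $d\ge 2$ and $n_1,\dots,n_d$ be natural numbers, and equip $\mathbb{R}^{n_1\times\dots\times n_d}$ with the Frobenius inner product. TT-cores with ranks $\mathbf s=(s_1,\dots,s_{d-1})$, $s_0=s_d=1$, are families of matrices $G_k[i]\in\mathbb{R}^{s_{k-1}\times s_k}$, $1\le k\le d$, $1\le i\le n_k$; they represent the tensor with entries $G_1[i_1]\cdots G_d[i_d]$. For $\mathbf r=(r_1,\dots,r_{d-1})$ with all $r_k\ge 1$, let $\mathcal M_{\mathbf r}$ be the set of tensors whose $k$-th unfolding has rank $r_k$ for $k=1,\dots,d-1$, and for $X\in\mathcal M_{\mathbf r}$ let $\mathrm P_X$ be the orthogonal projection onto the tangent space $T_X\mathcal M_{\mathbf r}$ (the span of the velocities at $X$ of the smooth curves in $\mathcal M_{\mathbf r}$ through $X$). Put $n=\max_k n_k$ and $r=\max_k r_k$. A *program* is a computational graph (straight-line program over $\mathbb{R}$) with the elementary operations $+,-,\times,/,\sqrt{\cdot},\exp,\log,\sin,\cos$, loading of constants and copying. Each operation counts as one FLOP. An execution is *legal* if every division has a nonzero divisor and every $\sqrt{\cdot}$ and $\log$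 has a positive argument. **Hypotheses.** Let $\Omega\subseteq\mathbb{R}^{n_1\times\dots\times n_d}$ be open (for instance the whole space) and let $f$ be a real function that is smooth on $\Omega$. Let $f$ be given by a program $p$, that is, for every rank vector $\mathbf s$ with positive entries, a computational graph $p_{\mathbf s}$ which takes TT-cores with ranks $\mathbf s$, is executed legally, and outputs $f(\widehat X)$ whenever the tensor $\widehat X$ represented by these cores lies in $\Omega$. Suppose that $p_{\mathbf s}$ uses at most $F(\mathbf s)$ FLOP, where $F$ is a polynomial in $s_1,\dots,s_{d-1}$ with nonnegative coefficients and of total degree at most $q$. **Algorithm.** The input consists of TT-cores $G_1,\dots,G_d$ with ranks $\mathbf r$ of a tensor $X\in\mathcal M_{\mathbf r}\cap\Omega$. 1. Compute, by Gram–Schmidt orthogonalization in a sweep from right to left followed by a sweep from left to right, cores $U_1,\dots,U_{d-1}$, $V_2,\dots,V_d$ and $S_1,\dots,S_d$. 2. Let $g(R_1,\dots,R_d)$ be the program that forms the cores $$\begin{bmatrix}R_1[i]&U_1[i]\end{bmatrix},\quad \begin{bmatrix}V_k[i]&0\\ R_k[i]&U_k[i]\end{bmatrix}\ (1<k<d),\quad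 \begin{bmatrix}V_d[i]\\ R_d[i]\end{bmatrix}$$ of the tensor $\mathcal T_X(R_1,\dots,R_d)=\sum_k U_1\cdots U_{k-1}R_kV_{k+1}\cdots V_d$ and runs $p_{2\mathbf r}$ on them. Compute $D_k=\partial g/\partial R_k$ at $(S_1,0,\dots,0)$ by reverse-mode automatic differentiation of this program. 3. Set $S_k^\delta[i]=D_k[i]-U_k[i]\sum_j U_k[j]^{\mathsf T}D_k[j]$ for $k<d$ and $S_d^\delta=D_d$, computing the sum first. 4. Output the block cores of step 2 with $R_k=S_k^\delta$. **Claim.** For every $q$ there is a constant $C$, depending only on $q$, such that for all $d,n_1,\dots,n_d,\Omega,f,p,F,\mathbf r$ and $G_1,\dots,G_d$ as above, the algorithm is executed legally and uses at most $$C\,\bigl(F(\mathbf r)+d\,n\,r^3\bigr)$$ FLOP, and: * $\sum_i U_k[i]^{\mathsf T}U_k[i]=I$ for $k<d$, $\sum_i V_k[i]V_k[i]^{\mathsf T}=I$ for $k>1$, and $X_{i_1\dots i_d}=U_1[i_1]\cdots U_{\mu-1}[i_{\mu-1}]\,S_\mu[i_\mu]\,V_{\mu+1}[i_{\mu+1}]\cdots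 V_d[i_d]$ for every $\mu=1,\dots,d$; * the computed $D_k$ are the partial derivatives of $f\circ\mathcal T_X$ with respect to $R_k$ at $(S_1,0,\dots,0)$, the computed $S^\delta_k$ are given by the formulas of step 3, and they satisfy the gauge conditions $\sum_i U_k[i]^{\mathsf T}S_k^\delta[i]=0$ for $k<d$; * the output cores are the block cores of $S^\delta$, and the tensor they represent is the Riemannian gradient $\mathrm P_X\nabla f(X)$. -/

import Mathlib

open Topology
open scoped ContDiff NNReal

noncomputable section

namespace TTGrad

/-! ### Straight-line programs over the reals, with unit cost for each instruction -/

/-- Elementary operations on the contents of registers named by `R`. -/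
inductive Op (R : Type) : Type
  | const (c : ℝ)
  | copy (x : R)
  | add (x y : R)
  | sub (x y : R)
  | mul (x y : R)
  | div (x y : R)
  | sqrt (x : R)
  | exp (x : R)
  | log (x : R)
  | sin (x : R)
  | cos (x : R)

namespace Op

variable {R R' : Type}

/-- The value of an operation when the registers contain `m`. -/
def eval (m : R → ℝ) : Op R → ℝ
  | const c => c
  | copy x => m x
  | add x y => m x + m y
  | sub x y => m x - m y
  | mul x y => m x * m y
  | div x y => m x / m y
  | sqrt x => Real.sqrt (m x)
  | exp x => Real.exp (m x)
  | log x => Real.log (m x)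
  | sin x => Real.sin (m x)
  | cos x => Real.cos (m x)

/-- The operation is performed inside the open set on which it is defined and smooth. -/
def Defined (m : R → ℝ) : Op R → Prop
  | div _ y => m y ≠ 0
  | sqrt x => 0 < m x
  | log x => 0 < m x
  | _ => True

/-- The registers that the operation reads. -/
def args : Op R → List R
  | const _ => []
  | copy x => [x]
  | add x y => [x, y]
  | sub x y => [x, y]
  | mul x y => [x, y]
  | div x y => [x, y]
  | sqrt x => [x]
  | exp x => [x]
  | log x => [x]
  | sin x => [x]
  | cos x => [x]

/-- Renaming of registers. -/
def rename (φ : R → R') : Op R → Op R'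
  | const c => const c
  | copy x => copy (φ x)
  | add x y => add (φ x) (φ y)
  | sub x y => sub (φ x) (φ y)
  | mul x y => mul (φ x) (φ y)
  | div x y => div (φ x) (φ y)
  | sqrt x => sqrt (φ x)
  | exp x => exp (φ x)
  | log x => log (φ x)
  | sin x => sin (φ x)
  | cos x => cos (φ x)

end Op

/-- Straight-line code: the pair `(x, o)` is the assignment `x := o`. The cost of running the code
is its length. -/
abbrev Code (R : Type) : Type := List (R × Op R)

namespace Code

variable {R R' : Type}

open Classical in
/-- The memory after running the code from the memory `m`. -/
def exec : Code R → (R → ℝ) → (R → ℝ)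
  | [], m => m
  | (x, o) :: c, m => exec c (Function.update m x (o.eval m))

open Classical in
/-- No instruction of the run from the memory `m` leaves the domain of its operation. -/
def Defined : Code R → (R → ℝ) → Prop
  | [], _ => True
  | (x, o) :: c, m => o.Defined m ∧ Defined c (Function.update m x (o.eval m))

/-- Renaming of registers. -/
def rename (φ : R → R') (c : Code R) : Code R' :=
  c.map fun xo => (φ xo.1, xo.2.rename φ)

end Code

/-- A computational graph (Wengert list) with inputs `ι` and intermediate variables `ν`, listed
in order of evaluation, and with one distinguished output variable. -/
structure Program (ι ν : Type) : Type where
  code : List (ν × Op (ι ⊕ ν))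
  out : ι ⊕ ν

namespace Program

variable {ι ν : Type}

/-- Each intermediate variable is assigned once, and is assigned before it is read. -/
def WellFormed (p : Program ι ν) : Prop :=
  (p.code.map Prod.fst).Nodup ∧
  (∀ l₁ v o l₂, p.code = l₁ ++ (v, o) :: l₂ →
    ∀ w, Sum.inr w ∈ o.args → w ∈ l₁.map Prod.fst) ∧
  (∀ w, p.out = Sum.inr w → w ∈ p.code.map Prod.fst)

/-- The number of elementary operations of the program. -/
def cost (p : Program ι ν) : ℕ := p.code.length

def toCode (p : Program ι ν) : Code (ι ⊕ ν) :=
  p.code.map fun vo => (Sum.inr vo.1, vo.2)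

def initial (x : ι → ℝ) : ι ⊕ ν → ℝ := Sum.elim x fun _ => 0

/-- On the input `x`, all operations are performed inside their domains. -/
def Defined (p : Program ι ν) (x : ι → ℝ) : Prop := p.toCode.Defined (initial x)

/-- The output of the program on the input `x`. -/
def eval (p : Program ι ν) (x : ι → ℝ) : ℝ := p.toCode.exec (initial x) p.out

end Program

/-! ### Reverse-mode automatic differentiation -/

/-- Registers of the reverse-mode differentiation of a program: the value and the adjoint of every
variable of the program, and a scratch register. -/
inductive ADReg (ι ν : Type) : Type
  | val (x : ι ⊕ ν)
  | adj (x : ι ⊕ ν)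
  | tmp

section ReverseAD

variable {ι ν : Type}

open ADReg

/-- Propagation of the adjoint of the variable `v`, assigned by `v := o`, to the operands. -/
def pullback (v : ν) : Op (ι ⊕ ν) → Code (ADReg ι ν)
  | .const _ => []
  | .copy x => [(adj x, .add (adj x) (adj (.inr v)))]
  | .add x y => [(adj x, .add (adj x) (adj (.inr v))), (adj y, .add (adj y) (adj (.inr v)))]
  | .sub x y => [(adj x, .add (adj x) (adj (.inr v))), (adj y, .sub (adj y) (adj (.inr v)))]
  | .mul x y =>
      [(tmp, .mul (adj (.inr v)) (val y)), (adj x, .add (adj x) tmp),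
       (tmp, .mul (adj (.inr v)) (val x)), (adj y, .add (adj y) tmp)]
  | .div x y =>
      [(tmp, .div (adj (.inr v)) (val y)), (adj x, .add (adj x) tmp),
       (tmp, .mul tmp (val (.inr v))), (adj y, .sub (adj y) tmp)]
  | .sqrt x =>
      [(tmp, .add (val (.inr v)) (val (.inr v))), (tmp, .div (adj (.inr v)) tmp),
       (adj x, .add (adj x) tmp)]
  | .exp x => [(tmp, .mul (adj (.inr v)) (val (.inr v))), (adj x, .add (adj x) tmp)]
  | .log x => [(tmp, .div (adj (.inr v)) (val x)), (adj x, .add (adj x) tmp)]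
  | .sin x =>
      [(tmp, .cos (val x)), (tmp, .mul (adj (.inr v)) tmp), (adj x, .add (adj x) tmp)]
  | .cos x =>
      [(tmp, .sin (val x)), (tmp, .mul (adj (.inr v)) tmp), (adj x, .sub (adj x) tmp)]

/-- Reverse-mode automatic differentiation: evaluate `p`, set the adjoint of the output to `1` and
all others to `0`, and go through the computational graph in reverse order. The inputs are expected
in the registers `val (.inl i)`; afterwards, the partial derivative with respect to the input `i`
is in `adj (.inl i)`. The list `inputs` enumerates the inputs. -/
def reverseAD (inputs : List ι) (p : Program ι ν) : Code (ADReg ι ν) :=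
  p.toCode.rename val ++
  inputs.map (fun i => (adj (.inl i), .const 0)) ++
  p.code.map (fun vo => (adj (.inr vo.1), .const 0)) ++
  [(adj p.out, .const 1)] ++
  p.code.reverse.flatMap (fun vo => pullback vo.1 vo.2)

end ReverseAD

/-! ### Tensors in the tensor-train format -/

/-- The bond dimensions `r₀ = 1, r₁, …, r_{d-1}, r_d = 1` of the rank vector `(r₁, …, r_{d-1})`. -/
def bond {d : ℕ} (r : Fin (d - 1) → ℕ) (k : ℕ) : ℕ :=
  if h : 0 < k ∧ k < d then r ⟨k - 1, by omega⟩ else 1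

theorem bond_two_nsmul_le {d : ℕ} (r : Fin (d - 1) → ℕ) (k : ℕ) :
    bond (2 • r) k ≤ 2 * bond r k := by
  unfold bond
  split <;> simp

/-- The space of `n₁ × ⋯ × n_d` tensors with the Frobenius inner product. -/
abbrev Tensor {d : ℕ} (n : Fin d → ℕ) : Type := EuclideanSpace ℝ ((k : Fin d) → Fin (n k))

/-- TT-cores: for every `k` and `i`, a matrix `G k i` of size `r_{k-1} × r_k` (with `k`
counted from `1`). -/
abbrev Cores {d : ℕ} (n : Fin d → ℕ) (r : Fin (d - 1) → ℕ) : Type :=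
  (k : Fin d) → Fin (n k) → Matrix (Fin (bond r k.val)) (Fin (bond r (k.val + 1))) ℝ

/-- The position `G k i a b` of an entry of TT-cores. -/
structure CoreIdx {d : ℕ} (n : Fin d → ℕ) (r : Fin (d - 1) → ℕ) : Type where
  k : Fin d
  a : Fin (bond r k.val)
  i : Fin (n k)
  b : Fin (bond r (k.val + 1))
deriving DecidableEq, Fintype

section TT

variable {d : ℕ} {n : Fin d → ℕ} {r : Fin (d - 1) → ℕ}

def Cores.entry (G : Cores n r) (j : CoreIdx n r) : ℝ := G j.k j.i j.a j.b

def Cores.ofEntries (v : CoreIdx n r → ℝ) : Cores n r :=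
  fun k i => Matrix.of fun a b => v ⟨k, a, i, b⟩

/-- The row vector `G₁[i₁] ⋯ G_k[i_k]`. -/
def partialProd (G : Cores n r) (i : (k : Fin d) → Fin (n k)) :
    (k : ℕ) → k ≤ d → (Fin (bond r k) → ℝ)
  | 0, _ => fun _ => 1
  | k + 1, h =>
      Matrix.vecMul (partialProd G i k (Nat.le_of_succ_le h)) (G ⟨k, h⟩ (i ⟨k, h⟩))

/-- The tensor with entries `G₁[i₁] ⋯ G_d[i_d]` (a `1 × 1` matrix). -/
def tensor (G : Cores n r) : Tensor n :=
  WithLp.toLp 2 fun i => ∑ b, partialProd G i d le_rfl b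

/-- The `k`-th unfolding of a tensor: the first `k` indices enumerate the rows. -/
def unfolding (A : Tensor n) (k : ℕ) :
    Matrix ((j : {j : Fin d // j.val < k}) → Fin (n j.val))
      ((j : {j : Fin d // ¬ j.val < k}) → Fin (n j.val)) ℝ :=
  Matrix.of fun x y =>
    A ((Equiv.piEquivPiSubtypeProd (fun j : Fin d => j.val < k) (fun j => Fin (n j))).symm (x, y))

/-- The set of tensors of TT-rank `r`, the `k`-th component of the TT-rank being the rank of the
`k`-th unfolding. -/
def fixedRank (n : Fin d → ℕ) (r : Fin (d - 1) → ℕ) : Set (Tensor n) :=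
  {A | ∀ k : Fin (d - 1), (unfolding A (k.val + 1)).rank = r k}

/-- `U`, `V`, `S` are left-orthogonal, right-orthogonal and unrestricted cores that give a
`μ`-orthogonal representation of `X` for every `μ`. (The last core of `U` and the first core of `V`
play no role.) -/
def IsOrthogonalization (X : Tensor n) (U V S : Cores n r) : Prop :=
  (∀ k : Fin d, k.val + 1 < d → ∑ i, (U k i).transpose * U k i = 1) ∧
  (∀ k : Fin d, 0 < k.val → ∑ i, V k i * (V k i).transpose = 1) ∧
  (∀ μ : Fin d, tensor (fun k => if k < μ then U k else if k = μ then S k else V k) = X)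

/-- The position of a bond index of the doubled ranks in a `2 × 2` block matrix. The first core
consists of the second block row, the last core of the first block column. -/
def splitBond (r : Fin (d - 1) → ℕ) (k : ℕ) (a : Fin (bond (2 • r) k)) :
    Fin (bond r k) ⊕ Fin (bond r k) :=
  if hk : k = 0 then .inr ⟨0, by simp [bond, hk]⟩
  else if h : a.val < bond r k then .inl ⟨a.val, h⟩
  else .inr ⟨a.val - bond r k, by
    have h₁ := a.isLt
    have h₂ := bond_two_nsmul_le r k
    omega⟩

/-- The entries of the block cores `[δ₁ U₁]`, `[V_k 0; δ_k U_k]` for `1 < k < d`, `[V_d; δ_d]`. -/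
def blockEntry {α : Type} (zero : α) (δ U V : CoreIdx n r → α) (j : CoreIdx n (2 • r)) : α :=
  match splitBond r j.k.val j.a, splitBond r (j.k.val + 1) j.b with
  | .inl a, .inl b => V ⟨j.k, a, j.i, b⟩
  | .inl _, .inr _ => zero
  | .inr a, .inl b => δ ⟨j.k, a, j.i, b⟩
  | .inr a, .inr b => U ⟨j.k, a, j.i, b⟩

/-- The TT-cores of the element `∑ₖ U₁ ⋯ U_{k-1} δ_k V_{k+1} ⋯ V_d` of the tangent space. -/
def blockCores (δ U V : Cores n r) : Cores n (2 • r) :=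
  Cores.ofEntries (blockEntry 0 δ.entry U.entry V.entry)

/-- The point `(S₁, 0, …, 0)`. -/
def basePoint (S : Cores n r) : CoreIdx n r → ℝ :=
  fun j => if j.k.val = 0 then S.entry j else 0

end TT

/-- The tangent space at `x` of an embedded submanifold: the velocities of the smooth curves in `M`
through `x`. (They form a subspace when `M` is an embedded submanifold; the span makes this a
`Submodule` for all sets.) -/
def tangentSpace {E : Type*} [NormedAddCommGroup E] [NormedSpace ℝ E] (M : Set E) (x : E) :
    Submodule ℝ E :=
  Submodule.span ℝ {v | ∃ γ : ℝ → E, γ 0 = x ∧ ContDiffAt ℝ ∞ γ 0 ∧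
    (∀ᶠ t in 𝓝 (0 : ℝ), γ t ∈ M) ∧ deriv γ 0 = v}

/-! ### The algorithm -/

/-- `dst := ∑ x * y` over the pairs `(x, y)` of the list. -/
def sumProd {R : Type} (dst tmp : R) (l : List (R × R)) : Code R :=
  (dst, .const 0) :: l.flatMap fun xy => [(tmp, .mul xy.1 xy.2), (dst, .add dst tmp)]

/-- `dst := dst - ∑ x * y` over the pairs `(x, y)` of the list. -/
def subProd {R : Type} (dst tmp : R) (l : List (R × R)) : Code R :=
  l.flatMap fun xy => [(tmp, .mul xy.1 xy.2), (dst, .sub dst tmp)]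

/-- Gram-Schmidt orthogonalization (modified) of the `s` vectors `A · 0, …, A · (s - 1)` with
coordinates in `rows`: computes `Q` with orthonormal columns and `T` upper triangular such that
`A = Q T`. -/
def gramSchmidt {R μ : Type} (rows : List μ) (s : ℕ) (A Q : μ → Fin s → R)
    (T : Fin s → Fin s → R) (tmp : R) : Code R :=
  (List.finRange s).flatMap fun b =>
    rows.map (fun x => (Q x b, .copy (A x b))) ++
    (List.finRange s).flatMap fun c =>
      if c < b then
        sumProd (T c b) tmp (rows.map fun x => (Q x c, Q x b)) ++
        rows.flatMap (fun x => subProd (Q x b) tmp [(T c b, Q x c)])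
      else if c = b then
        sumProd (T b b) tmp (rows.map fun x => (Q x b, Q x b)) ++
        [(T b b, .sqrt (T b b))] ++
        rows.map (fun x => (Q x b, .div (Q x b) (T b b)))
      else [(T c b, .const 0)]

section Algorithm

variable {d : ℕ}

/-- The inputs of `g`: the variables `R_k` and the fixed cores `U_k`, `V_k`. -/
inductive GInput (n : Fin d → ℕ) (r : Fin (d - 1) → ℕ) : Type
  | R (j : CoreIdx n r)
  | U (j : CoreIdx n r)
  | V (j : CoreIdx n r)

/-- The registers of the algorithm. -/
inductive Reg (n : Fin d → ℕ) (r : Fin (d - 1) → ℕ) : Type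
  /-- the given cores -/
  | G (j : CoreIdx n r)
  /-- cores to be right-orthogonalized -/
  | W (j : CoreIdx n r)
  | U (j : CoreIdx n r)
  | V (j : CoreIdx n r)
  | S (j : CoreIdx n r)
  /-- triangular factors at the bond between two neighbouring cores -/
  | L (k : Fin (d - 1)) (a b : Fin (bond r (k.val + 1)))
  | T (k : Fin (d - 1)) (a b : Fin (bond r (k.val + 1)))
  /-- registers of the automatic differentiation of `g` -/
  | ad (x : ADReg (GInput n r) (CoreIdx n (2 • r) ⊕ ℕ))
  /-- the derivatives of `g` -/
  | D (j : CoreIdx n r)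
  /-- the products of the transpose of `U_k` with the derivatives of `g` -/
  | M (k : Fin (d - 1)) (a b : Fin (bond r (k.val + 1)))
  /-- the deltas of the Riemannian gradient -/
  | delta (j : CoreIdx n r)
  /-- the TT-cores of the Riemannian gradient -/
  | grad (j : CoreIdx n (2 • r))
  | tmp

variable {n : Fin d → ℕ} {r : Fin (d - 1) → ℕ}

/-- For the bond `k`, the core to the left of it. -/
def lo (k : Fin (d - 1)) : Fin d := ⟨k.val, by omega⟩

/-- For the bond `k`, the core to the right of it. -/
def hi (k : Fin (d - 1)) : Fin d := ⟨k.val + 1, by omega⟩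

/-- The positions of all entries of the `k`-th core. -/
def coreEntries (n : Fin d → ℕ) (r : Fin (d - 1) → ℕ) (k : Fin d) : List (CoreIdx n r) :=
  (List.finRange _).flatMap fun a => (List.finRange _).flatMap fun i =>
    (List.finRange _).map fun b => ⟨k, a, i, b⟩

/-- The positions of all entries of all cores. -/
def allEntries (n : Fin d → ℕ) (r : Fin (d - 1) → ℕ) : List (CoreIdx n r) :=
  (List.finRange d).flatMap (coreEntries n r)

/-- Orthogonalization. A sweep from the right to the left makes the cores right-orthogonal, then a
sweep from the left to the right computes `S_k` and makes it left-orthogonal. -/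
def orthogonalize (n : Fin d → ℕ) (r : Fin (d - 1) → ℕ) : Code (Reg n r) :=
  (allEntries n r).flatMap (fun j =>
    if j.k.val + 1 = d then [(Reg.W j, Op.copy (Reg.G j))] else []) ++
  (List.finRange (d - 1)).reverse.flatMap (fun k =>
    -- the transposed right core `W` is factored as the transpose of `V` times `L`
    gramSchmidt (List.finRange (n (hi k)) ×ˢ List.finRange (bond r ((hi k).val + 1)))
      (bond r (k.val + 1))
      (fun x a => Reg.W ⟨hi k, a, x.1, x.2⟩) (fun x a => Reg.V ⟨hi k, a, x.1, x.2⟩)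
      (Reg.L k) Reg.tmp ++
    -- the left core is multiplied by the transpose of `L`
    (List.finRange (bond r (lo k).val)).flatMap fun a =>
      (List.finRange (n (lo k))).flatMap fun i =>
        (List.finRange (bond r (k.val + 1))).flatMap fun b =>
          sumProd (Reg.W ⟨lo k, a, i, b⟩) Reg.tmp
            ((List.finRange (bond r (k.val + 1))).map fun c =>
              (Reg.G ⟨lo k, a, i, c⟩, Reg.L k b c))) ++
  (allEntries n r).flatMap (fun j =>
    if j.k.val = 0 then [(Reg.S j, Op.copy (Reg.W j))] else []) ++
  (List.finRange (d - 1)).flatMap (fun k =>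
    -- the left core `S` is factored as `U` times `T`
    gramSchmidt (List.finRange (bond r (lo k).val) ×ˢ List.finRange (n (lo k)))
      (bond r (k.val + 1))
      (fun x b => Reg.S ⟨lo k, x.1, x.2, b⟩) (fun x b => Reg.U ⟨lo k, x.1, x.2, b⟩)
      (Reg.T k) Reg.tmp ++
    -- the right core `V` is multiplied by `T`
    (List.finRange (bond r (k.val + 1))).flatMap fun a =>
      (List.finRange (n (hi k))).flatMap fun i =>
        (List.finRange (bond r ((hi k).val + 1))).flatMap fun b =>
          sumProd (Reg.S ⟨hi k, a, i, b⟩) Reg.tmp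
            ((List.finRange (bond r (k.val + 1))).map fun c =>
              (Reg.T k a c, Reg.V ⟨hi k, c, i, b⟩)))

/-- The instruction that fills one entry of the block cores. -/
def blockOp {R : Type} (δ U V : CoreIdx n r → R) (j : CoreIdx n (2 • r)) : Op R :=
  blockEntry (.const 0) (fun j => .copy (δ j)) (fun j => .copy (U j)) (fun j => .copy (V j)) j

/-- The program of `g`: form the block cores and run `p` on them. -/
def gProgram (p : Program (CoreIdx n (2 • r)) ℕ) :
    Program (GInput n r) (CoreIdx n (2 • r) ⊕ ℕ) where
  code :=
    (allEntries n (2 • r)).map (fun j =>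
      (Sum.inl j, blockOp (fun j => .inl (.R j)) (fun j => .inl (.U j)) (fun j => .inl (.V j)) j)) ++
    p.code.map (fun vo => (Sum.inr vo.1, vo.2.rename Sum.inr))
  out := Sum.inr p.out

/-- The inputs of `g` that are in use. -/
def gInputs (n : Fin d → ℕ) (r : Fin (d - 1) → ℕ) : List (GInput n r) :=
  (allEntries n r).map .R ++
  ((allEntries n r).filter fun j => j.k.val + 1 < d).map .U ++
  ((allEntries n r).filter fun j => 0 < j.k.val).map .V

/-- The point at which `g` is differentiated: `R₁ = S₁` and `R_k = 0` for `k > 1`. -/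
def loadOp : GInput n r → Op (Reg n r)
  | .R j => if j.k.val = 0 then .copy (.S j) else .const 0
  | .U j => .copy (.U j)
  | .V j => .copy (.V j)

/-- Projection of the derivatives onto the gauge conditions:
`delta_k := D_k - U_k (U_kᵀ D_k)` for `k < d`, and `delta_d := D_d`. -/
def gaugeProjection (n : Fin d → ℕ) (r : Fin (d - 1) → ℕ) : Code (Reg n r) :=
  (allEntries n r).map (fun j => (Reg.delta j, Op.copy (Reg.D j))) ++
  (List.finRange (d - 1)).flatMap (fun k =>
    ((List.finRange (bond r (k.val + 1))).flatMap fun c =>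
      (List.finRange (bond r (k.val + 1))).flatMap fun b =>
        sumProd (Reg.M k c b) Reg.tmp
          ((List.finRange (bond r (lo k).val) ×ˢ List.finRange (n (lo k))).map fun x =>
            (Reg.U ⟨lo k, x.1, x.2, c⟩, Reg.D ⟨lo k, x.1, x.2, b⟩))) ++
    (List.finRange (bond r (lo k).val)).flatMap fun a =>
      (List.finRange (n (lo k))).flatMap fun i =>
        (List.finRange (bond r (k.val + 1))).flatMap fun b =>
          subProd (Reg.delta ⟨lo k, a, i, b⟩) Reg.tmp
            ((List.finRange (bond r (k.val + 1))).map fun c =>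
              (Reg.U ⟨lo k, a, i, c⟩, Reg.M k c b)))

/-- The algorithm for the Riemannian gradient: orthogonalize the cores, differentiate `g` at
`(S₁, 0, …, 0)` in reverse mode, project onto the gauge conditions, form the block cores. -/
def riemannianGradient (p : Program (CoreIdx n (2 • r)) ℕ) : Code (Reg n r) :=
  orthogonalize n r ++
  (gInputs n r).map (fun x => (Reg.ad (.val (.inl x)), loadOp x)) ++
  (reverseAD (gInputs n r) (gProgram p)).rename Reg.ad ++
  (allEntries n r).map (fun j => (Reg.D j, Op.copy (Reg.ad (.adj (.inl (.R j)))))) ++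
  gaugeProjection n r ++
  (allEntries n (2 • r)).map (fun j => (Reg.grad j, blockOp Reg.delta Reg.U Reg.V j))

end Algorithm

end TTGrad

end

open TTGrad

/-! Geometry. With left-orthogonal `U` and right-orthogonal `V`, every tangent vector at `X` has the
form `T_X(R) = ∑ U₁ ⋯ U_{k-1} R_k V_{k+1} ⋯ V_d`, and on cores that satisfy the gauge conditions
this parametrization is isometric: different components are orthogonal, and each one carries the
Frobenius inner product of its core (`inner_tangentMap_of_gauged`). The map `T_X` is linear and
sends `(S₁, 0, …, 0)` to `X`. By the chain rule the partial derivatives `D` therefore satisfy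
`⟨∇f(X), T_X(R)⟩ = ⟨D, R⟩`. For gauged `R` the right side does not change when `D` is replaced by
its gauged part, and by isometry it then equals `⟨T_X(gauged part of D), T_X(R)⟩`. A tangent vector
with the same inner products with the tangent space as `∇f(X)` is its orthogonal projection
(`tensor_blockCores_gaugePart`).

Tangent space. Each component of `T_X(R)` is the velocity of a straight line that stays in the set
of fixed rank for small times: the cores bound the ranks from above, and a nonvanishing minor bounds
them from below (`tangentTerm_mem_tangentSpace`). Conversely, let `P_k`, `Q_k` be the orthogonal
projections onto the column and row spaces of the `k`-th unfolding of `X`. The velocity `A` of any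
curve of constant rank satisfies `(1 - P_k) A (1 - Q_k) = 0` (`projection_deriv_eq_zero`).
Telescoping `P_k A` over `k` then puts `A` in gauged form (`exists_gauged`). No manifold structure
is needed.

Computation. Code is verified with triples `Runs` of code, initial memory and postcondition.
Gram-Schmidt never divides by zero, because the ranks of the cores are the ranks of the unfoldings,
which makes the interface matrices of full rank. Reverse mode is correct because the adjoints
satisfy the recursion of `Code.grad` (`runs_backward`), and `Code.grad` is the gradient by the chain
rule along curves (`Code.hasGradAt`). The program of `g` computes `f ∘ T_X` wherever the tensor lies
in the open set `Ω`, hence near the base point (`grad_gProgram`).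

Cost. Reverse mode costs at most six operations per instruction, and doubling all ranks multiplies
`F` by at most `2 ^ q`. All other loops cost a multiple of `d n r³`. -/

namespace TTGrad

/-! ### Running straight-line code -/

namespace Code

variable {R R' : Type}

theorem exec_nil (m : R → ℝ) : exec [] m = m := rfl

theorem defined_nil (m : R → ℝ) : Code.Defined [] m := trivial

/-- `exec` is defined with the classical decidability instance; this form unfolds it for whichever
instance is in scope. -/
theorem exec_cons [DecidableEq R] (x : R) (o : Op R) (c : Code R) (m : R → ℝ) :
    exec ((x, o) :: c) m = exec c (Function.update m x (o.eval m)) := by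
  rw [exec]
  congr!

theorem defined_cons [DecidableEq R] (x : R) (o : Op R) (c : Code R) (m : R → ℝ) :
    Code.Defined ((x, o) :: c) m ↔
      o.Defined m ∧ Code.Defined c (Function.update m x (o.eval m)) := by
  rw [Code.Defined]
  congr!

theorem exec_append (c₁ c₂ : Code R) (m : R → ℝ) :
    exec (c₁ ++ c₂) m = exec c₂ (exec c₁ m) := by
  induction c₁ generalizing m with
  | nil => rfl
  | cons xo c ih => obtain ⟨x, o⟩ := xo; exact ih _

theorem defined_append (c₁ c₂ : Code R) (m : R → ℝ) :
    Code.Defined (c₁ ++ c₂) m ↔ Code.Defined c₁ m ∧ Code.Defined c₂ (exec c₁ m) := by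
  induction c₁ generalizing m with
  | nil => simp [Code.Defined, exec]
  | cons xo c ih =>
    obtain ⟨x, o⟩ := xo
    simp only [List.cons_append, Code.Defined, exec, ih, and_assoc]

theorem exec_of_notMem (c : Code R) (m : R → ℝ) (x : R) (h : ∀ yo ∈ c, yo.1 ≠ x) :
    exec c m x = m x := by
  induction c generalizing m with
  | nil => rfl
  | cons yo c ih =>
    obtain ⟨y, o⟩ := yo
    rw [exec, ih _ fun zo hz => h zo (List.mem_cons_of_mem _ hz)]
    classical
    convert Function.update_of_ne (h _ List.mem_cons_self).symm _ _

/-- `c` runs legally from `m` and ends in a memory that satisfies `Q`. -/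
def Runs (c : Code R) (m : R → ℝ) (Q : (R → ℝ) → Prop) : Prop :=
  Code.Defined c m ∧ Q (exec c m)

theorem Runs.mono {c : Code R} {m : R → ℝ} {P Q : (R → ℝ) → Prop} (h : Runs c m P)
    (hPQ : ∀ m, P m → Q m) : Runs c m Q :=
  ⟨h.1, hPQ _ h.2⟩

theorem Runs.append {c₁ c₂ : Code R} {m : R → ℝ} {P Q : (R → ℝ) → Prop} (h : Runs c₁ m P)
    (h' : ∀ m, P m → Runs c₂ m Q) : Runs (c₁ ++ c₂) m Q := by
  refine ⟨(defined_append _ _ _).2 ⟨h.1, (h' _ h.2).1⟩, ?_⟩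
  rw [exec_append]
  exact (h' _ h.2).2

theorem runs_nil {m : R → ℝ} {Q : (R → ℝ) → Prop} (h : Q m) : Runs [] m Q :=
  ⟨trivial, h⟩

theorem runs_single [DecidableEq R] {x : R} {o : Op R} {m : R → ℝ} {Q : (R → ℝ) → Prop}
    (hd : o.Defined m) (h : Q (Function.update m x (o.eval m))) : Runs [(x, o)] m Q :=
  ⟨(defined_cons ..).2 ⟨hd, trivial⟩, by rwa [exec_cons]⟩

theorem runs_cons [DecidableEq R] {x : R} {o : Op R} {c : Code R} {m : R → ℝ} {Q : (R → ℝ) → Prop}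
    (hd : o.Defined m) (h : Runs c (Function.update m x (o.eval m)) Q) :
    Runs ((x, o) :: c) m Q :=
  ⟨(defined_cons ..).2 ⟨hd, h.1⟩, by rw [exec_cons]; exact h.2⟩

/-- Loop over a list, with an invariant that may depend on the part of the list already done. -/
theorem runs_flatMap {α : Type} (body : α → Code R) (I : List α → (R → ℝ) → Prop) (l : List α)
    (step : ∀ l₁ a l₂, l = l₁ ++ a :: l₂ → ∀ m, I l₁ m → Runs (body a) m (I (l₁ ++ [a])))
    {m : R → ℝ} (h0 : I [] m) : Runs (l.flatMap body) m (I l) := by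
  suffices H : ∀ l₂ l₁, l = l₁ ++ l₂ → ∀ m, I l₁ m → Runs (l₂.flatMap body) m (I l) from
    H l [] rfl m h0
  intro l₂
  induction l₂ with
  | nil => intro l₁ hl m hm; simp only [List.append_nil] at hl; subst hl; exact runs_nil hm
  | cons a l₂ ih =>
    intro l₁ hl m hm
    rw [List.flatMap_cons]
    exact (step l₁ a l₂ hl m hm).append (ih (l₁ ++ [a]) (by simp [hl]))

/-- Counting loop. -/
theorem runs_finRange {s : ℕ} (body : Fin s → Code R) (I : ℕ → (R → ℝ) → Prop)
    (step : ∀ (k : Fin s) m, I k m → Runs (body k) m (I (k + 1))) {m : R → ℝ} (h0 : I 0 m) :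
    Runs ((List.finRange s).flatMap body) m (I s) := by
  have := runs_flatMap body (fun l => I l.length) (List.finRange s) ?_ (m := m) h0
  · simpa using this
  · intro l₁ a l₂ hl m hm
    have : a.val = l₁.length := by
      have h1 : (List.finRange s)[l₁.length]'(by rw [hl]; simp) = a := by
        simp [hl]
      rw [← h1]; simp
    simpa [this] using step a m (by rwa [this])

/-- Loop counting down. -/
theorem runs_finRange_reverse {s : ℕ} (body : Fin s → Code R) (I : ℕ → (R → ℝ) → Prop)
    (step : ∀ (k : Fin s) m, I (k + 1) m → Runs (body k) m (I k)) {m : R → ℝ} (h0 : I s m) :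
    Runs ((List.finRange s).reverse.flatMap body) m (I 0) := by
  have := runs_flatMap body (fun l => I (s - l.length)) (List.finRange s).reverse ?_ (m := m)
    (by simpa using h0)
  · simpa using this
  · intro l₁ a l₂ hl m hm
    have hlen : s = l₁.length + (l₂.length + 1) := by
      have := congrArg List.length hl
      simpa using this
    have : a.val = s - l₁.length - 1 := by
      have h1 : (List.finRange s).reverse[l₁.length]'(by rw [hl]; simp) = a := by
        simp [hl]
      rw [← h1, List.getElem_reverse]; simp; omega
    have e1 : s - l₁.length = a + 1 := by omega
    have e2 : s - (l₁ ++ [a]).length = a := by simp; omega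
    rw [e2]
    exact step a m (by rwa [e1] at hm)

/-- A loop whose passes compute registers `dst a` independently of each other, from registers that
the loop does not change. -/
theorem runs_parallel {α : Type} (l : List α) (hl : l.Nodup) (body : α → Code R) (dst : α → R)
    (hdst : Function.Injective dst) (scratch : Set R) (hscr : ∀ a, dst a ∉ scratch)
    (val : α → ℝ) (m : R → ℝ)
    (h : ∀ a ∈ l, ∀ m', (∀ x, (∀ b, x ≠ dst b) → x ∉ scratch → m' x = m x) →
      m' (dst a) = m (dst a) →
      Runs (body a) m' fun m'' => m'' (dst a) = val a ∧
        ∀ x, x ≠ dst a → x ∉ scratch → m'' x = m' x) :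
    Runs (l.flatMap body) m fun m' => (∀ a ∈ l, m' (dst a) = val a) ∧
      ∀ x, (∀ a ∈ l, x ≠ dst a) → x ∉ scratch → m' x = m x := by
  refine runs_flatMap body (fun l' m' => (∀ a ∈ l', m' (dst a) = val a) ∧
      ∀ x, (∀ a ∈ l', x ≠ dst a) → x ∉ scratch → m' x = m x) l ?_ (by simp)
  rintro l₁ a l₂ rfl m' ⟨h1, h2⟩
  -- Since no pass is repeated and `dst` is injective, the register of the current pass still holds
  -- its initial content.
  have hal : a ∉ l₁ := fun hal =>
    (List.disjoint_of_nodup_append hl hal) List.mem_cons_self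
  refine (h a (by simp) m' (fun x hx hs => h2 x (fun b _ => hx b) hs)
    (h2 _ (fun b hb e => hal (hdst e ▸ hb)) (hscr a))).mono ?_
  rintro m'' ⟨hv, hf⟩
  refine ⟨?_, ?_⟩
  · intro b hb
    by_cases hba : b = a
    · rw [hba, hv]
    · rw [hf _ (fun e => hba (hdst e)) (hscr b)]
      refine h1 b ?_
      simpa [hba] using hb
  · intro x hx hs
    rw [hf x (hx a (by simp)) hs]
    exact h2 x (fun b hb => hx b (by simp [hb])) hs

/-- Parallel assignment. -/
theorem runs_map {α : Type} (l : List α) (dst : α → R) (hdst : Function.Injective dst)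
    (op : α → Op R) (hop : ∀ a ∈ l, ∀ m, (op a).Defined m)
    (m : R → ℝ) (hargs : ∀ a ∈ l, ∀ m' : R → ℝ, (∀ x, (∀ b ∈ l, x ≠ dst b) → m' x = m x) →
      (op a).eval m' = (op a).eval m) :
    Runs (l.map fun a => (dst a, op a)) m fun m' => (∀ a ∈ l, m' (dst a) = (op a).eval m) ∧
      ∀ x, (∀ a ∈ l, x ≠ dst a) → m' x = m x := by
  classical
  have e : (l.map fun a => (dst a, op a)) = l.flatMap fun a => [(dst a, op a)] := by
    exact List.map_eq_flatMap
  rw [e]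
  refine runs_flatMap _ (fun l' m' => (∀ a ∈ l', m' (dst a) = (op a).eval m) ∧
      ∀ x, (∀ a ∈ l', x ≠ dst a) → m' x = m x) l ?_ (by simp)
  rintro l₁ a l₂ hl m' ⟨h1, h2⟩
  have ha : a ∈ l := by simp [hl]
  -- No operand is a destination, so the order of the assignments and repetitions in `l` are
  -- harmless.
  have hval : (op a).eval m' = (op a).eval m :=
    hargs a ha m' fun x hx => h2 x fun b hb => hx b (by simp [hl, hb])
  refine runs_single (hop a ha _) ⟨?_, ?_⟩
  · intro b hb
    by_cases hba : b = a
    · subst hba; simp [hval]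
    · rw [Function.update_of_ne (fun e => hba (hdst e))]
      exact h1 b (by simpa [hba] using hb)
  · intro x hx
    rw [Function.update_of_ne (hx a (by simp))]
    exact h2 x fun b hb => hx b (by simp [hb])

theorem exec_rename (φ : R → R') (hφ : Function.Injective φ) (c : Code R) (m : R' → ℝ) :
    exec (c.rename φ) m ∘ φ = exec c (m ∘ φ) := by
  induction c generalizing m with
  | nil => rfl
  | cons xo c ih =>
    obtain ⟨x, o⟩ := xo
    have he : (o.rename φ).eval m = o.eval (m ∘ φ) := by cases o <;> rfl
    classical
    have := ih (Function.update m (φ x) ((o.rename φ).eval m))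
    simp only [rename, List.map_cons, exec_cons] at this ⊢
    rw [this, he, Function.update_comp_eq_of_injective _ hφ]

theorem defined_rename (φ : R → R') (hφ : Function.Injective φ) (c : Code R) (m : R' → ℝ) :
    Code.Defined (c.rename φ) m ↔ Code.Defined c (m ∘ φ) := by
  induction c generalizing m with
  | nil => rfl
  | cons xo c ih =>
    obtain ⟨x, o⟩ := xo
    have he : (o.rename φ).eval m = o.eval (m ∘ φ) := by cases o <;> rfl
    have hd : (o.rename φ).Defined m ↔ o.Defined (m ∘ φ) := by cases o <;> rfl
    classical
    have := ih (Function.update m (φ x) ((o.rename φ).eval m))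
    simp only [rename, List.map_cons, defined_cons] at this ⊢
    rw [this, he, Function.update_comp_eq_of_injective _ hφ, hd]

theorem exec_rename_of_notMem (φ : R → R') (c : Code R) (m : R' → ℝ) (x : R')
    (hx : ∀ y, φ y ≠ x) : exec (c.rename φ) m x = m x := by
  refine exec_of_notMem _ _ _ ?_
  intro yo hyo
  obtain ⟨zo, -, rfl⟩ := List.mem_map.1 hyo
  exact hx _

end Code

open Code

/-! ### Accumulation of sums of products -/

section Accumulate

variable {R : Type}

theorem runs_subProd {dst tmp : R} (l : List (R × R)) (htmp : dst ≠ tmp)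
    (hl : ∀ xy ∈ l, xy.1 ≠ dst ∧ xy.1 ≠ tmp ∧ xy.2 ≠ dst ∧ xy.2 ≠ tmp) (m : R → ℝ) :
    Runs (subProd dst tmp l) m fun m' =>
      m' dst = m dst - (l.map fun xy => m xy.1 * m xy.2).sum ∧
      ∀ x, x ≠ dst → x ≠ tmp → m' x = m x := by
  classical
  refine runs_flatMap _ (fun l' m' => m' dst = m dst - (l'.map fun xy => m xy.1 * m xy.2).sum ∧
      ∀ x, x ≠ dst → x ≠ tmp → m' x = m x) l ?_ (m := m) (by simp)
  rintro l₁ ⟨x, y⟩ l₂ h m' ⟨h1, h2⟩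
  obtain ⟨a1, a2, a3, a4⟩ := hl (x, y) (by simp [h])
  simp only at a1 a2 a3 a4
  refine runs_cons trivial (runs_single trivial ⟨?_, ?_⟩)
  · simp [Op.eval, htmp, h1, h2 x a1 a2, h2 y a3 a4, sub_sub]
  · intro z hz hz'
    simp [hz, hz', h2 z hz hz']

theorem runs_sumProd {dst tmp : R} (l : List (R × R)) (htmp : dst ≠ tmp)
    (hl : ∀ xy ∈ l, xy.1 ≠ dst ∧ xy.1 ≠ tmp ∧ xy.2 ≠ dst ∧ xy.2 ≠ tmp) (m : R → ℝ) :
    Runs (sumProd dst tmp l) m fun m' =>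
      m' dst = (l.map fun xy => m xy.1 * m xy.2).sum ∧
      ∀ x, x ≠ dst → x ≠ tmp → m' x = m x := by
  classical
  refine runs_cons trivial (runs_flatMap _ (fun l' m' =>
      m' dst = (l'.map fun xy => m xy.1 * m xy.2).sum ∧
      ∀ x, x ≠ dst → x ≠ tmp → m' x = m x) l ?_ (m := Function.update m dst 0)
        ⟨by simp, fun x hx _ => by simp [hx]⟩)
  rintro l₁ ⟨x, y⟩ l₂ h m' ⟨h1, h2⟩
  obtain ⟨a1, a2, a3, a4⟩ := hl (x, y) (by simp [h])
  simp only at a1 a2 a3 a4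
  refine runs_cons trivial (runs_single trivial ⟨?_, ?_⟩)
  · simp [Op.eval, htmp, h1, h2 x a1 a2, h2 y a3 a4]
  · intro z hz hz'
    simp [hz, hz', h2 z hz hz']

end Accumulate

end TTGrad

namespace TTGrad

/-! ### Correctness of reverse-mode differentiation -/

section Gradient

variable {R : Type}

open Classical in
/-- The partial derivative of an operation with respect to the register `x`. -/
noncomputable def Op.partialDeriv (m : R → ℝ) (x : R) : Op R → ℝ
  | .const _ => 0
  | .copy y => if x = y then 1 else 0
  | .add y z => (if x = y then 1 else 0) + if x = z then 1 else 0
  | .sub y z => (if x = y then 1 else 0) - if x = z then 1 else 0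
  | .mul y z => (if x = y then m z else 0) + if x = z then m y else 0
  | .div y z => (if x = y then (m z)⁻¹ else 0) - if x = z then m y / m z ^ 2 else 0
  | .sqrt y => if x = y then 1 / (2 * Real.sqrt (m y)) else 0
  | .exp y => if x = y then Real.exp (m y) else 0
  | .log y => if x = y then (m y)⁻¹ else 0
  | .sin y => if x = y then Real.cos (m y) else 0
  | .cos y => if x = y then -Real.sin (m y) else 0

/-- The backward sweep evaluates partial derivatives in the final memory instead of the memory at
the time of the instruction. This lemma makes the two interchangeable once the operands agree. -/
theorem Op.congr_args {m m' : R → ℝ} (o : Op R) (h : ∀ x ∈ o.args, m x = m' x) :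
    o.eval m = o.eval m' ∧ (o.Defined m ↔ o.Defined m') ∧
      ∀ x, o.partialDeriv m x = o.partialDeriv m' x := by
  cases o <;> simp_all [Op.eval, Op.args, Op.Defined, Op.partialDeriv]

open Classical in
/-- The gradient of the content of `out` after running the code, as a function of the memory
before. -/
noncomputable def Code.grad (out : R) : Code R → (R → ℝ) → (R → ℝ)
  | [], _ => Pi.single out 1
  | (v, o) :: c, m => fun x =>
      (if x = v then 0 else grad out c (Function.update m v (o.eval m)) x) +
        grad out c (Function.update m v (o.eval m)) v * o.partialDeriv m x

/-- Chain rule for one assignment. The old content of `v` is overwritten, so for `x = v` only its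
influence through the operand list of `o` survives. -/
theorem Code.grad_cons [DecidableEq R] (out v : R) (o : Op R) (c : Code R) (m : R → ℝ) (x : R) :
    Code.grad out ((v, o) :: c) m x =
      (if x = v then 0 else Code.grad out c (Function.update m v (o.eval m)) x) +
        Code.grad out c (Function.update m v (o.eval m)) v * o.partialDeriv m x := by
  rw [Code.grad]
  congr!

/-- `a` is the gradient of `g` at `m`, tested on curves that move finitely many registers to first
order. -/
def HasGradAt (g : (R → ℝ) → ℝ) (m a : R → ℝ) : Prop :=
  ∀ (s : Finset R) (z : ℝ → R → ℝ) (z' : R → ℝ), z 0 = m →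
    (∀ x, HasDerivAt (fun t => z t x) (z' x) 0) → (∀ x ∉ s, z' x = 0) →
    HasDerivAt (fun t => g (z t)) (∑ x ∈ s, a x * z' x) 0

theorem Op.hasGradAt (o : Op R) {m : R → ℝ} (h : o.Defined m) :
    HasGradAt (fun m => o.eval m) m (fun x => o.partialDeriv m x) := by
  classical
  rintro s z z' rfl hz hs
  -- This holds also for `y ∉ s`, because the velocity `z' y` vanishes there.
  have key : ∀ (y : R) (c : ℝ), ∑ x ∈ s, (if x = y then c else 0) * z' x = c * z' y := by
    intro y c
    by_cases hy : y ∈ s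
    · rw [Finset.sum_eq_single y] <;> simp_all
    · rw [hs y hy, mul_zero]
      refine Finset.sum_eq_zero fun x hx => ?_
      rw [if_neg (fun e : x = y => hy (e ▸ hx)), zero_mul]
  cases o with
  | const c => simpa [Op.eval, Op.partialDeriv] using hasDerivAt_const (0 : ℝ) c
  | copy y => simpa [Op.eval, Op.partialDeriv, key, -ite_mul] using hz y
  | add y w =>
    simpa [Op.eval, Op.partialDeriv, key, -ite_mul, add_mul, Finset.sum_add_distrib]
      using (hz y).fun_add (hz w)
  | sub y w =>
    simpa [Op.eval, Op.partialDeriv, key, -ite_mul, sub_mul, Finset.sum_sub_distrib]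
      using (hz y).fun_sub (hz w)
  | mul y w =>
    have := (hz y).fun_mul (hz w)
    simp only [Op.eval, Op.partialDeriv, add_mul, Finset.sum_add_distrib, key]
    exact this.congr_deriv (by ring)
  | div y w =>
    have hw : z 0 w ≠ 0 := h
    have := (hz y).fun_div (hz w) hw
    simp only [Op.eval, Op.partialDeriv, sub_mul, Finset.sum_sub_distrib, key]
    exact this.congr_deriv (by field_simp)
  | sqrt y =>
    have hy : 0 < z 0 y := h
    have := (hz y).sqrt hy.ne'
    simp only [Op.eval, Op.partialDeriv, key]
    convert this using 1
    ring
  | exp y =>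
    have := (hz y).exp
    simpa only [Op.eval, Op.partialDeriv, key] using this
  | log y =>
    have hy : 0 < z 0 y := h
    have := (hz y).log hy.ne'
    simp only [Op.eval, Op.partialDeriv, key]
    convert this using 1
    ring
  | sin y =>
    have := (hz y).sin
    simpa only [Op.eval, Op.partialDeriv, key] using this
  | cos y =>
    have := (hz y).cos
    simpa only [Op.eval, Op.partialDeriv, key] using this

/-- There may be infinitely many registers, so differentiability is tested on curves and no norm on
memories is chosen. In the induction the curve of memories after the first instruction is again
admissible: only the register `v` is new, and it moves with velocity `e`. -/
theorem Code.hasGradAt (out : R) (c : Code R) {m : R → ℝ} (h : Code.Defined c m) :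
    HasGradAt (fun m => Code.exec c m out) m (Code.grad out c m) := by
  classical
  induction c generalizing m with
  | nil =>
    rintro s z z' rfl hz hs
    exact Op.hasGradAt (.copy out) trivial s z z' rfl hz hs |>.congr_deriv (by
      refine Finset.sum_congr rfl fun x _ => ?_
      simp [Op.partialDeriv, Code.grad, Pi.single_apply])
  | cons vo c ih =>
    obtain ⟨v, o⟩ := vo
    rintro s z z' rfl hz hs
    have h1 := Op.hasGradAt o ((Code.defined_cons ..).1 h).1 s z z' rfl hz hs
    set e := ∑ x ∈ s, o.partialDeriv (z 0) x * z' x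
    obtain ⟨-, hd⟩ := (Code.defined_cons ..).1 h
    have h2 := ih hd (insert v s) (fun t => Function.update (z t) v (o.eval (z t)))
      (Function.update z' v e) rfl ?_ ?_
    · simp only [Code.exec_cons, Code.grad_cons]
      refine h2.congr_deriv ?_
      set a := Code.grad out c (Function.update (z 0) v (o.eval (z 0)))
      -- This form splits off the summand of `v` whether or not `v ∈ s`.
      have hins : insert v s = insert v (s.erase v) := by ext; simp; tauto
      rw [hins, Finset.sum_insert (by simp)]
      simp only [add_mul, Finset.sum_add_distrib, mul_assoc, ← Finset.mul_sum, Function.update_self]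
      rw [add_comm]
      congr 1
      rw [← Finset.sum_erase (a := v) s (f := fun x => (if x = v then 0 else a x) * z' x) (by simp)]
      refine Finset.sum_congr rfl fun x hx => ?_
      have hx := Finset.ne_of_mem_erase hx
      simp [hx]
    · intro x
      by_cases hx : x = v
      · subst hx; simpa using h1
      · simpa [hx] using hz x
    · intro x hx
      simp only [Finset.mem_insert, not_or] at hx
      simp [hx.1, hs x hx.2]

end Gradient

/-! ### The forward and backward passes -/

section ReverseAD

open Code ADReg

variable {ι ν : Type}

/-- The code for `div`, `sqrt` and `exp` reuses the stored result of the instruction, which is why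
`hval` is needed: for instance `x / y²` is obtained as `(x / y) / y`. By `hv` the adjoint of `v`
stays fixed while those of the operands are updated. -/
theorem runs_pullback (v : ν) (o : Op (ι ⊕ ν)) (hv : Sum.inr v ∉ o.args) (m : ADReg ι ν → ℝ)
    (hd : o.Defined (m ∘ val)) (hval : m (val (.inr v)) = o.eval (m ∘ val)) :
    Runs (pullback v o) m fun m' => (∀ x, m' (val x) = m (val x)) ∧
      ∀ x, x ≠ .inr v →
        m' (adj x) = m (adj x) + m (adj (.inr v)) * o.partialDeriv (m ∘ val) x := by
  classical
  cases o with
  | const c => exact runs_nil (by simp [Op.partialDeriv])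
  | copy y =>
    refine ⟨by simp [pullback, defined_cons, defined_nil, Op.Defined], ?_⟩
    simp only [Op.args, List.mem_cons, List.not_mem_nil, or_false] at hv
    simp only [pullback, exec_nil, exec_cons, Op.eval, Op.partialDeriv]
    refine ⟨fun x => by simp, fun x hx => ?_⟩
    by_cases h1 : x = y <;> simp [h1]
  | add y z =>
    refine ⟨by simp [pullback, defined_cons, defined_nil, Op.Defined], ?_⟩
    simp only [Op.args, List.mem_cons, List.not_mem_nil, or_false] at hv
    simp only [pullback, exec_nil, exec_cons, Op.eval, Op.partialDeriv]
    refine ⟨fun x => by simp, fun x hx => ?_⟩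
    by_cases h1 : x = y <;> by_cases h2 : x = z <;>
      simp_all [eq_comm] <;> ring
  | sub y z =>
    refine ⟨by simp [pullback, defined_cons, defined_nil, Op.Defined], ?_⟩
    simp only [Op.args, List.mem_cons, List.not_mem_nil, or_false] at hv
    simp only [pullback, exec_nil, exec_cons, Op.eval, Op.partialDeriv]
    refine ⟨fun x => by simp, fun x hx => ?_⟩
    by_cases h1 : x = y <;> by_cases h2 : x = z <;>
      simp_all [eq_comm] <;> ring
  | mul y z =>
    refine ⟨by simp [pullback, defined_cons, defined_nil, Op.Defined], ?_⟩
    simp only [Op.args, List.mem_cons, List.not_mem_nil, or_false] at hv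
    simp only [pullback, exec_nil, exec_cons, Op.eval, Op.partialDeriv]
    refine ⟨fun x => by simp, fun x hx => ?_⟩
    by_cases h1 : x = y <;> by_cases h2 : x = z <;>
      simp_all [eq_comm] <;> ring
  | div y z =>
    simp only [Op.args, List.mem_cons, List.not_mem_nil, or_false] at hv
    have hz : m (val z) ≠ 0 := hd
    refine ⟨by simp [pullback, defined_cons, defined_nil, Op.Defined, hz], ?_⟩
    simp only [pullback, exec_nil, exec_cons, Op.eval, Op.partialDeriv]
    refine ⟨fun x => by simp, fun x hx => ?_⟩
    simp only [Op.eval, Function.comp_apply] at hval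
    by_cases h1 : x = y <;> by_cases h2 : x = z
    · subst h1 h2
      simp [hval]
      field_simp
      ring
    · subst h1
      simp [h2, Ne.symm h2, div_eq_mul_inv]
    · subst h2
      simp [h1, Ne.symm h1, hval]
      field_simp
      ring
    · simp [h1, h2]
  | sqrt y =>
    simp only [Op.args, List.mem_cons, List.not_mem_nil, or_false] at hv
    have hy : 0 < m (val y) := hd
    have hs := (Real.sqrt_pos.2 hy).ne'
    simp only [Op.eval, Function.comp_apply] at hval
    refine ⟨by simp [pullback, defined_cons, defined_nil, Op.Defined, Op.eval, hval, hs], ?_⟩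
    simp only [pullback, exec_nil, exec_cons, Op.eval, Op.partialDeriv]
    refine ⟨fun x => by simp, fun x hx => ?_⟩
    by_cases h1 : x = y <;> simp_all [eq_comm]
    field_simp; ring
  | exp y =>
    simp only [Op.args, List.mem_cons, List.not_mem_nil, or_false] at hv
    refine ⟨by simp [pullback, defined_cons, defined_nil, Op.Defined], ?_⟩
    simp only [Op.eval, Function.comp_apply] at hval
    simp only [pullback, exec_nil, exec_cons, Op.eval, Op.partialDeriv]
    refine ⟨fun x => by simp, fun x hx => ?_⟩
    by_cases h1 : x = y <;> simp_all [eq_comm]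
  | log y =>
    simp only [Op.args, List.mem_cons, List.not_mem_nil, or_false] at hv
    have hy : m (val y) ≠ 0 := ne_of_gt hd
    refine ⟨by simp [pullback, defined_cons, defined_nil, Op.Defined, hy], ?_⟩
    simp only [pullback, exec_nil, exec_cons, Op.eval, Op.partialDeriv]
    refine ⟨fun x => by simp, fun x hx => ?_⟩
    by_cases h1 : x = y <;> simp_all [eq_comm, div_eq_mul_inv]
  | sin y =>
    simp only [Op.args, List.mem_cons, List.not_mem_nil, or_false] at hv
    refine ⟨by simp [pullback, defined_cons, defined_nil, Op.Defined], ?_⟩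
    simp only [pullback, exec_nil, exec_cons, Op.eval, Op.partialDeriv]
    refine ⟨fun x => by simp, fun x hx => ?_⟩
    by_cases h1 : x = y <;> simp_all [eq_comm]
  | cos y =>
    simp only [Op.args, List.mem_cons, List.not_mem_nil, or_false] at hv
    refine ⟨by simp [pullback, defined_cons, defined_nil, Op.Defined], ?_⟩
    simp only [pullback, exec_nil, exec_cons, Op.eval, Op.partialDeriv]
    refine ⟨fun x => by simp, fun x hx => ?_⟩
    by_cases h1 : x = y <;> simp_all [eq_comm]
    ring

/-- Every variable is assigned at most once, and not after it has been read. -/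
def SingleAssignment : List (ν × Op (ι ⊕ ν)) → Prop
  | [] => True
  | (v, o) :: c => (∀ w, Sum.inr w ∈ o.args → w ≠ v ∧ ∀ yo ∈ c, yo.1 ≠ w) ∧
      (∀ yo ∈ c, yo.1 ≠ v) ∧ SingleAssignment c

theorem exec_toCode_of_notMem (c : List (ν × Op (ι ⊕ ν))) (m : ι ⊕ ν → ℝ) (x : ι ⊕ ν)
    (h : ∀ yo ∈ c, Sum.inr yo.1 ≠ x) :
    exec (c.map fun vo => (Sum.inr vo.1, vo.2)) m x = m x := by
  refine exec_of_notMem _ _ _ ?_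
  simp only [List.mem_map]
  rintro _ ⟨yo, hyo, rfl⟩
  exact h yo hyo

/-- Induction on the code, whose tail is processed first. The adjoints then hold the gradient of the
tail, and the pullback of the head performs the recursion `Code.grad_cons`. A variable assigned in
`c` is excluded from the conclusion: its adjoint refers to the content after the assignment, while
`grad` refers to the content before. The set `s` consists of registers whose adjoints have been
initialized. -/
theorem runs_backward (out : ι ⊕ ν) (c : List (ν × Op (ι ⊕ ν))) (hc : SingleAssignment c)
    (m₀ : ι ⊕ ν → ℝ) (hd : Code.Defined (c.map fun vo => (Sum.inr vo.1, vo.2)) m₀)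
    (m : ADReg ι ν → ℝ) (hm : m ∘ val = exec (c.map fun vo => (Sum.inr vo.1, vo.2)) m₀)
    (s : Set (ι ⊕ ν)) (hs : ∀ x ∈ s, m (adj x) = grad out [] m₀ x)
    (hcs : ∀ vo ∈ c, Sum.inr vo.1 ∈ s) :
    Runs (c.reverse.flatMap fun vo => pullback vo.1 vo.2) m fun m' =>
      (∀ x, m' (val x) = m (val x)) ∧
      ∀ x ∈ s, (∀ vo ∈ c, Sum.inr vo.1 ≠ x) →
        m' (adj x) = grad out (c.map fun vo => (Sum.inr vo.1, vo.2)) m₀ x := by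
  classical
  induction c generalizing m₀ with
  | nil => exact runs_nil ⟨fun _ => rfl, fun x hx _ => hs x hx⟩
  | cons vo c ih =>
    obtain ⟨v, o⟩ := vo
    obtain ⟨hc1, hc2, hc3⟩ := hc
    rw [List.reverse_cons, List.flatMap_append]
    simp only [List.map_cons, defined_cons, exec_cons] at hd hm
    refine (ih hc3 _ hd.2 hm (by simpa [grad] using hs)
      fun vo hvo => hcs vo (List.mem_cons_of_mem _ hvo)).append ?_
    rintro m₁ ⟨h1, h2⟩
    have hmv : m₁ ∘ val = m ∘ val := funext h1
    -- Single assignment: neither this instruction nor a later one overwrites an operand, so the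
    -- final memory still holds its value.
    have hargs : ∀ x ∈ o.args, (m₁ ∘ val) x = m₀ x := by
      intro x hx
      rw [hmv, hm, exec_toCode_of_notMem]
      · rw [Function.update_of_ne]
        rintro rfl
        exact (hc1 v hx).1 rfl
      · rintro yo hyo rfl
        exact (hc1 _ hx).2 yo hyo rfl
    obtain ⟨e1, e2, e3⟩ := o.congr_args hargs
    have hv : Sum.inr v ∉ o.args := fun h => (hc1 v h).1 rfl
    have hval : m₁ (val (.inr v)) = o.eval (m₁ ∘ val) := by
      have : m₁ (val (.inr v)) = (m₁ ∘ val) (.inr v) := rfl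
      rw [this, e1, hmv, hm, exec_toCode_of_notMem _ _ _ fun yo hyo => by simpa using hc2 yo hyo]
      simp
    simp only [List.flatMap_cons, List.flatMap_nil, List.append_nil]
    refine (runs_pullback v o hv m₁ (e2.2 hd.1) hval).mono ?_
    rintro m₂ ⟨h3, h4⟩
    refine ⟨fun x => (h3 x).trans (h1 x), fun x hx hxc => ?_⟩
    have hxv : x ≠ .inr v := (hxc (v, o) List.mem_cons_self).symm
    rw [h4 x hxv, h2 x hx fun vo hvo => hxc vo (List.mem_cons_of_mem _ hvo),
      h2 (.inr v) (hcs (v, o) List.mem_cons_self) fun yo hyo => by simpa using hc2 yo hyo, e3]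
    simp [grad_cons, hxv]

theorem runs_reverseAD (inputs : List ι) (p : Program ι ν) (hp : SingleAssignment p.code)
    (m : ADReg ι ν → ℝ) (hd : Code.Defined p.toCode (m ∘ val)) :
    Runs (reverseAD inputs p) m fun m' =>
      ∀ i ∈ inputs, m' (adj (.inl i)) = grad p.out p.toCode (m ∘ val) (.inl i) := by
  classical
  have hinj : Function.Injective (val : ι ⊕ ν → ADReg ι ν) := fun a b h => by cases h; rfl
  unfold reverseAD
  simp only [List.append_assoc]
  have r1 : Runs (p.toCode.rename val) m fun m' => m' ∘ val = exec p.toCode (m ∘ val) :=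
    ⟨(defined_rename _ hinj _ _).2 hd, exec_rename _ hinj _ _⟩
  refine r1.append fun m₁ h1 => ?_
  have r2 := runs_map inputs (fun i => (adj (.inl i) : ADReg ι ν)) (fun a b h => by cases h; rfl)
    (fun _ => .const 0) (by simp [Op.Defined]) m₁ (by simp [Op.eval])
  refine r2.append fun m₂ h2 => ?_
  -- The destination depends only on the first component of `vo` and is not injective in `vo`, so
  -- `runs_map` does not apply.
  have r3 := runs_flatMap (fun vo : ν × Op (ι ⊕ ν) => [((adj (.inr vo.1) : ADReg ι ν), .const 0)])
    (fun l m => (∀ vo ∈ l, m (adj (.inr vo.1)) = 0) ∧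
      ∀ x, (∀ w, x ≠ adj (.inr w)) → m x = m₂ x) p.code (by
        rintro l₁ ⟨v, o⟩ l₂ - m' ⟨h3, h4⟩
        refine runs_single trivial ⟨?_, ?_⟩
        · intro vo hvo
          rw [Function.update_apply]
          split_ifs with h
          · rfl
          · refine h3 vo ?_
            simp only [List.mem_append, List.mem_singleton] at hvo
            rcases hvo with hvo | rfl
            · exact hvo
            · exact absurd rfl h
        · intro x hx
          rw [Function.update_of_ne (hx _), h4 x hx]) (m := m₂) (by simp)
  rw [List.map_eq_flatMap (l := p.code)]
  refine r3.append fun m₃ h3 => ?_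
  refine runs_cons trivial ?_
  have hback := runs_backward p.out p.code hp (m ∘ val) hd
    (Function.update m₃ (adj p.out) ((Op.const 1).eval m₃)) ?_
    ({x | ∃ i ∈ inputs, x = .inl i} ∪ {x | ∃ vo ∈ p.code, x = .inr vo.1}) ?_ ?_
  · refine hback.mono ?_
    rintro m₄ ⟨-, h4⟩ i hi
    exact h4 _ (Or.inl ⟨i, hi, rfl⟩) (by simp)
  · change _ = exec p.toCode (m ∘ val)
    rw [← h1]
    funext x
    rw [Function.comp_apply, Function.update_of_ne (by simp), h3.2 _ (by simp), h2.2 _ (by simp),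
      Function.comp_apply]
  · intro x hx
    simp only [grad, Pi.single_apply]
    by_cases hxo : x = p.out
    · subst hxo; simp [Op.eval]
    · rw [if_neg hxo, Function.update_of_ne (by simpa using hxo)]
      rcases hx with ⟨i, hi, rfl⟩ | ⟨vo, hvo, rfl⟩
      · rw [h3.2 _ (by simp), h2.1 i hi]; rfl
      · exact h3.1 vo hvo
  · intro vo hvo
    exact Or.inr ⟨vo, hvo, rfl⟩

theorem Program.WellFormed.singleAssignment {p : Program ι ν} (hp : p.WellFormed) :
    SingleAssignment p.code := by
  obtain ⟨h1, h2, -⟩ := hp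
  suffices H : ∀ c l, p.code = l ++ c → SingleAssignment c from H p.code [] rfl
  intro c
  induction c with
  | nil => intros; trivial
  | cons vo c ih =>
    obtain ⟨v, o⟩ := vo
    intro l hl
    have hn := h1
    rw [hl, List.map_append, List.map_cons, List.nodup_append, List.nodup_cons] at hn
    refine ⟨fun w hw => ?_, fun yo hyo e => ?_, ih (l ++ [(v, o)]) (by simp [hl])⟩
    · have hwl := h2 l v o c hl w hw
      refine ⟨fun e => hn.2.2 w hwl v (by simp) e, fun yo hyo e => ?_⟩
      exact hn.2.2 w hwl yo.1 (List.mem_cons_of_mem _ (List.mem_map_of_mem hyo)) e.symm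
    · subst e
      exact hn.2.1.1 (List.mem_map.2 ⟨yo, hyo, rfl⟩)

/-- Every intermediate variable is written before it is read, so its initial content is irrelevant.
Inside the algorithm these registers hold arbitrary values, whereas `Program.initial` sets them to
zero. -/
theorem Program.WellFormed.exec_congr {p : Program ι ν} (hp : p.WellFormed) (m m' : ι ⊕ ν → ℝ)
    (hm : ∀ i, m (.inl i) = m' (.inl i)) :
    (Code.Defined p.toCode m ↔ Code.Defined p.toCode m') ∧
      exec p.toCode m p.out = exec p.toCode m' p.out := by
  classical
  obtain ⟨-, h2, h3⟩ := hp
  suffices H : ∀ c l, p.code = l ++ c → ∀ m m' : ι ⊕ ν → ℝ, (∀ i, m (.inl i) = m' (.inl i)) →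
      (∀ w ∈ l.map Prod.fst, m (.inr w) = m' (.inr w)) →
      (Code.Defined (c.map fun vo => (Sum.inr vo.1, vo.2)) m ↔
        Code.Defined (c.map fun vo => (Sum.inr vo.1, vo.2)) m') ∧
      exec (c.map fun vo => (Sum.inr vo.1, vo.2)) m p.out =
        exec (c.map fun vo => (Sum.inr vo.1, vo.2)) m' p.out from
    H p.code [] rfl m m' hm (by simp)
  intro c
  induction c with
  | nil =>
    intro l hl m m' hi hw
    refine ⟨Iff.rfl, ?_⟩
    change m p.out = m' p.out
    rcases ho : p.out with i | w
    · exact hi i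
    · have := h3 w ho
      rw [hl, List.append_nil] at this
      exact hw w this
  | cons vo c ih =>
    obtain ⟨v, o⟩ := vo
    intro l hl m m' hi hw
    obtain ⟨e1, e2, -⟩ := o.congr_args (m := m) (m' := m') (by
      rintro (i | w) hx
      · exact hi i
      · exact hw w (h2 l v o c hl w hx))
    have := ih (l ++ [(v, o)]) (by simp [hl]) (Function.update m (.inr v) (o.eval m))
      (Function.update m' (.inr v) (o.eval m')) (by simpa using hi) (by
        intro w hwl
        by_cases hwv : w = v
        · subst hwv; simp [e1]
        · rw [Function.update_of_ne (by simpa using hwv),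
            Function.update_of_ne (by simpa using hwv)]
          refine hw w ?_
          simpa [hwv] using hwl)
    simp only [List.map_cons, defined_cons, exec_cons]
    rw [e2, this.1]
    exact ⟨Iff.rfl, this.2⟩

end ReverseAD

end TTGrad

namespace TTGrad

/-! ### Correctness of Gram-Schmidt orthogonalization -/

section GramSchmidt

open Code

theorem sum_map_of_nodup {μ : Type} [Fintype μ] {rows : List μ} (h : rows.Nodup)
    (hmem : ∀ x, x ∈ rows) (f : μ → ℝ) : (rows.map f).sum = ∑ x, f x := by
  classical
  have : rows.toFinset = Finset.univ := by ext x; simp [hmem]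
  rw [← List.sum_toFinset _ h, this]

variable {R μ : Type} {s : ℕ} {rows : List μ} {A Q : μ → Fin s → R} {T : Fin s → Fin s → R}
  {tmp : R}

/-- The registers used by the Gram-Schmidt code are distinct. -/
structure GramSchmidtRegs (A Q : μ → Fin s → R) (T : Fin s → Fin s → R) (tmp : R) : Prop where
  injQ : ∀ x b y c, Q x b = Q y c → x = y ∧ b = c
  injT : ∀ a b c d, T a b = T c d → a = c ∧ b = d
  AQ : ∀ x b y c, A x b ≠ Q y c
  AT : ∀ x b c d, A x b ≠ T c d
  Atmp : ∀ x b, A x b ≠ tmp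
  QT : ∀ x b c d, Q x b ≠ T c d
  Qtmp : ∀ x b, Q x b ≠ tmp
  Ttmp : ∀ c b, T c b ≠ tmp

/-- The vector held in the column `b` of a matrix of registers. -/
def column (A : μ → Fin s → R) (m : R → ℝ) (b : Fin s) : μ → ℝ := fun x => m (A x b)

variable [Fintype μ]

/-- The state of the orthogonalization of the column `b`, when the first `k` coefficients have been
computed. -/
structure GramSchmidtState (Q : μ → Fin s → R) (T : Fin s → Fin s → R) (tmp : R) (b : Fin s)
    (a : μ → ℝ) (m₁ : R → ℝ) (k : ℕ) (m : R → ℝ) : Prop where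
  frame : ∀ z, (∀ x, z ≠ Q x b) → (∀ c, z ≠ T c b) → z ≠ tmp → m z = m₁ z
  orth : ∀ c : Fin s, c.val < k → c < b → column Q m c ⬝ᵥ column Q m b = 0
  before : k ≤ b.val →
    a = ∑ c ∈ Finset.univ.filter (fun c : Fin s => c.val < k), m (T c b) • column Q m c +
      column Q m b
  after : b.val < k → a = ∑ c ∈ Finset.Iic b, m (T c b) • column Q m c ∧ m (T b b) ≠ 0 ∧
      column Q m b ⬝ᵥ column Q m b = 1
  zero : ∀ c : Fin s, c.val < k → b < c → m (T c b) = 0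

/-- One pass of the inner loop. For `c < b` the component along column `c` is removed, and this
preserves the orthogonality to earlier columns since those are orthogonal to column `c`. For `c = b`
the remainder is normalized. For `c > b` a zero is stored below the diagonal of `T`. -/
theorem runs_gramSchmidt_step (h : GramSchmidtRegs A Q T tmp) (hrows : rows.Nodup)
    (hmem : ∀ x, x ∈ rows) (b : Fin s) (a : μ → ℝ) (m₁ : R → ℝ)
    (hQ : ∀ c c', c < b → c' < b →
      column Q m₁ c ⬝ᵥ column Q m₁ c' = if c = c' then 1 else 0)
    (ha : a ∉ Submodule.span ℝ (column Q m₁ '' {c | c < b}))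
    (c : Fin s) (m : R → ℝ) (hm : GramSchmidtState Q T tmp b a m₁ c m) :
    Runs (if c < b then
        sumProd (T c b) tmp (rows.map fun x => (Q x c, Q x b)) ++
        rows.flatMap (fun x => subProd (Q x b) tmp [(T c b, Q x c)])
      else if c = b then
        sumProd (T b b) tmp (rows.map fun x => (Q x b, Q x b)) ++
        [(T b b, .sqrt (T b b))] ++
        rows.map (fun x => (Q x b, .div (Q x b) (T b b)))
      else [(T c b, .const 0)]) m (GramSchmidtState Q T tmp b a m₁ (c + 1)) := by
  classical
  obtain ⟨injQ, injT, AQ, AT, Atmp, QT, Qtmp, Ttmp⟩ := h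
  have hcol : ∀ m', (∀ z, (∀ x, z ≠ Q x b) → (∀ c, z ≠ T c b) → z ≠ tmp → m' z = m₁ z) →
      ∀ c, c ≠ b → column Q m' c = column Q m₁ c := by
    intro m' hm' c hcb
    funext x
    exact hm' _ (fun y e => hcb (injQ _ _ _ _ e).2) (fun c' => QT _ _ _ _) (Qtmp _ _)
  have hcolm := hcol m hm.frame
  split_ifs with h1 h2
  · have hcb : c ≠ b := h1.ne
    refine (runs_sumProd (rows.map fun x => (Q x c, Q x b)) (Ttmp c b) (by
      simp only [List.mem_map]
      rintro _ ⟨x, -, rfl⟩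
      exact ⟨QT _ _ _ _, Qtmp _ _, QT _ _ _ _, Qtmp _ _⟩) m).append ?_
    rintro m₂ ⟨e1, e2⟩
    rw [List.map_map, sum_map_of_nodup hrows hmem] at e1
    set t := m₂ (T c b) with ht
    have hcol2 : ∀ c', column Q m₂ c' = column Q m c' := fun c' =>
      funext fun x => e2 _ (QT _ _ _ _) (Qtmp _ _)
    have htd : t = column Q m c ⬝ᵥ column Q m b := e1
    refine (runs_parallel rows hrows _ (fun x => Q x b) (fun x y e => (injQ _ _ _ _ e).1) {tmp}
      (fun x => by simpa using Qtmp x b) (fun x => m₂ (Q x b) - t * m₂ (Q x c)) m₂ ?_).mono ?_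
    · intro x _ m' hm' hmx
      refine (runs_subProd [(T c b, Q x c)] (Qtmp x b) ?_ m').mono ?_
      · simp only [List.mem_singleton]
        rintro _ rfl
        exact ⟨(QT _ _ _ _).symm, Ttmp _ _, fun e => hcb (injQ _ _ _ _ e).2, Qtmp _ _⟩
      · rintro m'' ⟨f1, f2⟩
        refine ⟨?_, fun z hz hz' => f2 z hz hz'⟩
        rw [f1, hmx]
        simp only [List.map_cons, List.map_nil, List.sum_cons, List.sum_nil, add_zero]
        rw [hm' (T c b) (fun y => (QT _ _ _ _).symm) (Ttmp _ _),
          hm' (Q x c) (fun y e => hcb (injQ _ _ _ _ e).2) (Qtmp _ _)]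
    · rintro m₃ ⟨g1, g2⟩
      have hT3 : ∀ c', m₃ (T c' b) = m₂ (T c' b) := fun c' =>
        g2 _ (fun x _ => (QT _ _ _ _).symm) (Ttmp _ _)
      have hT2 : ∀ c', c' ≠ c → m₂ (T c' b) = m (T c' b) := fun c' hc' =>
        e2 _ (fun e => hc' (injT _ _ _ _ e).1) (Ttmp _ _)
      have frame3 : ∀ z, (∀ x, z ≠ Q x b) → (∀ c, z ≠ T c b) → z ≠ tmp → m₃ z = m₁ z := by
        intro z z1 z2 z3
        rw [g2 z (fun x _ => z1 x) z3, e2 z (z2 c) z3, hm.frame z z1 z2 z3]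
      have hcol3 := hcol m₃ frame3
      have hq3 : column Q m₃ b = column Q m b - t • column Q m c := by
        rw [← hcol2, ← hcol2]
        funext x
        exact g1 x (hmem x)
      refine ⟨frame3, ?_, ?_, ?_, ?_⟩
      · intro c' hc' hc'b
        rw [hcol3 c' hc'b.ne, hq3, hcolm c hcb, dotProduct_sub, dotProduct_smul]
        rcases Nat.lt_succ_iff_lt_or_eq.1 hc' with hlt | heq
        · have := hm.orth c' hlt hc'b
          rw [hcolm c' hc'b.ne] at this
          rw [this, hQ c' c hc'b h1, if_neg (by rintro rfl; exact lt_irrefl _ hlt)]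
          simp
        · have : c' = c := Fin.ext heq
          subst this
          rw [← hcolm c' hcb, ← htd, hcolm c' hcb, hQ c' c' h1 h1, if_pos rfl]
          simp
      · intro _
        rw [hm.before h1.le, hq3]
        have hins : (Finset.univ.filter fun c' : Fin s => c'.val < c.val + 1) =
            insert c (Finset.univ.filter fun c' : Fin s => c'.val < c.val) := by
          ext c'
          simp only [Finset.mem_filter, Finset.mem_univ, true_and, Finset.mem_insert, Fin.ext_iff]
          omega
        rw [hins, Finset.sum_insert (by simp), hT3, ← ht, hcol3 c hcb, hcolm c hcb]
        have : ∑ c' ∈ Finset.univ.filter (fun c' : Fin s => c'.val < c.val),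
            m₃ (T c' b) • column Q m₃ c' =
            ∑ c' ∈ Finset.univ.filter (fun c' : Fin s => c'.val < c.val),
            m (T c' b) • column Q m c' := by
          refine Finset.sum_congr rfl fun c' hc' => ?_
          simp only [Finset.mem_filter, Finset.mem_univ, true_and] at hc'
          have : c' ≠ b := ne_of_lt (lt_trans (show c' < c from hc') h1)
          rw [hT3, hT2 c' (by rintro rfl; exact lt_irrefl _ hc'), hcol3 c' this, hcolm c' this]
        rw [this]
        abel
      · intro hb
        exact absurd (Nat.lt_succ_iff.1 hb) (not_le.2 h1)
      · intro c' hc' hbc'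
        exact absurd (lt_of_lt_of_le (lt_trans h1 hbc') (Nat.lt_succ_iff.1 hc')) (lt_irrefl _)
  · subst h2
    have hbef := hm.before le_rfl
    have hsum : ∀ m', (∀ z, (∀ x, z ≠ Q x c) → (∀ c', z ≠ T c' c) → z ≠ tmp → m' z = m₁ z) →
        (∀ c' < c, m' (T c' c) = m (T c' c)) → ∑ c' ∈ Finset.Iio c, m' (T c' c) • column Q m' c' =
        ∑ c' ∈ Finset.univ.filter (fun c' : Fin s => c'.val < c.val),
          m (T c' c) • column Q m c' := by
      intro m' hm' hT
      have : (Finset.univ.filter fun c' : Fin s => c'.val < c.val) = Finset.Iio c := by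
        ext; simp
      rw [this]
      refine Finset.sum_congr rfl fun c' hc' => ?_
      have hlt : c' < c := Finset.mem_Iio.1 hc'
      rw [hT c' hlt, hcol m' hm' c' hlt.ne, hcolm c' hlt.ne]
    -- A vanishing remainder would put `a` into the span of the preceding columns. This is what
    -- makes the square root and the division legal.
    have hne : column Q m c ≠ 0 := by
      intro h0
      apply ha
      rw [hbef, h0, add_zero]
      refine Submodule.sum_mem _ fun c' hc' => Submodule.smul_mem _ _ ?_
      simp only [Finset.mem_filter, Finset.mem_univ, true_and] at hc'
      have hlt : c' < c := hc'
      rw [hcolm c' hlt.ne]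
      exact Submodule.subset_span ⟨c', hlt, rfl⟩
    have hpos : 0 < column Q m c ⬝ᵥ column Q m c := by
      refine lt_of_le_of_ne (Finset.sum_nonneg fun x _ => mul_self_nonneg _) ?_
      intro h0
      exact hne (dotProduct_self_eq_zero.1 h0.symm)
    rw [List.append_assoc]
    refine (runs_sumProd (rows.map fun x => (Q x c, Q x c)) (Ttmp c c) (by
      simp only [List.mem_map]
      rintro _ ⟨x, -, rfl⟩
      exact ⟨QT _ _ _ _, Qtmp _ _, QT _ _ _ _, Qtmp _ _⟩) m).append ?_
    rintro m₂ ⟨e1, e2⟩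
    rw [List.map_map, sum_map_of_nodup hrows hmem] at e1
    replace e1 : m₂ (T c c) = column Q m c ⬝ᵥ column Q m c := e1
    refine runs_cons (by simpa [Op.Defined, e1] using hpos) ?_
    set m₃ := Function.update m₂ (T c c) ((Op.sqrt (T c c)).eval m₂) with hm3
    set t := m₃ (T c c) with ht
    have htt : t * t = column Q m c ⬝ᵥ column Q m c := by
      rw [ht, hm3, Function.update_self, Op.eval, Real.mul_self_sqrt (e1 ▸ hpos.le), e1]
    have ht0 : t ≠ 0 := by rintro h0; rw [h0, zero_mul] at htt; exact hpos.ne htt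
    have hm3' : ∀ z, z ≠ T c c → z ≠ tmp → m₃ z = m z := fun z hz hz' => by
      rw [hm3, Function.update_of_ne hz, e2 z hz hz']
    have e : rows.map (fun x => (Q x c, Op.div (Q x c) (T c c))) =
      rows.flatMap fun x => [(Q x c, Op.div (Q x c) (T c c))] := List.map_eq_flatMap
    rw [e]
    change Runs (rows.flatMap _) m₃ _
    refine (runs_parallel rows hrows _ (fun x => Q x c) (fun x y e => (injQ _ _ _ _ e).1) {tmp}
      (fun x => by simpa using Qtmp x c) (fun x => m (Q x c) / t) m₃ ?_).mono ?_
    · intro x _ m' hm' hmx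
      have hT' : m' (T c c) = t := hm' _ (fun y => (QT _ _ _ _).symm) (Ttmp _ _)
      refine runs_single (by simpa [Op.Defined, hT'] using ht0) ⟨?_, fun z hz _ => ?_⟩
      · rw [Function.update_self, Op.eval, hT', hmx, hm3' _ (QT _ _ _ _) (Qtmp _ _)]
      · rw [Function.update_of_ne hz]
    · rintro m₄ ⟨g1, g2⟩
      have hT4 : ∀ c', m₄ (T c' c) = m₃ (T c' c) := fun c' =>
        g2 _ (fun x _ => (QT _ _ _ _).symm) (Ttmp _ _)
      have frame4 : ∀ z, (∀ x, z ≠ Q x c) → (∀ c', z ≠ T c' c) → z ≠ tmp → m₄ z = m₁ z := by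
        intro z z1 z2 z3
        rw [g2 z (fun x _ => z1 x) z3, hm3' z (z2 c) z3, hm.frame z z1 z2 z3]
      have hq4 : column Q m c = t • column Q m₄ c := by
        funext x
        have := g1 x (hmem x)
        simp only [column, Pi.smul_apply, smul_eq_mul, this]
        field_simp
      refine ⟨frame4, ?_, ?_, ?_, ?_⟩
      · intro c' _ hc'
        have := hm.orth c' hc' hc'
        rw [hq4, hcolm c' hc'.ne, ← hcol m₄ frame4 c' hc'.ne, dotProduct_smul, smul_eq_mul] at this
        exact (mul_eq_zero.1 this).resolve_left ht0
      · intro hcc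
        omega
      · intro _
        refine ⟨?_, by rwa [hT4], ?_⟩
        · rw [hbef, ← hsum m₄ frame4, ← Finset.Iio_insert, Finset.sum_insert (by simp), hT4 c,
            ← ht, ← hq4, add_comm]
          intro c' hc'
          rw [hT4, hm3' _ (fun e => hc'.ne (injT _ _ _ _ e).1) (Ttmp _ _)]
        · have := htt
          rw [hq4, smul_dotProduct, dotProduct_smul, smul_smul, smul_eq_mul] at this
          have ht2 : t * t ≠ 0 := mul_ne_zero ht0 ht0
          field_simp at this
          linarith
      · intro c' hc' hcc'
        exact absurd (lt_of_lt_of_le hcc' (Nat.lt_succ_iff.1 hc')) (lt_irrefl _)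
  · have hbc : b < c := lt_of_le_of_ne (not_lt.1 h1) (Ne.symm h2)
    refine runs_single trivial ?_
    set m₂ := Function.update m (T c b) ((Op.const 0).eval m) with hm2
    have hT2 : ∀ c', c' ≠ c → m₂ (T c' b) = m (T c' b) := fun c' hc' => by
      rw [hm2, Function.update_of_ne fun e => hc' (injT _ _ _ _ e).1]
    have hcol2 : ∀ c', column Q m₂ c' = column Q m c' := fun c' => funext fun x => by
      simp only [column]
      rw [hm2, Function.update_of_ne (QT _ _ _ _)]
    refine ⟨?_, ?_, ?_, ?_, ?_⟩
    · intro z z1 z2 z3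
      rw [hm2, Function.update_of_ne (z2 c), hm.frame z z1 z2 z3]
    · intro c' _ hc'
      rw [hcol2, hcol2, hm.orth c' (lt_trans hc' hbc) hc']
    · intro hcb
      exact absurd hbc (by rw [Fin.lt_def]; omega)
    · intro _
      obtain ⟨f1, f2, f3⟩ := hm.after hbc
      refine ⟨?_, by rwa [hT2 b hbc.ne], by rwa [hcol2]⟩
      rw [f1]
      refine Finset.sum_congr rfl fun c' hc' => ?_
      rw [hcol2, hT2 c' (lt_of_le_of_lt (Finset.mem_Iic.1 hc') hbc).ne]
    · intro c' hc' hbc'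
      rcases Nat.lt_succ_iff_lt_or_eq.1 hc' with hlt | heq
      · rw [hT2 c' (by rintro rfl; exact lt_irrefl _ hlt)]
        exact hm.zero c' hlt hbc'
      · have : c' = c := Fin.ext heq
        subst this
        rw [hm2, Function.update_self, Op.eval]

/-- The fourth clause of the loop invariant, that the finished columns of `Q` lie in the span of the
processed columns of `A`, turns the linear independence of the columns of `A` into the hypothesis
`ha` of each pass. -/
theorem runs_gramSchmidt (h : GramSchmidtRegs A Q T tmp) (hrows : rows.Nodup)
    (hmem : ∀ x, x ∈ rows) (m : R → ℝ) (hA : LinearIndependent ℝ (column A m)) :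
    Runs (gramSchmidt rows s A Q T tmp) m fun m' =>
      (∀ b c, ∑ x, m' (Q x b) * m' (Q x c) = if b = c then 1 else 0) ∧
      (∀ x b, m (A x b) = ∑ c, m' (Q x c) * m' (T c b)) ∧
      ∀ z, (∀ x b, z ≠ Q x b) → (∀ c b, z ≠ T c b) → z ≠ tmp → m' z = m z := by
  classical
  obtain ⟨injQ, injT, AQ, AT, Atmp, QT, Qtmp, Ttmp⟩ := id h
  refine (runs_finRange _ (fun k m' =>
    (∀ b c : Fin s, b.val < k → c.val < k →
      column Q m' b ⬝ᵥ column Q m' c = if b = c then 1 else 0) ∧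
    (∀ b : Fin s, b.val < k → column A m b = ∑ c ∈ Finset.Iic b, m' (T c b) • column Q m' c) ∧
    (∀ b c : Fin s, b.val < k → b < c → m' (T c b) = 0) ∧
    (∀ b : Fin s, b.val < k → column Q m' b ∈ Submodule.span ℝ (column A m '' {c | c.val < k})) ∧
    ∀ z, (∀ x b, z ≠ Q x b) → (∀ c b, z ≠ T c b) → z ≠ tmp → m' z = m z) ?_
    (by simp)).mono ?_
  · rintro b m₁ ⟨i1, i2, i3, i4, i5⟩
    have hA1 : column A m₁ = column A m := funext fun c => funext fun x =>
      i5 _ (AQ x c) (AT x c) (Atmp x c)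
    have e : rows.map (fun x => (Q x b, Op.copy (A x b))) =
      rows.flatMap fun x => [(Q x b, Op.copy (A x b))] := List.map_eq_flatMap
    rw [e]
    refine (runs_parallel rows hrows _ (fun x => Q x b) (fun x y e => (injQ _ _ _ _ e).1) {tmp}
      (fun x => by simpa using Qtmp x b) (fun x => m₁ (A x b)) m₁ ?_).append ?_
    · intro x _ m' hm' _
      refine runs_single trivial ⟨?_, fun z hz _ => ?_⟩
      · rw [Function.update_self, Op.eval, hm' _ (fun y => AQ _ _ _ _) (Atmp _ _)]
      · rw [Function.update_of_ne hz]
    rintro m₂ ⟨g1, g2⟩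
    have hq2 : column Q m₂ b = column A m b := by
      rw [← hA1]; exact funext fun x => g1 x (hmem x)
    have hq2' : ∀ c, c ≠ b → column Q m₂ c = column Q m₁ c := fun c hc => funext fun x =>
      g2 _ (fun y _ e => hc (injQ _ _ _ _ e).2) (Qtmp _ _)
    have hspan : Submodule.span ℝ (column Q m₂ '' {c | c < b}) ≤
        Submodule.span ℝ (column A m '' {c | c < b}) := by
      refine Submodule.span_le.2 ?_
      rintro _ ⟨c, hc, rfl⟩
      rw [hq2' c (ne_of_lt hc)]
      exact i4 c hc
    refine (runs_finRange _ (GramSchmidtState Q T tmp b (column A m b) m₂)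
      (fun c m' hm' => runs_gramSchmidt_step h hrows hmem b _ m₂ ?_ ?_ c m' hm') ?_).mono ?_
    · intro c c' hc hc'
      rw [hq2' c hc.ne, hq2' c' hc'.ne]
      exact i1 c c' hc hc'
    · intro hmem'
      exact hA.notMem_span_image (s := {c | c < b}) (x := b) (by simp) (hspan hmem')
    · refine ⟨fun _ _ _ _ => rfl, by simp, fun _ => by simp [hq2], by simp, by simp⟩
    · rintro m₃ hm3
      obtain ⟨k1, k2, k3⟩ := hm3.after b.isLt
      have hq3 : ∀ c, c ≠ b → column Q m₃ c = column Q m₁ c := fun c hc => by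
        rw [← hq2' c hc]
        exact funext fun x => hm3.frame _ (fun y e => hc (injQ _ _ _ _ e).2)
          (fun c => QT _ _ _ _) (Qtmp _ _)
      have hT3 : ∀ c c', c' ≠ b → m₃ (T c c') = m₁ (T c c') := fun c c' hc' => by
        rw [hm3.frame _ (fun y => (QT _ _ _ _).symm) (fun d e => hc' (injT _ _ _ _ e).2)
          (Ttmp _ _), g2 _ (fun y _ => (QT _ _ _ _).symm) (Ttmp _ _)]
      refine ⟨?_, ?_, ?_, ?_, ?_⟩
      · intro c c' hc hc'
        rcases Nat.lt_succ_iff_lt_or_eq.1 hc with hlt | heq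
        · rcases Nat.lt_succ_iff_lt_or_eq.1 hc' with hlt' | heq'
          · rw [hq3 c (ne_of_lt hlt), hq3 c' (ne_of_lt hlt')]
            exact i1 c c' hlt hlt'
          · obtain rfl : c' = b := Fin.ext heq'
            rw [hm3.orth c c.isLt hlt, if_neg (ne_of_lt (show c < c' from hlt))]
        · obtain rfl : c = b := Fin.ext heq
          rcases Nat.lt_succ_iff_lt_or_eq.1 hc' with hlt' | heq'
          · rw [dotProduct_comm, hm3.orth c' c'.isLt hlt',
              if_neg (ne_of_gt (show c' < c from hlt'))]
          · obtain rfl : c' = c := Fin.ext heq'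
            rw [k3, if_pos rfl]
      · intro c hc
        rcases Nat.lt_succ_iff_lt_or_eq.1 hc with hlt | heq
        · rw [i2 c hlt]
          refine Finset.sum_congr rfl fun d hd => ?_
          have hdb : d ≠ b := ne_of_lt (lt_of_le_of_lt (Finset.mem_Iic.1 hd) hlt)
          rw [hq3 d hdb, hT3 d c (ne_of_lt hlt)]
        · obtain rfl : c = b := Fin.ext heq
          exact k1
      · intro c d hc hcd
        rcases Nat.lt_succ_iff_lt_or_eq.1 hc with hlt | heq
        · rw [hT3 d c (ne_of_lt hlt)]
          exact i3 c d hlt hcd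
        · obtain rfl : c = b := Fin.ext heq
          exact hm3.zero d d.isLt hcd
      · have hmono : Submodule.span ℝ (column A m '' {c | c.val < b.val}) ≤
            Submodule.span ℝ (column A m '' {c | c.val < b.val + 1}) :=
          Submodule.span_mono (Set.image_mono fun c hc => Nat.lt_succ_of_lt hc)
        have hlow : ∀ c : Fin s, c.val < b.val →
            column Q m₃ c ∈ Submodule.span ℝ (column A m '' {c | c.val < b.val + 1}) := by
          intro c hlt
          rw [hq3 c (ne_of_lt hlt)]
          exact hmono (i4 c hlt)
        intro c hc
        rcases Nat.lt_succ_iff_lt_or_eq.1 hc with hlt | heq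
        · exact hlow c hlt
        · obtain rfl : c = b := Fin.ext heq
          rw [← Finset.Iio_insert, Finset.sum_insert (by simp)] at k1
          have : m₃ (T c c) • column Q m₃ c = column A m c -
              ∑ d ∈ Finset.Iio c, m₃ (T d c) • column Q m₃ d := by rw [k1]; abel
          -- The diagonal entry of `T` is nonzero, so the new column of `Q` can be solved for.
          rw [← Submodule.smul_mem_iff _ k2, this]
          refine Submodule.sub_mem _ (Submodule.subset_span ⟨c, by simp, rfl⟩) ?_
          exact Submodule.sum_mem _ fun d hd =>
            Submodule.smul_mem _ _ (hlow d (Fin.lt_def.1 (Finset.mem_Iio.1 hd)))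
      · intro z z1 z2 z3
        rw [hm3.frame z (fun x => z1 x b) (fun c => z2 c b) z3, g2 z (fun x _ => z1 x b) z3,
          i5 z z1 z2 z3]
  · rintro m' ⟨i1, i2, i3, -, i5⟩
    refine ⟨fun b c => i1 b c b.isLt c.isLt, fun x b => ?_, i5⟩
    have := congrFun (i2 b b.isLt) x
    simp only [Finset.sum_apply, Pi.smul_apply, smul_eq_mul, column] at this
    rw [this]
    -- `T` is upper triangular, so the terms with `c > b` vanish.
    refine Finset.sum_subset_zero_on_sdiff (Finset.subset_univ _) ?_ fun c _ => mul_comm _ _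
    intro c hc
    rw [i3 b c b.isLt (by simpa using hc), mul_zero]

end GramSchmidt

end TTGrad

namespace TTGrad

/-! ### Tensor-train algebra -/

section TTAlgebra

open Matrix

variable {d : ℕ} {n : Fin d → ℕ} {r : Fin (d - 1) → ℕ}

theorem bond_zero (r : Fin (d - 1) → ℕ) : bond r 0 = 1 := by simp [bond]

theorem bond_self (r : Fin (d - 1) → ℕ) : bond r d = 1 := by simp [bond]

theorem bond_succ (r : Fin (d - 1) → ℕ) (k : Fin (d - 1)) : bond r (k.val + 1) = r k := by
  have := k.isLt
  simp [bond, show k.val + 1 < d by omega]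

theorem bond_two_nsmul (r : Fin (d - 1) → ℕ) (k : ℕ) (h0 : 0 < k) (hd : k < d) :
    bond (2 • r) k = bond r k + bond r k := by
  simp [bond, h0, hd, two_mul]

/-- The column vector `G_{k+1}[i_{k+1}] ⋯ G_d[i_d]`, with `m = d - k`. -/
noncomputable def suffixProdAux (G : Cores n r) (i : (k : Fin d) → Fin (n k)) :
    (m k : ℕ) → k + m = d → (Fin (bond r k) → ℝ)
  | 0, _, _ => fun _ => 1
  | m + 1, k, h =>
      G ⟨k, by omega⟩ (i ⟨k, by omega⟩) *ᵥ suffixProdAux G i m (k + 1) (by omega)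

/-- The column vector `G_{k+1}[i_{k+1}] ⋯ G_d[i_d]`. -/
noncomputable def suffixProd (G : Cores n r) (i : (k : Fin d) → Fin (n k)) (k : ℕ) (hk : k ≤ d) :
    Fin (bond r k) → ℝ :=
  suffixProdAux G i (d - k) k (by omega)

/-- The recursion runs on the number `m` of remaining cores; this lemma replaces `d - k` by a
successor so that the recursion unfolds. -/
theorem suffixProdAux_congr (G : Cores n r) (i : (k : Fin d) → Fin (n k)) {m m' k : ℕ}
    (h : k + m = d) (h' : k + m' = d) : suffixProdAux G i m k h = suffixProdAux G i m' k h' := by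
  obtain rfl : m = m' := by omega
  rfl

theorem suffixProd_self (G : Cores n r) (i : (k : Fin d) → Fin (n k)) :
    suffixProd G i d le_rfl = fun _ => 1 :=
  suffixProdAux_congr G i (m' := 0) _ rfl

theorem suffixProd_eq (G : Cores n r) (i : (k : Fin d) → Fin (n k)) (k : Fin d) :
    suffixProd G i k k.isLt.le = G k (i k) *ᵥ suffixProd G i (k + 1) k.isLt :=
  suffixProdAux_congr G i (m' := d - (k + 1) + 1) _ (by omega)

theorem partialProd_zero (G : Cores n r) (i : (k : Fin d) → Fin (n k)) (h : 0 ≤ d) :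
    partialProd G i 0 h = fun _ => 1 := rfl

theorem partialProd_succ (G : Cores n r) (i : (k : Fin d) → Fin (n k)) (k : Fin d) :
    partialProd G i (k + 1) k.isLt = partialProd G i k k.isLt.le ᵥ* G k (i k) := rfl

theorem partialProd_congr {G H : Cores n r} {i i' : (k : Fin d) → Fin (n k)} (k : ℕ) (hk : k ≤ d)
    (h : ∀ j : Fin d, j.val < k → G j (i j) = H j (i' j)) :
    partialProd G i k hk = partialProd H i' k hk := by
  induction k with
  | zero => rfl
  | succ k ih =>
    rw [partialProd_succ G i ⟨k, hk⟩, partialProd_succ H i' ⟨k, hk⟩, h ⟨k, hk⟩ (Nat.lt_succ_self k)]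
    simp only
    rw [ih (by omega) fun j hj => h j (by omega)]

/-- Induction from `d` down to `0`. -/
theorem decreasing_induction {d : ℕ} {P : (k : ℕ) → k ≤ d → Prop} (hd : P d le_rfl)
    (step : ∀ k : Fin d, P (k + 1) k.isLt → P k k.isLt.le) (k : ℕ) (hk : k ≤ d) : P k hk := by
  obtain ⟨m, hm⟩ : ∃ m, k + m = d := ⟨d - k, by omega⟩
  induction m generalizing k with
  | zero => obtain rfl : k = d := by omega
            exact hd
  | succ m ih => exact step ⟨k, by omega⟩ (ih (k + 1) (by omega) (by omega))

theorem suffixProd_congr {G H : Cores n r} {i i' : (k : Fin d) → Fin (n k)} (k : ℕ) (hk : k ≤ d)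
    (h : ∀ j : Fin d, k ≤ j.val → G j (i j) = H j (i' j)) :
    suffixProd G i k hk = suffixProd H i' k hk := by
  revert h
  refine decreasing_induction (P := fun k hk => (∀ j : Fin d, k ≤ j.val → G j (i j) = H j (i' j)) →
    suffixProd G i k hk = suffixProd H i' k hk) ?_ ?_ k hk
  · intro _
    rw [suffixProd_self, suffixProd_self]
  · intro k ih h
    rw [suffixProd_eq, suffixProd_eq, h k le_rfl, ih fun j hj => h j (by omega)]

/-- The product of the cores may be cut at any bond; moving the cut past one core is associativity.
-/
theorem tensor_apply (G : Cores n r) (i : (k : Fin d) → Fin (n k)) (k : ℕ) (hk : k ≤ d) :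
    tensor G i = partialProd G i k hk ⬝ᵥ suffixProd G i k hk := by
  refine decreasing_induction (P := fun k hk =>
    tensor G i = partialProd G i k hk ⬝ᵥ suffixProd G i k hk) ?_ ?_ k hk
  · simp [tensor, suffixProd_self, dotProduct]
  · intro k ih
    rw [ih, partialProd_succ, suffixProd_eq, dotProduct_mulVec]

theorem tensor_congr {G H : Cores n r} (h : ∀ k i, G k i = H k i) : tensor G = tensor H := by
  have : G = H := by funext k i; exact h k i
  rw [this]

/-- A tensor does not change when two neighbouring cores are changed and their products are not. -/
theorem tensor_eq_of_mul_eq {G H : Cores n r} (k : Fin (d - 1))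
    (h : ∀ j, j ≠ lo k → j ≠ hi k → ∀ i, G j i = H j i)
    (hmul : ∀ (i : Fin (n (lo k))) (i' : Fin (n (hi k))) (a : Fin (bond r k.val))
      (b : Fin (bond r (k.val + 1 + 1))),
      ∑ c : Fin (bond r (k.val + 1)), G (lo k) i a c * G (hi k) i' c b =
      ∑ c : Fin (bond r (k.val + 1)), H (lo k) i a c * H (hi k) i' c b) :
    tensor G = tensor H := by
  ext i
  have hk : k.val ≤ d := by omega
  have hk' : k.val + 1 + 1 ≤ d := by omega
  have key : ∀ K : Cores n r, tensor K i = partialProd K i k.val hk ⬝ᵥ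
      ((Matrix.of fun a b => ∑ c : Fin (bond r (k.val + 1)),
        K (lo k) (i (lo k)) a c * K (hi k) (i (hi k)) c b) *ᵥ
        suffixProd K i (k.val + 1 + 1) hk') := by
    intro K
    rw [tensor_apply K i k.val hk]
    refine congrArg (fun w => partialProd K i k.val hk ⬝ᵥ w) ?_
    refine (suffixProd_eq K i (lo k)).trans ?_
    refine (congrArg (fun w => K (lo k) (i (lo k)) *ᵥ w) (suffixProd_eq K i (hi k))).trans ?_
    exact mulVec_mulVec _ (K (lo k) (i (lo k))) (K (hi k) (i (hi k)))
  have h1 : partialProd G i k.val hk = partialProd H i k.val hk := by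
    refine partialProd_congr _ _ fun j hj => h j ?_ ?_ _ <;> rw [Ne, Fin.ext_iff] <;>
      simp only [lo, hi] <;> omega
  have h2 : suffixProd G i (k.val + 1 + 1) hk' = suffixProd H i (k.val + 1 + 1) hk' := by
    refine suffixProd_congr _ _ fun j hj => h j ?_ ?_ _ <;> rw [Ne, Fin.ext_iff] <;>
      simp only [lo, hi] <;> omega
  rw [key, key, h1, h2]
  congr 3
  ext a b
  exact hmul _ _ _ _

/-- The cores of the representation that is orthogonal at the core `μ`. -/
def mixedCores (U S V : Cores n r) (μ : Fin d) : Cores n r :=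
  fun k => if k < μ then U k else if k = μ then S k else V k

/-- The entries of `U₁ ⋯ U_{k-1} R_k V_{k+1} ⋯ V_d`. -/
noncomputable def tangentTerm (U V R : Cores n r) (k : Fin d) (i : (k : Fin d) → Fin (n k)) : ℝ :=
  partialProd U i k k.isLt.le ⬝ᵥ (R k (i k) *ᵥ suffixProd V i (k + 1) k.isLt)

theorem tensor_mixedCores (U S V : Cores n r) (k : Fin d) (i : (k : Fin d) → Fin (n k)) :
    tensor (mixedCores U S V k) i = tangentTerm U V S k i := by
  rw [tensor_apply _ _ k k.isLt.le, suffixProd_eq, tangentTerm,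
    partialProd_congr (H := U) (i' := i), suffixProd_congr (H := V) (i' := i)]
  · simp [mixedCores]
  · intro j hj
    have h1 : ¬ j < k := by rw [Fin.lt_def]; omega
    have h2 : j ≠ k := by rw [Ne, Fin.ext_iff]; omega
    simp [mixedCores, h1, h2]
  · intro j hj
    simp [mixedCores, Fin.lt_def, hj]

/-! The block cores. -/

theorem splitBond_injective (r : Fin (d - 1) → ℕ) (k : ℕ) (h0 : 0 < k) :
    Function.Injective (splitBond r k) := by
  intro a b h
  unfold splitBond at h
  rw [dif_neg h0.ne', dif_neg h0.ne'] at h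
  split_ifs at h with h1 h2 h2 <;> simp only [Sum.inl.injEq, Sum.inr.injEq, Fin.mk.injEq,
    reduceCtorEq] at h <;> apply Fin.ext <;> omega

theorem splitBond_bijective (r : Fin (d - 1) → ℕ) (k : ℕ) (h0 : 0 < k) (hd : k < d) :
    Function.Bijective (splitBond r k) := by
  rw [Fintype.bijective_iff_injective_and_card]
  exact ⟨splitBond_injective r k h0, by
    simp only [Fintype.card_fin, Fintype.card_sum]
    exact bond_two_nsmul r k h0 hd⟩

theorem splitBond_zero (r : Fin (d - 1) → ℕ) (a : Fin (bond (2 • r) 0)) :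
    ∃ b, splitBond r 0 a = .inr b := ⟨_, by rw [splitBond, dif_pos rfl]⟩

theorem splitBond_self (hd : 0 < d) (r : Fin (d - 1) → ℕ) (a : Fin (bond (2 • r) d)) :
    ∃ b, splitBond r d a = .inl b := by
  have h : a.val < bond r d := by
    have := a.isLt
    have h1 := bond_self r
    have h2 := bond_self (2 • r)
    omega
  exact ⟨_, by rw [splitBond, dif_neg hd.ne', dif_pos h]⟩

/-- At an interior bond the doubled index runs bijectively over both blocks. The bond `0` has only
the second block, hence the condition `h0` that the first block contributes nothing there. -/
theorem sum_splitBond (r : Fin (d - 1) → ℕ) (k : ℕ) (hd : k < d)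
    (φ : Fin (bond r k) ⊕ Fin (bond r k) → ℝ) (h0 : k = 0 → ∀ a, φ (.inl a) = 0) :
    ∑ a, φ (splitBond r k a) = ∑ a, φ (.inl a) + ∑ a, φ (.inr a) := by
  rcases Nat.eq_zero_or_pos k with rfl | hk
  · have : Subsingleton (Fin (bond r 0)) := by rw [bond_zero]; infer_instance
    have hc : Fintype.card (Fin (bond (2 • r) 0)) = 1 := by simp [bond_zero]
    have hc' : Fintype.card (Fin (bond r 0)) = 1 := by simp [bond_zero]
    rw [Finset.sum_eq_zero (s := Finset.univ) (f := fun a => φ (.inl a)) fun a _ => h0 rfl a,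
      zero_add]
    obtain ⟨b, hb⟩ := splitBond_zero r (Fin.cast (bond_zero (2 • r)).symm 0)
    have e1 : ∀ a, φ (splitBond r 0 a) = φ (.inr b) := by
      intro a
      obtain ⟨c, hc⟩ := splitBond_zero r a
      rw [hc, Subsingleton.elim c b]
    have e2 : ∀ a, φ (.inr a) = φ (.inr b) := fun a => by rw [Subsingleton.elim a b]
    simp only [e1, e2, Finset.sum_const, Finset.card_univ, hc, hc']
  · rw [(splitBond_bijective r k hk hd).sum_comp φ, Fintype.sum_sum_type]

/-- The row vectors `∑_{j ≤ k} U₁ ⋯ U_{j-1} R_j V_{j+1} ⋯ V_k`. -/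
noncomputable def tangentPartial (U V R : Cores n r) (i : (k : Fin d) → Fin (n k)) :
    (k : ℕ) → k ≤ d → (Fin (bond r k) → ℝ)
  | 0, _ => 0
  | k + 1, h => tangentPartial U V R i k (Nat.le_of_succ_le h) ᵥ* V ⟨k, h⟩ (i ⟨k, h⟩) +
      partialProd U i k (Nat.le_of_succ_le h) ᵥ* R ⟨k, h⟩ (i ⟨k, h⟩)

/-- Block multiplication: `[t p] [V 0; R U] = [t V + p R, p U]`, where `t` is the partial sum of
tangent terms and `p` the product of the cores `U`. The start is the second block alone, with `t =
0` and `p = 1`. -/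
theorem partialProd_blockCores (R U V : Cores n r) (i : (k : Fin d) → Fin (n k)) (k : ℕ)
    (hk : k ≤ d) (a : Fin (bond (2 • r) k)) :
    partialProd (blockCores R U V) i k hk a =
      Sum.elim (tangentPartial U V R i k hk) (partialProd U i k hk) (splitBond r k a) := by
  induction k with
  | zero =>
    obtain ⟨b, hb⟩ := splitBond_zero r a
    rw [hb]
    rfl
  | succ k ih =>
    rw [partialProd_succ _ i ⟨k, hk⟩, vecMul, dotProduct]
    simp only [ih (by omega)]
    have e : ∀ x : Fin (bond (2 • r) k), blockCores R U V ⟨k, hk⟩ (i ⟨k, hk⟩) x a =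
        match splitBond r k x, splitBond r (k + 1) a with
        | .inl a, .inl b => V ⟨k, hk⟩ (i ⟨k, hk⟩) a b
        | .inl _, .inr _ => 0
        | .inr a, .inl b => R ⟨k, hk⟩ (i ⟨k, hk⟩) a b
        | .inr a, .inr b => U ⟨k, hk⟩ (i ⟨k, hk⟩) a b := by
      intro x
      simp only [blockCores, Cores.ofEntries, blockEntry, Matrix.of_apply]
      rcases splitBond r k x with _ | _ <;> rcases splitBond r (k + 1) a with _ | _ <;> rfl
    simp only [e]
    generalize splitBond r (k + 1) a = y
    rw [sum_splitBond r k hk (fun x =>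
      Sum.elim (tangentPartial U V R i k (by omega)) (partialProd U i k (by omega)) x *
        match x, y with
        | .inl a, .inl b => V ⟨k, hk⟩ (i ⟨k, hk⟩) a b
        | .inl _, .inr _ => 0
        | .inr a, .inl b => R ⟨k, hk⟩ (i ⟨k, hk⟩) a b
        | .inr a, .inr b => U ⟨k, hk⟩ (i ⟨k, hk⟩) a b)]
    · rcases y with b | b
      · rfl
      · simp only [Sum.elim_inl, mul_zero, Finset.sum_const_zero, zero_add, Sum.elim_inr]
        rfl
    · rintro rfl x
      simp [tangentPartial]

theorem tensor_blockCores (hd : 0 < d) (R U V : Cores n r) (i : (k : Fin d) → Fin (n k)) :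
    tensor (blockCores R U V) i = ∑ k, tangentTerm U V R k i := by
  -- Completing the partial sum at bond `k` with the remaining cores `V` gives the first `k` tangent
  -- terms; at `k = d` nothing remains to be multiplied.
  have key : ∀ (k : ℕ) (hk : k ≤ d), tangentPartial U V R i k hk ⬝ᵥ suffixProd V i k hk =
      ∑ j : Fin d with j.val < k, tangentTerm U V R j i := by
    intro k hk
    induction k with
    | zero => simp [tangentPartial]
    | succ k ih =>
      have hins : (Finset.univ.filter fun j : Fin d => j.val < k + 1) =
          insert ⟨k, hk⟩ (Finset.univ.filter fun j : Fin d => j.val < k) := by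
        ext j
        simp only [Finset.mem_filter, Finset.mem_univ, true_and, Finset.mem_insert, Fin.ext_iff]
        omega
      rw [hins, Finset.sum_insert (by simp), ← ih (by omega), suffixProd_eq V i ⟨k, hk⟩,
        tangentTerm, tangentPartial, add_dotProduct, add_comm, dotProduct_mulVec, dotProduct_mulVec]
  have h := key d le_rfl
  rw [suffixProd_self] at h
  simp only [Fin.is_lt, Finset.filter_true] at h
  rw [← h, tensor]
  change ∑ b, partialProd (blockCores R U V) i d le_rfl b = _
  have hc : Fintype.card (Fin (bond (2 • r) d)) = 1 := by simp [bond_self]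
  have hc' : Fintype.card (Fin (bond r d)) = 1 := by simp [bond_self]
  have : Subsingleton (Fin (bond r d)) := by rw [bond_self]; infer_instance
  obtain ⟨b, hb⟩ := splitBond_self hd r (Fin.cast (bond_self (2 • r)).symm 0)
  have e1 : ∀ a, partialProd (blockCores R U V) i d le_rfl a =
      tangentPartial U V R i d le_rfl b := by
    intro a
    rw [partialProd_blockCores]
    obtain ⟨c, hc⟩ := splitBond_self hd r a
    rw [hc, Subsingleton.elim c b, Sum.elim_inl]
  have e2 : ∀ a, tangentPartial U V R i d le_rfl a = tangentPartial U V R i d le_rfl b :=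
    fun a => by rw [Subsingleton.elim a b]
  simp only [e1, dotProduct, e2, mul_one, Finset.sum_const, Finset.card_univ, hc, hc']

end TTAlgebra

end TTGrad

namespace TTGrad

/-! ### Partial sums over the first or the last indices, and orthogonality relations -/

section PartialSums

open Matrix

variable {d : ℕ} {n : Fin d → ℕ} {r : Fin (d - 1) → ℕ}

/-- The sum over the first `k` indices. -/
noncomputable def lsum (k : ℕ) (φ : ((k : Fin d) → Fin (n k)) → ℝ) (i : (k : Fin d) → Fin (n k)) :
    ℝ :=
  ∑ x with ∀ j : Fin d, k ≤ j.val → x j = i j, φ x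

/-- The sum over all indices but the first `k`. -/
noncomputable def rsum (k : ℕ) (φ : ((k : Fin d) → Fin (n k)) → ℝ) (i : (k : Fin d) → Fin (n k)) :
    ℝ :=
  ∑ x with ∀ j : Fin d, j.val < k → x j = i j, φ x

/-- The function depends only on the indices from `k` on. -/
def DependsFrom {β : Type*} (k : ℕ) (φ : ((k : Fin d) → Fin (n k)) → β) : Prop :=
  ∀ x y, (∀ j : Fin d, k ≤ j.val → x j = y j) → φ x = φ y

theorem dependsFrom_suffixProd (G : Cores n r) (k : ℕ) (hk : k ≤ d) :
    DependsFrom k fun i => suffixProd G i k hk := fun x y h =>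
  suffixProd_congr k hk fun j hj => by rw [h j hj]

theorem lsum_zero (φ : ((k : Fin d) → Fin (n k)) → ℝ) (i : (k : Fin d) → Fin (n k)) :
    lsum 0 φ i = φ i := by
  have : (Finset.univ.filter fun x : (k : Fin d) → Fin (n k) =>
      ∀ j : Fin d, 0 ≤ j.val → x j = i j) = {i} := by
    ext x; simp [funext_iff]
  rw [lsum, this, Finset.sum_singleton]

theorem rsum_self (φ : ((k : Fin d) → Fin (n k)) → ℝ) (i : (k : Fin d) → Fin (n k)) :
    rsum d φ i = φ i := by
  have : (Finset.univ.filter fun x : (k : Fin d) → Fin (n k) =>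
      ∀ j : Fin d, j.val < d → x j = i j) = {i} := by
    ext x; simp [funext_iff]
  rw [rsum, this, Finset.sum_singleton]

theorem lsum_congr {k : ℕ} {φ ψ : ((k : Fin d) → Fin (n k)) → ℝ} {i : (k : Fin d) → Fin (n k)}
    (h : ∀ x, (∀ j : Fin d, k ≤ j.val → x j = i j) → φ x = ψ x) : lsum k φ i = lsum k ψ i :=
  Finset.sum_congr rfl fun x hx => h x (by simpa using hx)

theorem lsum_sum {ι : Type*} (s : Finset ι) (k : ℕ) (φ : ι → ((k : Fin d) → Fin (n k)) → ℝ)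
    (i : (k : Fin d) → Fin (n k)) :
    lsum k (fun x => ∑ a ∈ s, φ a x) i = ∑ a ∈ s, lsum k (φ a) i :=
  Finset.sum_comm

theorem rsum_sum {ι : Type*} (s : Finset ι) (k : ℕ) (φ : ι → ((k : Fin d) → Fin (n k)) → ℝ)
    (i : (k : Fin d) → Fin (n k)) :
    rsum k (fun x => ∑ a ∈ s, φ a x) i = ∑ a ∈ s, rsum k (φ a) i :=
  Finset.sum_comm

theorem lsum_const_mul (k : ℕ) (c : ℝ) (φ : ((k : Fin d) → Fin (n k)) → ℝ)
    (i : (k : Fin d) → Fin (n k)) : lsum k (fun x => c * φ x) i = c * lsum k φ i := by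
  rw [lsum, ← Finset.mul_sum]; rfl

theorem rsum_const_mul (k : ℕ) (c : ℝ) (φ : ((k : Fin d) → Fin (n k)) → ℝ)
    (i : (k : Fin d) → Fin (n k)) : rsum k (fun x => c * φ x) i = c * rsum k φ i := by
  rw [rsum, ← Finset.mul_sum]; rfl

theorem lsum_mul_of_dependsFrom {k : ℕ} {ψ : ((k : Fin d) → Fin (n k)) → ℝ}
    (hψ : DependsFrom k ψ) (φ : ((k : Fin d) → Fin (n k)) → ℝ) (i : (k : Fin d) → Fin (n k)) :
    lsum k (fun x => ψ x * φ x) i = ψ i * lsum k φ i := by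
  rw [← lsum_const_mul]
  exact lsum_congr fun x hx => by rw [hψ x i hx]

theorem dependsFrom_lsum (k : ℕ) (φ : ((k : Fin d) → Fin (n k)) → ℝ) :
    DependsFrom k (lsum k φ) := fun x y h => by
  unfold lsum
  congr 1
  ext z
  simp only [Finset.mem_filter, Finset.mem_univ, true_and]
  exact ⟨fun hz j hj => (hz j hj).trans (h j hj), fun hz j hj => (hz j hj).trans (h j hj).symm⟩

theorem rsum_congr_left {k : ℕ} (φ : ((k : Fin d) → Fin (n k)) → ℝ)
    {x y : (k : Fin d) → Fin (n k)} (h : ∀ j : Fin d, j.val < k → x j = y j) :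
    rsum k φ x = rsum k φ y := by
  unfold rsum
  congr 1
  ext z
  simp only [Finset.mem_filter, Finset.mem_univ, true_and]
  exact ⟨fun hz j hj => (hz j hj).trans (h j hj), fun hz j hj => (hz j hj).trans (h j hj).symm⟩

theorem lsum_succ (k : Fin d) (φ : ((k : Fin d) → Fin (n k)) → ℝ) (i : (k : Fin d) → Fin (n k)) :
    lsum (k + 1) φ i = ∑ v, lsum k φ (Function.update i k v) := by
  unfold lsum
  rw [← Finset.sum_fiberwise _ (fun x => x k)]
  refine Finset.sum_congr rfl fun v _ => Finset.sum_congr ?_ fun _ _ => rfl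
  ext x
  simp only [Finset.mem_filter, Finset.mem_univ, true_and]
  constructor
  · rintro ⟨h, rfl⟩ j hj
    by_cases hjk : j = k
    · subst hjk; simp
    · rw [Function.update_of_ne hjk]
      exact h j (Nat.succ_le_of_lt (lt_of_le_of_ne hj fun e => hjk (Fin.ext e.symm)))
  · intro h
    refine ⟨fun j hj => ?_, by simpa using h k le_rfl⟩
    have hjk : j ≠ k := by rintro rfl; omega
    simpa [hjk] using h j (by omega)

theorem rsum_eq_sum_succ (k : Fin d) (φ : ((k : Fin d) → Fin (n k)) → ℝ)
    (i : (k : Fin d) → Fin (n k)) :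
    rsum k φ i = ∑ v, rsum (k + 1) φ (Function.update i k v) := by
  unfold rsum
  rw [← Finset.sum_fiberwise _ (fun x => x k)]
  refine Finset.sum_congr rfl fun v _ => Finset.sum_congr ?_ fun _ _ => rfl
  ext x
  simp only [Finset.mem_filter, Finset.mem_univ, true_and]
  constructor
  · rintro ⟨h, rfl⟩ j hj
    by_cases hjk : j = k
    · subst hjk; simp
    · rw [Function.update_of_ne hjk]
      exact h j (lt_of_le_of_ne (Nat.lt_succ_iff.1 hj) fun e => hjk (Fin.ext e))
  · intro h
    refine ⟨fun j hj => ?_, by simpa using h k (Nat.lt_succ_self _)⟩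
    have hjk : j ≠ k := by rintro rfl; omega
    simpa [hjk] using h j (by omega)

/-- A multi-index is a pair of a left and a right part. -/
def cut (n : Fin d → ℕ) (k : ℕ) : ((j : Fin d) → Fin (n j)) ≃
    ((j : {j : Fin d // j.val < k}) → Fin (n j.val)) ×
      ((j : {j : Fin d // ¬ j.val < k}) → Fin (n j.val)) :=
  Equiv.piEquivPiSubtypeProd (fun j : Fin d => j.val < k) (fun j => Fin (n j))

theorem cut_symm_of_lt {k : ℕ} (x : (j : {j : Fin d // j.val < k}) → Fin (n j.val))
    (y : (j : {j : Fin d // ¬ j.val < k}) → Fin (n j.val)) {j : Fin d} (hj : j.val < k) :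
    (cut n k).symm (x, y) j = x ⟨j, hj⟩ := by
  simp [cut, Equiv.piEquivPiSubtypeProd, hj]

theorem cut_symm_of_le {k : ℕ} (x : (j : {j : Fin d // j.val < k}) → Fin (n j.val))
    (y : (j : {j : Fin d // ¬ j.val < k}) → Fin (n j.val)) {j : Fin d} (hj : k ≤ j.val) :
    (cut n k).symm (x, y) j = y ⟨j, not_lt.2 hj⟩ := by
  simp [cut, Equiv.piEquivPiSubtypeProd, not_lt.2 hj]

theorem lsum_eq_sum_cut (k : ℕ) (φ : ((k : Fin d) → Fin (n k)) → ℝ)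
    (i : (k : Fin d) → Fin (n k)) :
    lsum k φ i = ∑ x, φ ((cut n k).symm (x, (cut n k i).2)) := by
  unfold lsum
  refine Finset.sum_bij' (fun z _ => (cut n k z).1)
    (fun x _ => (cut n k).symm (x, (cut n k i).2)) (by simp) ?_ ?_ (by simp) ?_
  · intro x _
    simp only [Finset.mem_filter, Finset.mem_univ, true_and]
    intro j hj
    rw [cut_symm_of_le _ _ hj]; rfl
  all_goals
    intro z hz
    simp only [Finset.mem_filter, Finset.mem_univ, true_and] at hz
    have : (cut n k z).2 = (cut n k i).2 := funext fun j => hz j.1 (not_lt.1 j.2)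
    simp [← this]

theorem rsum_eq_sum_cut (k : ℕ) (φ : ((k : Fin d) → Fin (n k)) → ℝ)
    (i : (k : Fin d) → Fin (n k)) :
    rsum k φ i = ∑ y, φ ((cut n k).symm ((cut n k i).1, y)) := by
  unfold rsum
  refine Finset.sum_bij' (fun z _ => (cut n k z).2)
    (fun y _ => (cut n k).symm ((cut n k i).1, y)) (by simp) ?_ ?_ (by simp) ?_
  · intro x _
    simp only [Finset.mem_filter, Finset.mem_univ, true_and]
    intro j hj
    rw [cut_symm_of_lt _ _ hj]; rfl
  all_goals
    intro z hz
    simp only [Finset.mem_filter, Finset.mem_univ, true_and] at hz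
    have : (cut n k z).1 = (cut n k i).1 := funext fun j => hz j.1 j.2
    simp [← this]

/-- Partial sums are kept as functions of the full multi-index, so the total sum is evaluated at an
arbitrary base index `i`, on which it does not depend. -/
theorem sum_eq_rsum_lsum (k : ℕ) (φ : ((k : Fin d) → Fin (n k)) → ℝ)
    (i : (k : Fin d) → Fin (n k)) : ∑ x, φ x = rsum k (lsum k φ) i := by
  rw [rsum_eq_sum_cut]
  simp only [lsum_eq_sum_cut, Equiv.apply_symm_apply]
  rw [← (cut n k).symm.sum_comp, Fintype.sum_prod_type_right]

/-! Orthogonality relations. -/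

/-- All cores of `U` but the last one are left-orthogonal. -/
def LeftOrthogonal (U : Cores n r) : Prop :=
  ∀ k : Fin d, k.val + 1 < d → ∑ i, (U k i)ᵀ * U k i = 1

/-- All cores of `V` but the first one are right-orthogonal. -/
def RightOrthogonal (V : Cores n r) : Prop :=
  ∀ k : Fin d, 0 < k.val → ∑ i, V k i * (V k i)ᵀ = 1

/-- If the left interface vectors at bond `k` are orthonormal, the next core enters only through its
own Gram matrix. Taking `A = B = U k` propagates orthonormality; other choices give inner products
of tangent terms. -/
theorem lsum_vecMul_mul_vecMul {U : Cores n r} (k : Fin d)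
    (hU : ∀ a b i, lsum k.val (fun x => partialProd U x k k.isLt.le a *
      partialProd U x k k.isLt.le b) i = if a = b then 1 else 0)
    {β γ : Type*} (A : Fin (n k) → Matrix (Fin (bond r k.val)) β ℝ)
    (B : Fin (n k) → Matrix (Fin (bond r k.val)) γ ℝ) (b : β) (c : γ)
    (i : (k : Fin d) → Fin (n k)) :
    lsum (k.val + 1) (fun x => (partialProd U x k k.isLt.le ᵥ* A (x k)) b *
      (partialProd U x k k.isLt.le ᵥ* B (x k)) c) i = (∑ v, (A v)ᵀ * B v) b c := by
  rw [lsum_succ, Matrix.sum_apply]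
  refine Finset.sum_congr rfl fun v _ => ?_
  have : lsum k.val (fun x => (partialProd U x k k.isLt.le ᵥ* A (x k)) b *
      (partialProd U x k k.isLt.le ᵥ* B (x k)) c) (Function.update i k v) =
      lsum k.val (fun x => ∑ p, ∑ q, (A v p b * B v q c) * (partialProd U x k k.isLt.le p *
        partialProd U x k k.isLt.le q)) (Function.update i k v) := by
    refine lsum_congr fun x hx => ?_
    have hxk : x k = v := by simpa using hx k le_rfl
    rw [hxk, vecMul, vecMul, dotProduct, dotProduct, Finset.sum_mul_sum]
    exact Finset.sum_congr rfl fun p _ => Finset.sum_congr rfl fun q _ => by ring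
  rw [this, lsum_sum]
  simp only [lsum_sum, lsum_const_mul, hU, Matrix.mul_apply, transpose_apply, mul_ite, mul_one,
    mul_zero, Finset.sum_ite_eq, Finset.mem_univ, if_true]

/-- The bound `k < d` is strict because the last core of `U` is not orthogonal. -/
theorem lsum_partialProd {U : Cores n r} (hU : LeftOrthogonal U) (k : ℕ) (hk : k < d)
    (a b : Fin (bond r k)) (i : (k : Fin d) → Fin (n k)) :
    lsum k (fun x => partialProd U x k hk.le a * partialProd U x k hk.le b) i =
      if a = b then 1 else 0 := by
  induction k generalizing i with
  | zero =>
    have : Subsingleton (Fin (bond r 0)) := by rw [bond_zero]; infer_instance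
    rw [lsum_zero, if_pos (Subsingleton.elim a b), partialProd_zero, mul_one]
  | succ k ih =>
    have := lsum_vecMul_mul_vecMul ⟨k, by omega⟩ (fun a b i => ih (by omega) a b i)
      (U ⟨k, by omega⟩) (U ⟨k, by omega⟩) a b i
    rw [hU ⟨k, by omega⟩ hk, one_apply] at this
    exact this

theorem rsum_suffixProd {V : Cores n r} (hV : RightOrthogonal V) (k : ℕ) (h0 : 0 < k) (hk : k ≤ d)
    (a b : Fin (bond r k)) (i : (k : Fin d) → Fin (n k)) :
    rsum k (fun x => suffixProd V x k hk a * suffixProd V x k hk b) i =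
      if a = b then 1 else 0 := by
  revert h0 a b i
  refine decreasing_induction (P := fun k hk => 0 < k → ∀ (a b : Fin (bond r k)) i,
    rsum k (fun x => suffixProd V x k hk a * suffixProd V x k hk b) i =
      if a = b then 1 else 0) ?_ ?_ k hk
  · intro _ a b i
    have : Subsingleton (Fin (bond r d)) := by rw [bond_self]; infer_instance
    rw [rsum_self, if_pos (Subsingleton.elim a b), suffixProd_self, mul_one]
  · intro k ih h0 a b i
    have hVk := congrFun (congrFun (hV k h0) a) b
    rw [Matrix.sum_apply, one_apply] at hVk
    rw [rsum_eq_sum_succ, ← hVk]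
    refine Finset.sum_congr rfl fun v _ => ?_
    have : rsum (k.val + 1) (fun x => suffixProd V x k k.isLt.le a * suffixProd V x k k.isLt.le b)
        (Function.update i k v) =
        rsum (k.val + 1) (fun x => ∑ p, ∑ q, (V k v a p * V k v b q) *
          (suffixProd V x (k + 1) k.isLt p * suffixProd V x (k + 1) k.isLt q))
          (Function.update i k v) := by
      refine Finset.sum_congr rfl fun x hx => ?_
      have hxk : x k = v := by
        simp only [Finset.mem_filter, Finset.mem_univ, true_and] at hx
        simpa using hx k (Nat.lt_succ_self _)
      beta_reduce
      rw [suffixProd_eq, hxk, mulVec, mulVec, dotProduct, dotProduct, Finset.sum_mul_sum]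
      exact Finset.sum_congr rfl fun p _ => Finset.sum_congr rfl fun q _ => by ring
    rw [this, rsum_sum]
    simp only [rsum_sum, rsum_const_mul, ih (by omega), Matrix.mul_apply, transpose_apply, mul_ite,
      mul_one, mul_zero, Finset.sum_ite_eq, Finset.mem_univ, if_true]

theorem lsum_dotProduct_mul_dotProduct {U : Cores n r} (hU : LeftOrthogonal U) (k : Fin d)
    {β γ : Type*} [Fintype β] [Fintype γ] (A : Fin (n k) → Matrix (Fin (bond r k.val)) β ℝ)
    (B : Fin (n k) → Matrix (Fin (bond r k.val)) γ ℝ)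
    {ξ : ((k : Fin d) → Fin (n k)) → β → ℝ} (hξ : DependsFrom (k + 1) ξ)
    {ξ' : ((k : Fin d) → Fin (n k)) → γ → ℝ} (hξ' : DependsFrom (k + 1) ξ')
    (i : (k : Fin d) → Fin (n k)) :
    lsum (k.val + 1) (fun x => ((partialProd U x k k.isLt.le ᵥ* A (x k)) ⬝ᵥ ξ x) *
      ((partialProd U x k k.isLt.le ᵥ* B (x k)) ⬝ᵥ ξ' x)) i =
      ξ i ⬝ᵥ ((∑ v, (A v)ᵀ * B v) *ᵥ ξ' i) := by
  have : ∀ x, ((partialProd U x k k.isLt.le ᵥ* A (x k)) ⬝ᵥ ξ x) *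
      ((partialProd U x k k.isLt.le ᵥ* B (x k)) ⬝ᵥ ξ' x) =
      ∑ b, ∑ c, (ξ x b * ξ' x c) * ((partialProd U x k k.isLt.le ᵥ* A (x k)) b *
      (partialProd U x k k.isLt.le ᵥ* B (x k)) c) := by
    intro x
    rw [dotProduct, dotProduct, Finset.sum_mul_sum]
    exact Finset.sum_congr rfl fun p _ => Finset.sum_congr rfl fun q _ => by ring
  simp only [this, lsum_sum]
  rw [dotProduct]
  refine Finset.sum_congr rfl fun b _ => ?_
  rw [mulVec, dotProduct, Finset.mul_sum]
  refine Finset.sum_congr rfl fun c _ => ?_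
  rw [lsum_mul_of_dependsFrom (ψ := fun x => ξ x b * ξ' x c),
    lsum_vecMul_mul_vecMul k fun a b i => lsum_partialProd hU k k.isLt a b i]
  · ring
  · intro x y h
    simp only [hξ x y h, hξ' x y h]

/-- The gauge conditions. -/
def Gauged (U R : Cores n r) : Prop :=
  ∀ k : Fin d, k.val + 1 < d → ∑ i, (U k i)ᵀ * R k i = 0

theorem tangentTerm_eq (U V R : Cores n r) (k : Fin d) (i : (k : Fin d) → Fin (n k)) :
    tangentTerm U V R k i =
      (partialProd U i k k.isLt.le ᵥ* R k (i k)) ⬝ᵥ suffixProd V i (k + 1) k.isLt := by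
  rw [tangentTerm, dotProduct_mulVec]

/-- At position `j` the `j`-th term passes through `R_j`, while the `k`-th term still passes through
`U_j`. Summation over the indices up to `j` leaves the factor `∑ R_jᵀ U_j`, which the gauge
condition kills. Only the term with the smaller index has to be gauged. -/
theorem sum_tangentTerm_mul_of_lt {U V R R' : Cores n r} (hU : LeftOrthogonal U)
    (hR : Gauged U R) {j k : Fin d} (hjk : j < k) :
    ∑ i, tangentTerm U V R j i * tangentTerm U V R' k i = 0 := by
  rcases isEmpty_or_nonempty ((k : Fin d) → Fin (n k)) with h | ⟨⟨i₀⟩⟩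
  · simp
  have hjd : j.val + 1 < d := by have := k.isLt; rw [Fin.lt_def] at hjk; omega
  have hk : ∀ i, tangentTerm U V R' k i = (partialProd U i j j.isLt.le ᵥ* U j (i j)) ⬝ᵥ
      suffixProd (mixedCores U R' V k) i (j + 1) j.isLt := by
    intro i
    rw [← tensor_mixedCores, tensor_apply _ _ (j + 1) j.isLt, partialProd_congr (H := U) (i' := i),
      partialProd_succ]
    intro l hl
    have : l < k := by rw [Fin.lt_def] at hjk ⊢; omega
    simp [mixedCores, this]
  rw [sum_eq_rsum_lsum (j + 1) _ i₀]
  have hz : ∑ v, (R j v)ᵀ * U j v = 0 := by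
    have := congrArg transpose (hR j hjd)
    simpa [transpose_sum, transpose_mul] using this
  have : ∀ i, lsum (j.val + 1) (fun i => tangentTerm U V R j i * tangentTerm U V R' k i) i = 0 := by
    intro i
    simp only [hk, tangentTerm_eq U V R]
    rw [lsum_dotProduct_mul_dotProduct hU j (R j) (U j) (dependsFrom_suffixProd _ _ _)
      (dependsFrom_suffixProd _ _ _), hz]
    simp
  unfold rsum
  exact Finset.sum_eq_zero fun i _ => this i

/-- The sum over the left indices produces the Gram matrix `N = ∑ R_kᵀ R'_k`; orthonormality of the
right interface reduces the remaining sum to its trace. -/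
theorem sum_tangentTerm_mul_self {U V : Cores n r} (hU : LeftOrthogonal U)
    (hV : RightOrthogonal V) (R R' : Cores n r) (k : Fin d)
    (i₀ : (k : Fin d) → Fin (n k)) :
    ∑ i, tangentTerm U V R k i * tangentTerm U V R' k i = ∑ v, ((R k v)ᵀ * R' k v).trace := by
  rw [sum_eq_rsum_lsum (k + 1) _ i₀]
  simp only [tangentTerm_eq]
  have := fun i => lsum_dotProduct_mul_dotProduct hU k (R k) (R' k)
    (dependsFrom_suffixProd V (k + 1) k.isLt) (dependsFrom_suffixProd V (k + 1) k.isLt) i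
  rw [funext this]
  rw [← trace_sum]
  generalize ∑ v, (R k v)ᵀ * R' k v = N
  have : ∀ i, suffixProd V i (k + 1) k.isLt ⬝ᵥ N *ᵥ suffixProd V i (k + 1) k.isLt =
      ∑ a, ∑ b, N a b * (suffixProd V i (k + 1) k.isLt a * suffixProd V i (k + 1) k.isLt b) := by
    intro i
    simp only [dotProduct, mulVec, Finset.mul_sum]
    exact Finset.sum_congr rfl fun p _ => Finset.sum_congr rfl fun q _ => by ring
  simp only [this, rsum_sum, rsum_const_mul, rsum_suffixProd hV _ (Nat.succ_pos _), mul_ite,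
    mul_one,
    mul_zero, Finset.sum_ite_eq, Finset.mem_univ, if_true, trace, diag_apply]

end PartialSums

end TTGrad

namespace TTGrad

/-! ### Matrices of bounded rank -/

section BoundedRank

open Matrix Filter

variable {m n ρ : Type*} [Fintype m] [Fintype n] [Fintype ρ] [DecidableEq ρ]

theorem det_ne_zero_of_card_le_rank {A : Matrix ρ ρ ℝ} (h : Fintype.card ρ ≤ A.rank) :
    A.det ≠ 0 := by
  have hli : LinearIndependent ℝ A.row := by
    rw [linearIndependent_iff_card_le_finrank_span]
    rwa [A.rank_eq_finrank_span_row] at h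
  exact ((Matrix.isUnit_iff_isUnit_det A).1 (linearIndependent_rows_iff_isUnit.1 hli)).ne_zero

theorem card_le_rank_of_det_ne_zero {Y : Matrix m n ℝ} {L : Matrix m ρ ℝ} {R : Matrix ρ n ℝ}
    (h : (Lᵀ * Y * Rᵀ).det ≠ 0) : Fintype.card ρ ≤ Y.rank := by
  rw [← rank_of_det_ne_zero h]
  exact (rank_mul_le_left _ _).trans (rank_mul_le_right _ _)

/-- Skeleton decomposition. The columns of `Y * Rᵀ` already span the column space of `Y`, so `Y = Y
* Rᵀ * W`, and `W` is found by multiplying with `Lᵀ` and inverting the small matrix. -/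
theorem eq_mul_inv_mul_of_rank_le {Y : Matrix m n ℝ} {L : Matrix m ρ ℝ} {R : Matrix ρ n ℝ}
    (hY : Y.rank ≤ Fintype.card ρ) (h : (Lᵀ * Y * Rᵀ).det ≠ 0) :
    Y = Y * Rᵀ * (Lᵀ * Y * Rᵀ)⁻¹ * (Lᵀ * Y) := by
  classical
  have hC : Fintype.card ρ ≤ (Y * Rᵀ).rank := by
    rw [← rank_of_det_ne_zero h, Matrix.mul_assoc]
    exact rank_mul_le_right _ _
  have hle : LinearMap.range (Y * Rᵀ).mulVecLin ≤ LinearMap.range Y.mulVecLin := by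
    rw [mulVecLin_mul]
    exact LinearMap.range_comp_le_range _ _
  -- One column space contains the other, and the invertible matrix `Lᵀ * Y * Rᵀ` forces the smaller
  -- one to have dimension at least that of the larger.
  have hrange := Submodule.eq_of_le_of_finrank_le hle (hY.trans hC)
  have hcol : ∀ j, ∃ w, (Y * Rᵀ) *ᵥ w = Y.col j := by
    intro j
    have : Y.col j ∈ LinearMap.range (Y * Rᵀ).mulVecLin := by
      rw [hrange]
      exact ⟨Pi.single j 1, by simp⟩
    exact this
  choose w hw using hcol
  have hYW : Y = Y * Rᵀ * (Matrix.of w)ᵀ := by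
    ext i j
    have := congrFun (hw j) i
    rw [Matrix.mul_apply]
    exact this.symm
  have hW : Lᵀ * Y = (Lᵀ * Y * Rᵀ) * (Matrix.of w)ᵀ := by
    conv_lhs => rw [hYW]
    simp only [Matrix.mul_assoc]
  have hu : IsUnit (Lᵀ * Y * Rᵀ).det := isUnit_iff_ne_zero.2 h
  calc Y = Y * Rᵀ * (Matrix.of w)ᵀ := hYW
    _ = Y * Rᵀ * ((Lᵀ * Y * Rᵀ)⁻¹ * ((Lᵀ * Y * Rᵀ) * (Matrix.of w)ᵀ)) := by
      rw [Matrix.nonsing_inv_mul_cancel_left _ _ hu]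
    _ = Y * Rᵀ * (Lᵀ * Y * Rᵀ)⁻¹ * (Lᵀ * Y) := by rw [← hW, ← Matrix.mul_assoc]

/-- Limits of difference quotients use only the entrywise topology, so no norm on matrices has to be
chosen. -/
theorem hasDerivAt_matrix_tendsto {Y : ℝ → Matrix m n ℝ} {Y' : Matrix m n ℝ}
    (hY : ∀ i j, HasDerivAt (fun t => Y t i j) (Y' i j) 0) :
    Tendsto (fun t => t⁻¹ • (Y t - Y 0)) (𝓝[≠] 0) (𝓝 Y') := by
  refine tendsto_pi_nhds.2 fun i => tendsto_pi_nhds.2 fun j => ?_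
  simpa using hasDerivAt_iff_tendsto_slope_zero.1 (hY i j)

theorem tendsto_matrix_mul {α l m n : Type*} [Fintype m] {f : Filter α} {A : α → Matrix l m ℝ}
    {B : α → Matrix m n ℝ} {a : Matrix l m ℝ} {b : Matrix m n ℝ} (hA : Tendsto A f (𝓝 a))
    (hB : Tendsto B f (𝓝 b)) : Tendsto (fun t => A t * B t) f (𝓝 (a * b)) :=
  ((continuous_fst.matrix_mul continuous_snd).tendsto (a, b)).comp (hA.prodMk_nhds hB)

/-- The derivative of a curve of matrices of rank at most `r` at a matrix of rank `r`. -/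
theorem projection_deriv_eq_zero [DecidableEq m] [DecidableEq n] {Y : ℝ → Matrix m n ℝ}
    {Y' : Matrix m n ℝ}
    (hY : ∀ i j, HasDerivAt (fun t => Y t i j) (Y' i j) 0)
    (hrank : ∀ᶠ t in 𝓝 (0 : ℝ), (Y t).rank ≤ Fintype.card ρ) {L : Matrix m ρ ℝ}
    {R : Matrix ρ n ℝ} {M : Matrix ρ ρ ℝ} (hL : Lᵀ * L = 1) (hR : R * Rᵀ = 1)
    (h0 : Y 0 = L * M * R) (hM : M.det ≠ 0) :
    (1 - L * Lᵀ) * Y' * (1 - Rᵀ * R) = 0 := by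
  have hT := hasDerivAt_matrix_tendsto hY
  have hY0 : Tendsto Y (𝓝 0) (𝓝 (Y 0)) :=
    tendsto_pi_nhds.2 fun i => tendsto_pi_nhds.2 fun j => (hY i j).continuousAt
  have hPL : (1 - L * Lᵀ) * L = 0 := by
    rw [Matrix.sub_mul, Matrix.mul_assoc, hL]; simp
  have hRN : R * (1 - Rᵀ * R) = 0 := by
    rw [Matrix.mul_sub, ← Matrix.mul_assoc, hR]; simp
  have hPY : (1 - L * Lᵀ) * Y 0 = 0 := by
    rw [h0, ← Matrix.mul_assoc, ← Matrix.mul_assoc, hPL]; simp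
  have hYN : Y 0 * (1 - Rᵀ * R) = 0 := by rw [h0, Matrix.mul_assoc, hRN]; simp
  have hA0 : Lᵀ * Y 0 * Rᵀ = M := by
    rw [h0, ← Matrix.mul_assoc, ← Matrix.mul_assoc, hL, Matrix.one_mul, Matrix.mul_assoc, hR,
      Matrix.mul_one]
  have hA : Tendsto (fun t => Lᵀ * Y t * Rᵀ) (𝓝 0) (𝓝 M) := by
    rw [← hA0]
    exact tendsto_matrix_mul (tendsto_matrix_mul tendsto_const_nhds hY0) tendsto_const_nhds
  have hdet : ∀ᶠ t in 𝓝 (0 : ℝ), (Lᵀ * Y t * Rᵀ).det ≠ 0 := by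
    have : Continuous fun Z : Matrix ρ ρ ℝ => Z.det := by fun_prop
    exact ((this.tendsto M).comp hA).eventually_ne hM
  have hAinv : Tendsto (fun t => (Lᵀ * Y t * Rᵀ)⁻¹) (𝓝 0) (𝓝 M⁻¹) := by
    have : ContinuousAt Inv.inv M := continuousAt_matrix_inv M (by
      rw [Ring.inverse_eq_inv']
      exact continuousAt_inv₀ hM)
    exact this.tendsto.comp hA
  have h1 : Tendsto (fun t => (1 - L * Lᵀ) * (t⁻¹ • (Y t - Y 0)) * (1 - Rᵀ * R)) (𝓝[≠] 0)
      (𝓝 ((1 - L * Lᵀ) * Y' * (1 - Rᵀ * R))) := by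
    exact tendsto_matrix_mul (tendsto_matrix_mul tendsto_const_nhds hT) tendsto_const_nhds
  -- By the skeleton decomposition this is the previous expression for small `t ≠ 0`. Both outer
  -- factors of the decomposition vanish at `t = 0`; the division by `t` is absorbed by the left
  -- one, so the right one still drives the limit to zero.
  have h2 : Tendsto (fun t => ((1 - L * Lᵀ) * (t⁻¹ • (Y t - Y 0)) * Rᵀ) *
      (Lᵀ * Y t * Rᵀ)⁻¹ * (Lᵀ * Y t * (1 - Rᵀ * R))) (𝓝[≠] 0)
      (𝓝 (((1 - L * Lᵀ) * Y' * Rᵀ) * M⁻¹ * (Lᵀ * Y 0 * (1 - Rᵀ * R)))) := by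
    exact tendsto_matrix_mul (tendsto_matrix_mul (tendsto_matrix_mul
      (tendsto_matrix_mul tendsto_const_nhds hT) tendsto_const_nhds)
      (hAinv.mono_left nhdsWithin_le_nhds)) (tendsto_matrix_mul (tendsto_matrix_mul
      tendsto_const_nhds (hY0.mono_left nhdsWithin_le_nhds)) tendsto_const_nhds)
  rw [Matrix.mul_assoc Lᵀ, hYN, Matrix.mul_zero, Matrix.mul_zero] at h2
  refine tendsto_nhds_unique h1 (h2.congr' ?_)
  filter_upwards [nhdsWithin_le_nhds hrank, nhdsWithin_le_nhds hdet] with t hr hd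
  have hYt := eq_mul_inv_mul_of_rank_le hr hd
  set N := 1 - Rᵀ * R
  set P := 1 - L * Lᵀ
  simp only [Matrix.mul_smul, Matrix.smul_mul, Matrix.mul_sub, hPY, sub_zero]
  congr 1
  conv_rhs => rw [hYt]
  simp only [Matrix.mul_assoc]

end BoundedRank

/-! ### Unfoldings and the tangent space -/

section Unfolding

open Matrix Filter

variable {d : ℕ} {n : Fin d → ℕ} {r : Fin (d - 1) → ℕ}

/-- The left interface matrix with rows `G₁[i₁] ⋯ G_k[i_k]`. -/
noncomputable def leftInterface (G : Cores n r) (i₀ : (k : Fin d) → Fin (n k)) (k : ℕ)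
    (hk : k ≤ d) : Matrix ((j : {j : Fin d // j.val < k}) → Fin (n j.val)) (Fin (bond r k)) ℝ :=
  Matrix.of fun x a => partialProd G ((cut n k).symm (x, (cut n k i₀).2)) k hk a

/-- The right interface matrix with columns `G_{k+1}[i_{k+1}] ⋯ G_d[i_d]`. -/
noncomputable def rightInterface (G : Cores n r) (i₀ : (k : Fin d) → Fin (n k)) (k : ℕ)
    (hk : k ≤ d) : Matrix (Fin (bond r k)) ((j : {j : Fin d // ¬ j.val < k}) → Fin (n j.val)) ℝ :=
  Matrix.of fun a y => suffixProd G ((cut n k).symm ((cut n k i₀).1, y)) k hk a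

/-- The index `i₀` only fills the positions to the right of the cut, which the product of the first
`k` cores does not see. -/
theorem leftInterface_apply (G : Cores n r) (i₀ : (k : Fin d) → Fin (n k)) (k : ℕ)
    (hk : k ≤ d) (x) (y) (a) :
    leftInterface G i₀ k hk x a = partialProd G ((cut n k).symm (x, y)) k hk a := by
  refine congrFun (partialProd_congr k hk fun j hj => ?_) a
  rw [cut_symm_of_lt _ _ hj, cut_symm_of_lt _ _ hj]

theorem rightInterface_apply (G : Cores n r) (i₀ : (k : Fin d) → Fin (n k)) (k : ℕ)
    (hk : k ≤ d) (x) (y) (a) :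
    rightInterface G i₀ k hk a y = suffixProd G ((cut n k).symm (x, y)) k hk a := by
  refine congrFun (suffixProd_congr k hk fun j hj => ?_) a
  rw [cut_symm_of_le _ _ hj, cut_symm_of_le _ _ hj]

theorem unfolding_apply (A : Tensor n) (k : ℕ) (x) (y) :
    unfolding A k x y = A ((cut n k).symm (x, y)) := rfl

/-- Cutting the product at one bond gives the upper bound on the rank of the unfolding and, when
that rank is the bond size, full rank of both interface matrices. -/
theorem unfolding_tensor (G : Cores n r) (i₀ : (k : Fin d) → Fin (n k)) (k : ℕ) (hk : k ≤ d) :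
    unfolding (tensor G) k = leftInterface G i₀ k hk * rightInterface G i₀ k hk := by
  ext x y
  rw [unfolding_apply, tensor_apply _ _ k hk, Matrix.mul_apply, dotProduct]
  refine Finset.sum_congr rfl fun a _ => ?_
  rw [leftInterface_apply G i₀ k hk x y, rightInterface_apply G i₀ k hk x y]

theorem transpose_mul_leftInterface {U : Cores n r} (hU : LeftOrthogonal U)
    (i₀ : (k : Fin d) → Fin (n k)) (k : ℕ) (hk : k < d) :
    (leftInterface U i₀ k hk.le)ᵀ * leftInterface U i₀ k hk.le = 1 := by
  ext a b
  rw [Matrix.mul_apply, one_apply, ← lsum_partialProd hU k hk a b i₀, lsum_eq_sum_cut]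
  rfl

theorem mul_transpose_rightInterface {V : Cores n r} (hV : RightOrthogonal V)
    (i₀ : (k : Fin d) → Fin (n k)) (k : ℕ) (h0 : 0 < k) (hk : k ≤ d) :
    rightInterface V i₀ k hk * (rightInterface V i₀ k hk)ᵀ = 1 := by
  ext a b
  rw [Matrix.mul_apply, one_apply, ← rsum_suffixProd hV k h0 hk a b i₀, rsum_eq_sum_cut]
  rfl

theorem rank_unfolding_tensor_le (G : Cores n r) (i₀ : (k : Fin d) → Fin (n k)) (k : ℕ)
    (hk : k ≤ d) : (unfolding (tensor G) k).rank ≤ bond r k := by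
  rw [unfolding_tensor G i₀ k hk]
  exact (rank_mul_le_left _ _).trans ((rank_le_card_width _).trans_eq (Fintype.card_fin _))

/-- A tensor without entries has unfoldings of rank zero. The lemma supplies the base index used for
the partial sums, and `n_k ≥ 1` for the cost bound. -/
theorem nonempty_index {A : Tensor n} (hA : A ∈ fixedRank n r) (hd : 2 ≤ d) (hr : ∀ k, 0 < r k) :
    Nonempty ((k : Fin d) → Fin (n k)) := by
  by_contra h
  rw [not_nonempty_iff] at h
  have hk : 0 < d - 1 := by omega
  have h1 := hA ⟨0, hk⟩
  have h2 : unfolding A 1 = 0 := by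
    ext x y
    exact h.elim ((cut n 1).symm (x, y))
  simp only [zero_add] at h1
  rw [h2, rank_zero] at h1
  exact (hr _).ne h1

/-- The bond size equals the rank of the unfolding, so the right interface matrix has independent
rows. This guarantees linearly independent inputs of Gram-Schmidt in the sweep to the left; the next
lemma serves the sweep to the right. -/
theorem eq_zero_of_dotProduct_suffixProd {G : Cores n r} (hG : tensor G ∈ fixedRank n r)
    (i₀ : (k : Fin d) → Fin (n k)) (k : Fin (d - 1)) (hk : k.val + 1 ≤ d)
    (y : Fin (bond r (k.val + 1)) → ℝ)
    (h : ∀ i, y ⬝ᵥ suffixProd G i (k.val + 1) hk = 0) : y = 0 := by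
  have h1 : bond r (k.val + 1) ≤ (rightInterface G i₀ (k.val + 1) hk).rank := by
    refine (bond_succ r k).trans_le ?_
    rw [← hG k, unfolding_tensor G i₀ _ hk]
    exact rank_mul_le_right _ _
  have hli : LinearIndependent ℝ (rightInterface G i₀ (k.val + 1) hk).row := by
    rw [linearIndependent_iff_card_le_finrank_span, Fintype.card_fin]
    rwa [rank_eq_finrank_span_row] at h1
  rw [← Matrix.vecMul_injective_iff] at hli
  refine hli ?_
  beta_reduce
  rw [zero_vecMul]
  funext z
  exact h _

theorem eq_zero_of_partialProd_dotProduct {G : Cores n r} (hG : tensor G ∈ fixedRank n r)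
    (i₀ : (k : Fin d) → Fin (n k)) (k : Fin (d - 1)) (hk : k.val + 1 ≤ d)
    (y : Fin (bond r (k.val + 1)) → ℝ)
    (h : ∀ i, partialProd G i (k.val + 1) hk ⬝ᵥ y = 0) : y = 0 := by
  have h1 : bond r (k.val + 1) ≤ (leftInterface G i₀ (k.val + 1) hk).rank := by
    refine (bond_succ r k).trans_le ?_
    rw [← hG k, unfolding_tensor G i₀ _ hk]
    exact rank_mul_le_left _ _
  have hli : LinearIndependent ℝ (leftInterface G i₀ (k.val + 1) hk).col := by
    rw [linearIndependent_iff_card_le_finrank_span, Fintype.card_fin]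
    rwa [rank_eq_finrank_span_cols] at h1
  rw [← Matrix.mulVec_injective_iff] at hli
  refine hli ?_
  beta_reduce
  rw [mulVec_zero]
  funext z
  exact h _

theorem leftInterface_congr {G H : Cores n r} (i₀ : (k : Fin d) → Fin (n k)) (k : ℕ) (hk : k ≤ d)
    (h : ∀ j : Fin d, j.val < k → G j = H j) :
    leftInterface G i₀ k hk = leftInterface H i₀ k hk := by
  ext x a
  exact congrFun (partialProd_congr k hk fun j hj => by rw [h j hj]) a

theorem rightInterface_congr {G H : Cores n r} (i₀ : (k : Fin d) → Fin (n k)) (k : ℕ) (hk : k ≤ d)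
    (h : ∀ j : Fin d, k ≤ j.val → G j = H j) :
    rightInterface G i₀ k hk = rightInterface H i₀ k hk := by
  ext x a
  exact congrFun (suffixProd_congr k hk fun j hj => by rw [h j hj]) x

/-- The singular values of the unfolding are those of a small invertible matrix. -/
theorem exists_unfolding_eq {X : Tensor n} (hX : X ∈ fixedRank n r) {U V S : Cores n r}
    (h : IsOrthogonalization X U V S) (i₀ : (k : Fin d) → Fin (n k)) (k : Fin (d - 1))
    (hk : k.val + 1 < d) : ∃ M : Matrix (Fin (bond r (k.val + 1))) (Fin (bond r (k.val + 1))) ℝ,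
      M.det ≠ 0 ∧ unfolding X (k.val + 1) =
        leftInterface U i₀ (k.val + 1) hk.le * M * rightInterface V i₀ (k.val + 1) hk.le := by
  obtain ⟨hU, hV, hS⟩ := h
  set L := leftInterface U i₀ (k.val + 1) hk.le with hLdef
  set R := rightInterface V i₀ (k.val + 1) hk.le with hRdef
  have hL : Lᵀ * L = 1 := transpose_mul_leftInterface hU i₀ _ hk
  have e1 : ∃ Z : Matrix (Fin (bond r (k.val + 1)))
      ((j : {j : Fin d // ¬ j.val < k.val + 1}) → Fin (n j.val)) ℝ,
      unfolding X (k.val + 1) = L * Z := by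
    refine ⟨rightInterface (mixedCores U S V (hi k)) i₀ (k.val + 1) hk.le, ?_⟩
    have : tensor (mixedCores U S V (hi k)) = X := hS (hi k)
    rw [← this, unfolding_tensor _ i₀ _ hk.le, hLdef]
    congr 1
    refine leftInterface_congr i₀ _ _ fun j hj => ?_
    have : j < hi k := hj
    simp [mixedCores, this]
  have e2 : ∃ Z : Matrix ((j : {j : Fin d // j.val < k.val + 1}) → Fin (n j.val))
      (Fin (bond r (k.val + 1))) ℝ, unfolding X (k.val + 1) = Z * R := by
    refine ⟨leftInterface (mixedCores U S V (lo k)) i₀ (k.val + 1) hk.le, ?_⟩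
    have : tensor (mixedCores U S V (lo k)) = X := hS (lo k)
    rw [← this, unfolding_tensor _ i₀ _ hk.le, hRdef]
    congr 1
    refine rightInterface_congr i₀ _ _ fun j hj => ?_
    have h1 : ¬ j < lo k := by rw [Fin.lt_def]; simp only [lo]; omega
    have h2 : j ≠ lo k := by rw [Ne, Fin.ext_iff]; simp only [lo]; omega
    simp [mixedCores, h1, h2]
  obtain ⟨Z, hZ⟩ := e1
  obtain ⟨Z', hZ'⟩ := e2
  -- The representation orthogonal at the right core gives the column space `L`, the one orthogonal
  -- at the left core gives the row space `R`; inserting `Lᵀ * L = 1` combines them.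
  have hfac : unfolding X (k.val + 1) = L * (Lᵀ * Z') * R := by
    calc unfolding X (k.val + 1) = L * (Lᵀ * L) * Z := by rw [hL, Matrix.mul_one, hZ]
      _ = L * (Lᵀ * (L * Z)) := by simp only [Matrix.mul_assoc]
      _ = L * (Lᵀ * (Z' * R)) := by rw [← hZ, hZ']
      _ = L * (Lᵀ * Z') * R := by simp only [Matrix.mul_assoc]
  refine ⟨Lᵀ * Z', det_ne_zero_of_card_le_rank ?_, hfac⟩
  refine ((Fintype.card_fin _).trans (bond_succ r k)).trans_le ?_
  rw [← hX k, hfac]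
  exact (rank_mul_le_left _ _).trans (rank_mul_le_right _ _)

variable {X : Tensor n} {U V S : Cores n r}

/-- The cores assumed in `hZ` bound the ranks from above for every `t`. The determinant of the
unfolding compressed by `L` and `R` is continuous and nonzero at `0`, which bounds the ranks from
below for small `t`. -/
theorem eventually_add_smul_mem_fixedRank (hX : X ∈ fixedRank n r)
    (h : IsOrthogonalization X U V S) (i₀ : (k : Fin d) → Fin (n k)) (Z : Tensor n)
    (hZ : ∀ t : ℝ, ∃ G : Cores n r, X + t • Z = tensor G) :
    ∀ᶠ t in 𝓝 (0 : ℝ), X + t • Z ∈ fixedRank n r := by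
  refine eventually_all.2 fun k => ?_
  have hk : k.val + 1 < d := by omega
  obtain ⟨M, hM, hfac⟩ := exists_unfolding_eq hX h i₀ k hk
  set L := leftInterface U i₀ (k.val + 1) hk.le
  set R := rightInterface V i₀ (k.val + 1) hk.le
  have hL : Lᵀ * L = 1 := transpose_mul_leftInterface h.1 i₀ _ hk
  have hR : R * Rᵀ = 1 := mul_transpose_rightInterface h.2.1 i₀ _ (Nat.succ_pos _) hk.le
  have hlin : ∀ t : ℝ, unfolding (X + t • Z) (k.val + 1) =
    unfolding X (k.val + 1) + t • unfolding Z (k.val + 1) := fun t => rfl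
  have hcont : Continuous fun t : ℝ => (Lᵀ * unfolding (X + t • Z) (k.val + 1) * Rᵀ).det := by
    simp only [hlin]
    fun_prop
  have h0 : (Lᵀ * unfolding (X + (0 : ℝ) • Z) (k.val + 1) * Rᵀ).det ≠ 0 := by
    have : Lᵀ * (L * M * R) * Rᵀ = M := by
      rw [← Matrix.mul_assoc, ← Matrix.mul_assoc, hL, Matrix.one_mul, Matrix.mul_assoc, hR,
        Matrix.mul_one]
    rwa [zero_smul, add_zero, hfac, this]
  filter_upwards [hcont.continuousAt.eventually_ne h0] with t ht
  obtain ⟨G, hG⟩ := hZ t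
  refine le_antisymm ?_ ?_
  · rw [hG, ← bond_succ r k]
    exact rank_unfolding_tensor_le G i₀ _ hk.le
  · have := card_le_rank_of_det_ne_zero ht
    rwa [Fintype.card_fin, bond_succ] at this

/-- Replacing `S_k` by `S_k + t R_k` in the representation orthogonal at `k` moves the tensor along
a straight line with this velocity, without enlarging any bond. -/
theorem tangentTerm_mem_tangentSpace (hX : X ∈ fixedRank n r)
    (h : IsOrthogonalization X U V S) (i₀ : (k : Fin d) → Fin (n k)) (R : Cores n r) (k : Fin d) :
    (WithLp.toLp 2 (tangentTerm U V R k) : Tensor n) ∈ tangentSpace (fixedRank n r) X := by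
  set Z : Tensor n := WithLp.toLp 2 (tangentTerm U V R k)
  have hZ : ∀ t : ℝ, ∃ G : Cores n r, X + t • Z = tensor G := by
    intro t
    refine ⟨mixedCores U (fun j i => S j i + t • R j i) V k, ?_⟩
    ext i
    have hXk : tensor (mixedCores U S V k) = X := h.2.2 k
    rw [tensor_mixedCores, ← hXk, PiLp.add_apply, PiLp.smul_apply, tensor_mixedCores]
    simp only [tangentTerm, add_mulVec, dotProduct_add, smul_mulVec, dotProduct_smul, Z]
  have hder : HasDerivAt (fun t : ℝ => X + t • Z) Z 0 := by
    simpa using ((hasDerivAt_id (0 : ℝ)).smul_const Z).const_add X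
  refine Submodule.subset_span ⟨fun t => X + t • Z, by simp, ?_,
    eventually_add_smul_mem_fixedRank hX h i₀ Z hZ, hder.deriv⟩
  fun_prop

/-- The linearized rank condition at one bond, with the column and row spaces of the unfolding given
by the interface matrices of `U` and `V`. -/
theorem projection_velocity_eq_zero (hX : X ∈ fixedRank n r) (h : IsOrthogonalization X U V S)
    (i₀ : (k : Fin d) → Fin (n k)) {γ : ℝ → Tensor n} (h0 : γ 0 = X)
    (hγ : DifferentiableAt ℝ γ 0) (hmem : ∀ᶠ t in 𝓝 (0 : ℝ), γ t ∈ fixedRank n r)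
    (k : Fin (d - 1)) (hk : k.val + 1 < d) :
    (1 - leftInterface U i₀ (k.val + 1) hk.le * (leftInterface U i₀ (k.val + 1) hk.le)ᵀ) *
      unfolding (deriv γ 0) (k.val + 1) *
      (1 - (rightInterface V i₀ (k.val + 1) hk.le)ᵀ * rightInterface V i₀ (k.val + 1) hk.le) =
      0 := by
  obtain ⟨M, hM, hfac⟩ := exists_unfolding_eq hX h i₀ k hk
  refine projection_deriv_eq_zero (Y := fun t => unfolding (γ t) (k.val + 1)) ?_ ?_
    (transpose_mul_leftInterface h.1 i₀ _ hk)
    (mul_transpose_rightInterface h.2.1 i₀ _ (Nat.succ_pos _) hk.le) (by simpa only [h0]) hM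
  · intro x y
    exact (EuclideanSpace.proj (𝕜 := ℝ)
      ((cut n (k.val + 1)).symm (x, y))).hasFDerivAt.comp_hasDerivAt 0
      hγ.hasDerivAt
  · filter_upwards [hmem] with t ht
    rw [ht k, Fintype.card_fin, bond_succ]

end Unfolding

end TTGrad

namespace TTGrad

/-! ### Gauged form of tangent vectors by telescoping projections -/

section TangentDecomposition

open Matrix

variable {d : ℕ} {n : Fin d → ℕ} {r : Fin (d - 1) → ℕ}

/-- The orthogonal projection, acting on the first `k` indices, onto the span of the columns of the
left interface matrix. -/
noncomputable def lproj (U : Cores n r) (k : ℕ) (hk : k ≤ d)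
    (φ : ((k : Fin d) → Fin (n k)) → ℝ) (i : (k : Fin d) → Fin (n k)) : ℝ :=
  partialProd U i k hk ⬝ᵥ fun a => lsum k (fun x => partialProd U x k hk a * φ x) i

/-- The orthogonal projection, acting on all indices but the first `k`, onto the span of the rows of
the right interface matrix. -/
noncomputable def rproj (V : Cores n r) (k : ℕ) (hk : k ≤ d)
    (φ : ((k : Fin d) → Fin (n k)) → ℝ) (i : (k : Fin d) → Fin (n k)) : ℝ :=
  (fun b => rsum k (fun x => φ x * suffixProd V x k hk b) i) ⬝ᵥ suffixProd V i k hk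

theorem mul_transpose_mul_unfolding (U : Cores n r) (i₀ : (k : Fin d) → Fin (n k)) (k : ℕ)
    (hk : k ≤ d) (A : Tensor n) :
    leftInterface U i₀ k hk * ((leftInterface U i₀ k hk)ᵀ * unfolding A k) =
      unfolding (WithLp.toLp 2 (lproj U k hk A) : Tensor n) k := by
  ext x y
  rw [Matrix.mul_apply, unfolding_apply]
  change _ = lproj U k hk A _
  unfold lproj
  refine Finset.sum_congr rfl fun a _ => ?_
  rw [leftInterface_apply U i₀ k hk x y, Matrix.mul_apply]
  beta_reduce
  rw [lsum_eq_sum_cut]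
  congr 1
  refine Finset.sum_congr rfl fun z _ => ?_
  rw [transpose_apply, leftInterface_apply U i₀ k hk z y, Equiv.apply_symm_apply, unfolding_apply]

theorem unfolding_mul_transpose_mul (V : Cores n r) (i₀ : (k : Fin d) → Fin (n k)) (k : ℕ)
    (hk : k ≤ d) (A : Tensor n) :
    (unfolding A k * (rightInterface V i₀ k hk)ᵀ) * rightInterface V i₀ k hk =
      unfolding (WithLp.toLp 2 (rproj V k hk A) : Tensor n) k := by
  ext x y
  rw [Matrix.mul_apply, unfolding_apply]
  change _ = rproj V k hk A _
  unfold rproj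
  refine Finset.sum_congr rfl fun a _ => ?_
  rw [rightInterface_apply V i₀ k hk x y, Matrix.mul_apply]
  beta_reduce
  rw [rsum_eq_sum_cut]
  congr 1
  refine Finset.sum_congr rfl fun z _ => ?_
  rw [transpose_apply, rightInterface_apply V i₀ k hk x z, Equiv.apply_symm_apply, unfolding_apply]

/-- Expansion of `(1 - P) A (1 - Q) = 0`, with `P` acting as `lproj` and `Q` as `rproj`. -/
theorem sub_lproj_sub_rproj {U V : Cores n r} {i₀ : (k : Fin d) → Fin (n k)} {k : ℕ} {hk : k ≤ d}
    {A : Tensor n} (h : (1 - leftInterface U i₀ k hk * (leftInterface U i₀ k hk)ᵀ) *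
      unfolding A k * (1 - (rightInterface V i₀ k hk)ᵀ * rightInterface V i₀ k hk) = 0)
    (i : (k : Fin d) → Fin (n k)) :
    A i = lproj U k hk A i + rproj V k hk A i - lproj U k hk (rproj V k hk A) i := by
  have h1 : unfolding A k = unfolding (WithLp.toLp 2 (lproj U k hk A) : Tensor n) k +
      unfolding (WithLp.toLp 2 (rproj V k hk A) : Tensor n) k -
      unfolding (WithLp.toLp 2 (lproj U k hk (rproj V k hk A)) : Tensor n) k := by
    have e := mul_transpose_mul_unfolding U i₀ k hk (WithLp.toLp 2 (rproj V k hk A) : Tensor n)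
    rw [← unfolding_mul_transpose_mul V i₀] at e
    change _ = unfolding (WithLp.toLp 2 (lproj U k hk (rproj V k hk A)) : Tensor n) k at e
    rw [← e, ← mul_transpose_mul_unfolding U i₀, ← unfolding_mul_transpose_mul V i₀]
    rw [Matrix.sub_mul, Matrix.one_mul, Matrix.mul_sub, Matrix.mul_one, Matrix.sub_mul] at h
    simp only [Matrix.mul_assoc] at h ⊢
    rw [← sub_eq_zero, ← h]
    abel
  have := congrFun (congrFun h1 (cut n k i).1) (cut n k i).2
  simpa [unfolding_apply] using this

theorem lproj_partialProd {U : Cores n r} (hU : LeftOrthogonal U) (k : ℕ) (hk : k < d)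
    {ξ : ((k : Fin d) → Fin (n k)) → Fin (bond r k) → ℝ} (hξ : DependsFrom k ξ)
    (i : (k : Fin d) → Fin (n k)) :
    lproj U k hk.le (fun i => partialProd U i k hk.le ⬝ᵥ ξ i) i =
      partialProd U i k hk.le ⬝ᵥ ξ i := by
  unfold lproj
  congr 1
  funext a
  have : ∀ x, partialProd U x k hk.le a * (partialProd U x k hk.le ⬝ᵥ ξ x) =
      ∑ c, ξ x c * (partialProd U x k hk.le a * partialProd U x k hk.le c) := by
    intro x
    rw [dotProduct, Finset.mul_sum]
    exact Finset.sum_congr rfl fun c _ => by ring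
  have h2 : ∀ c, lsum k (fun x => ξ x c * (partialProd U x k hk.le a * partialProd U x k hk.le c)) i
      = ξ i c * (if a = c then 1 else 0) := by
    intro c
    rw [lsum_mul_of_dependsFrom (ψ := fun x => ξ x c) (fun x y h => by simp only [hξ x y h]),
      lsum_partialProd hU k hk]
  simp only [this, lsum_sum, h2]
  simp

/-- The left interface at `k + 1` factors through the one at `k`, so the ranges of the left
projections are nested. -/
theorem lproj_lproj_succ {U : Cores n r} (hU : LeftOrthogonal U) (k : Fin d)
    (φ : ((k : Fin d) → Fin (n k)) → ℝ) (i : (k : Fin d) → Fin (n k)) :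
    lproj U k k.isLt.le (lproj U (k + 1) k.isLt φ) i = lproj U (k + 1) k.isLt φ i := by
  have : lproj U (k + 1) k.isLt φ = fun i => partialProd U i k k.isLt.le ⬝ᵥ
      (U k (i k) *ᵥ fun a => lsum (k + 1) (fun x => partialProd U x (k + 1) k.isLt a * φ x) i) := by
    funext i
    rw [lproj, partialProd_succ, ← dotProduct_mulVec]
  rw [this]
  refine lproj_partialProd hU k k.isLt (fun x y h => ?_) i
  have e : (fun a => lsum (k.val + 1) (fun x => partialProd U x (k + 1) k.isLt a * φ x) x) =
      fun a => lsum (k.val + 1) (fun x => partialProd U x (k + 1) k.isLt a * φ x) y :=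
    funext fun a => dependsFrom_lsum _ _ x y fun j hj => h j (by omega)
  rw [h k le_rfl, e]

/-- The contraction of a tensor with all cores but the `k`-th. -/
noncomputable def contraction (U V : Cores n r) (i₀ : (k : Fin d) → Fin (n k))
    (φ : ((k : Fin d) → Fin (n k)) → ℝ) : Cores n r :=
  fun k v => Matrix.of fun a b => lsum k (fun x => partialProd U x k k.isLt.le a *
    rsum (k + 1) (fun z => φ z * suffixProd V z (k + 1) k.isLt b) x) (Function.update i₀ k v)

theorem contraction_apply (U V : Cores n r) (i₀ : (k : Fin d) → Fin (n k))
    (φ : ((k : Fin d) → Fin (n k)) → ℝ) (k : Fin d) (i : (k : Fin d) → Fin (n k)) (a b) :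
    contraction U V i₀ φ k (i k) a b = lsum k (fun x => partialProd U x k k.isLt.le a *
      rsum (k + 1) (fun z => φ z * suffixProd V z (k + 1) k.isLt b) x) i := by
  rw [contraction, of_apply, lsum_eq_sum_cut, lsum_eq_sum_cut]
  refine Finset.sum_congr rfl fun x _ => ?_
  congr 1
  · refine congrFun (partialProd_congr _ _ fun j hj => ?_) a
    rw [cut_symm_of_lt _ _ hj, cut_symm_of_lt _ _ hj]
  · refine rsum_congr_left _ fun j hj => ?_
    by_cases hjk : j.val < k.val
    · rw [cut_symm_of_lt _ _ hjk, cut_symm_of_lt _ _ hjk]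
    · obtain rfl : j = k := Fin.ext (by omega)
      rw [cut_symm_of_le _ _ le_rfl, cut_symm_of_le _ _ le_rfl]
      simp [cut, Equiv.piEquivPiSubtypeProd]

variable {U V : Cores n r}

/-- Projecting to the left and to the right of position `k` leaves one free core there, hence a
single tangent term. Projecting to the left of `k + 1` instead, as in the next lemma, replaces that
core by its part in the range of `U_k`; the difference of the two is gauged. -/
theorem lproj_rproj_succ (i₀ : (k : Fin d) → Fin (n k)) (φ : ((k : Fin d) → Fin (n k)) → ℝ)
    (k : Fin d) (i : (k : Fin d) → Fin (n k)) :
    lproj U k k.isLt.le (rproj V (k + 1) k.isLt φ) i =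
      tangentTerm U V (contraction U V i₀ φ) k i := by
  unfold lproj tangentTerm
  congr 1
  funext a
  rw [mulVec, dotProduct]
  have : ∀ x, partialProd U x k k.isLt.le a * rproj V (k + 1) k.isLt φ x =
      ∑ b, suffixProd V x (k + 1) k.isLt b * (partialProd U x k k.isLt.le a *
        rsum (k + 1) (fun z => φ z * suffixProd V z (k + 1) k.isLt b) x) := by
    intro x
    rw [rproj, dotProduct, Finset.mul_sum]
    exact Finset.sum_congr rfl fun c _ => by ring
  simp only [this, lsum_sum]
  refine Finset.sum_congr rfl fun b _ => ?_
  rw [lsum_mul_of_dependsFrom (ψ := fun x => suffixProd V x (k + 1) k.isLt b), contraction_apply,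
    mul_comm]
  intro x y h
  exact congrFun (dependsFrom_suffixProd V (k + 1) k.isLt x y fun j hj => h j (by omega)) b

theorem lproj_succ_rproj_succ (i₀ : (k : Fin d) → Fin (n k))
    (φ : ((k : Fin d) → Fin (n k)) → ℝ) (k : Fin d) (i : (k : Fin d) → Fin (n k)) :
    lproj U (k + 1) k.isLt (rproj V (k + 1) k.isLt φ) i =
      tangentTerm U V (fun j v => U j v * ∑ w, (U j w)ᵀ * contraction U V i₀ φ j w) k i := by
  rw [lproj, tangentTerm, partialProd_succ, ← dotProduct_mulVec, ← mulVec_mulVec]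
  congr 2
  funext c
  rw [mulVec, dotProduct]
  have : ∀ x, partialProd U x (k + 1) k.isLt c * rproj V (k + 1) k.isLt φ x =
      ∑ b, suffixProd V x (k + 1) k.isLt b * (partialProd U x (k + 1) k.isLt c *
        rsum (k + 1) (fun z => φ z * suffixProd V z (k + 1) k.isLt b) x) := by
    intro x
    rw [rproj, dotProduct, Finset.mul_sum]
    exact Finset.sum_congr rfl fun c _ => by ring
  simp only [this, lsum_sum]
  refine Finset.sum_congr rfl fun b _ => ?_
  rw [lsum_mul_of_dependsFrom (ψ := fun x => suffixProd V x (k + 1) k.isLt b), mul_comm]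
  · congr 1
    rw [lsum_succ, Matrix.sum_apply]
    refine Finset.sum_congr rfl fun v _ => ?_
    rw [Matrix.mul_apply]
    have : lsum k.val (fun x => partialProd U x (k + 1) k.isLt c *
        rsum (k + 1) (fun z => φ z * suffixProd V z (k + 1) k.isLt b) x) (Function.update i k v) =
        lsum k.val (fun x => ∑ a, U k v a c * (partialProd U x k k.isLt.le a *
        rsum (k + 1) (fun z => φ z * suffixProd V z (k + 1) k.isLt b) x))
          (Function.update i k v) := by
      refine lsum_congr fun x hx => ?_
      have hxk : x k = v := by simpa using hx k le_rfl
      rw [partialProd_succ, hxk, vecMul, dotProduct, Finset.sum_mul]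
      exact Finset.sum_congr rfl fun a _ => by ring
    rw [this, lsum_sum]
    refine Finset.sum_congr rfl fun a _ => ?_
    rw [lsum_const_mul, ← contraction_apply U V i₀, Function.update_self, transpose_apply]
  · intro x y h
    exact congrFun (dependsFrom_suffixProd V (k + 1) k.isLt x y h) b

/-- A tensor that satisfies the linearized rank conditions is an element of the tangent space in
gauged form. -/
theorem exists_gauged (hd : 0 < d) (hU : LeftOrthogonal U) (i₀ : (k : Fin d) → Fin (n k))
    (A : Tensor n) (hA : ∀ (k : Fin (d - 1)) (hk : k.val + 1 < d),
      (1 - leftInterface U i₀ (k.val + 1) hk.le * (leftInterface U i₀ (k.val + 1) hk.le)ᵀ) *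
      unfolding A (k.val + 1) *
      (1 - (rightInterface V i₀ (k.val + 1) hk.le)ᵀ * rightInterface V i₀ (k.val + 1) hk.le) = 0) :
    ∃ R : Cores n r, Gauged U R ∧ ∀ i, A i = ∑ k, tangentTerm U V R k i := by
  set Q := contraction U V i₀ A with hQ
  refine ⟨fun k v => if k.val + 1 < d then Q k v - U k v * ∑ w, (U k w)ᵀ * Q k w else Q k v,
    ?_, ?_⟩
  · intro k hk
    simp only [hk, if_true, Matrix.mul_sub, Finset.sum_sub_distrib, ← Matrix.mul_assoc]
    rw [← Finset.sum_mul, hU k hk, Matrix.one_mul, sub_self]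
  intro i
  -- The telescoping quantity is `P_k A`, with `P₀ = 1`. Its value at `d` is set to `0` instead of a
  -- projection, since the last core of `U` is not orthogonal and the last component is not gauged.
  let e : ℕ → ℝ := fun k => if hk : k < d then lproj U k hk.le A i else 0
  have hterm : ∀ k : Fin d, tangentTerm U V (fun k v => if k.val + 1 < d then
      Q k v - U k v * ∑ w, (U k w)ᵀ * Q k w else Q k v) k i = e k - e (k + 1) := by
    intro k
    simp only [e, k.isLt, dif_pos]
    by_cases hk : k.val + 1 < d
    · rw [dif_pos hk]
      -- Apply `P_k` to `A = P_{k+1} A + Q_{k+1} A - P_{k+1} Q_{k+1} A` and use `P_k P_{k+1} =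
      -- P_{k+1}`.
      have h1 : lproj U k k.isLt.le A i = lproj U (k + 1) k.isLt A i +
          lproj U k k.isLt.le (rproj V (k + 1) k.isLt A) i -
          lproj U (k + 1) k.isLt (rproj V (k + 1) k.isLt A) i := by
        have h2 := sub_lproj_sub_rproj (hA ⟨k.val, by omega⟩ hk)
        conv_lhs => rw [funext h2]
        rw [← lproj_lproj_succ hU k A, ← lproj_lproj_succ hU k (rproj V (k + 1) k.isLt A)]
        unfold lproj
        rw [← dotProduct_add, ← dotProduct_sub]
        congr 1
        funext a
        simp only [lsum, Pi.add_apply, Pi.sub_apply, mul_add, mul_sub, Finset.sum_add_distrib,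
          Finset.sum_sub_distrib]
      rw [h1, lproj_rproj_succ i₀, lproj_succ_rproj_succ i₀]
      simp only [tangentTerm, hk, if_true, sub_mulVec, dotProduct_sub]
      ring
    · rw [dif_neg hk, sub_zero]
      have hkd : k.val + 1 = d := by have := k.isLt; omega
      -- At the last bond, of size one, the suffix product is `1` and no index is summed, so the
      -- right projection is the identity.
      have h1 : rproj V (k + 1) k.isLt A = A := by
        funext x
        have hs : ∀ (l : ℕ) (hl : l ≤ d), l = d → rproj V l hl A x = A x := by
          rintro l hl rfl
          simp only [rproj, suffixProd_self, rsum_self, dotProduct, mul_one, Finset.sum_const,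
            Finset.card_univ, Fintype.card_fin, bond_self, one_smul]
        exact hs _ _ hkd
      have h2 := lproj_rproj_succ (U := U) (V := V) i₀ A k i
      rw [h1] at h2
      rw [h2, tangentTerm, tangentTerm, if_neg hk]
  rw [Finset.sum_congr rfl fun k _ => hterm k, Fin.sum_univ_eq_sum_range (fun k => e k - e (k + 1)),
    Finset.sum_range_sub']
  have hed : e d = 0 := by simp [e]
  rw [hed, sub_zero]
  simp only [e, hd, dif_pos, lproj, partialProd_zero, lsum_zero, dotProduct, one_mul,
    Finset.sum_const, Finset.card_univ, Fintype.card_fin, bond_zero, one_smul]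

end TangentDecomposition

end TTGrad

namespace TTGrad

/-! ### The projection onto the tangent space in gauged coordinates -/

section RiemannianGradient

open Matrix

variable {d : ℕ} {n : Fin d → ℕ} {r : Fin (d - 1) → ℕ} {U V : Cores n r}

/-- The element of the tangent space with the given components, as a linear map. -/
noncomputable def tangentMap (U V : Cores n r) : Cores n r →ₗ[ℝ] Tensor n where
  toFun R := WithLp.toLp 2 fun i => ∑ k, tangentTerm U V R k i
  map_add' R R' := by
    ext i
    simp [tangentTerm, add_mulVec, dotProduct_add, Finset.sum_add_distrib]
  map_smul' c R := by
    ext i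
    simp [tangentTerm, smul_mulVec, dotProduct_smul, Finset.mul_sum]

theorem tangentMap_apply (R : Cores n r) (i : (k : Fin d) → Fin (n k)) :
    tangentMap U V R i = ∑ k, tangentTerm U V R k i := rfl

theorem tensor_blockCores_eq (hd : 0 < d) (R U V : Cores n r) :
    tensor (blockCores R U V) = tangentMap U V R := by
  ext i
  exact tensor_blockCores hd R U V i

/-- Cores as a linear function of their entries. -/
noncomputable def ofEntriesLinear (n : Fin d → ℕ) (r : Fin (d - 1) → ℕ) :
    (CoreIdx n r → ℝ) →ₗ[ℝ] Cores n r where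
  toFun := Cores.ofEntries
  map_add' _ _ := rfl
  map_smul' _ _ := rfl

/-- Positions of entries as tuples. -/
def coreIdxEquiv (n : Fin d → ℕ) (r : Fin (d - 1) → ℕ) : CoreIdx n r ≃
    (k : Fin d) × Fin (n k) × Fin (bond r (k.val + 1)) × Fin (bond r k.val) where
  toFun j := ⟨j.k, j.i, j.b, j.a⟩
  invFun x := ⟨x.1, x.2.2.2, x.2.1, x.2.2.1⟩
  left_inv _ := rfl
  right_inv _ := rfl

theorem sum_entry_mul_entry (D R : Cores n r) :
    ∑ j, D.entry j * R.entry j = ∑ k, ∑ v, ((D k v)ᵀ * R k v).trace := by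
  rw [← (coreIdxEquiv n r).symm.sum_comp, Fintype.sum_sigma]
  refine Finset.sum_congr rfl fun k _ => ?_
  simp only [Fintype.sum_prod_type]
  rfl

/-- The mixed terms vanish: for each pair of positions the gauge condition of whichever factor has
the smaller position is used, so both `R` and `R'` are assumed gauged. -/
theorem inner_tangentMap_of_gauged (hU : LeftOrthogonal U) (hV : RightOrthogonal V)
    (i₀ : (k : Fin d) → Fin (n k)) {R R' : Cores n r} (hR : Gauged U R) (hR' : Gauged U R') :
    inner ℝ (tangentMap U V R) (tangentMap U V R') = ∑ j, R.entry j * R'.entry j := by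
  rw [sum_entry_mul_entry, PiLp.inner_apply]
  simp only [tangentMap_apply, RCLike.inner_apply, conj_trivial]
  have : ∀ i, (∑ k, tangentTerm U V R' k i) * ∑ k, tangentTerm U V R k i =
      ∑ j, ∑ k, tangentTerm U V R j i * tangentTerm U V R' k i := by
    intro i
    rw [mul_comm, Finset.sum_mul_sum]
  simp only [this]
  rw [Finset.sum_comm]
  refine Finset.sum_congr rfl fun j _ => ?_
  rw [Finset.sum_comm, Finset.sum_eq_single j, sum_tangentTerm_mul_self hU hV R R' j i₀]
  · intro k _ hk
    rcases lt_or_gt_of_ne hk with h | h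
    · simp only [mul_comm (tangentTerm U V R j _)]
      exact sum_tangentTerm_mul_of_lt hU hR' h
    · exact sum_tangentTerm_mul_of_lt hU hR h
  · simp

/-- The projection of derivatives onto the gauge conditions. -/
noncomputable def gaugePart (U D : Cores n r) : Cores n r := fun k i =>
  if k.val + 1 < d then D k i - U k i * ∑ j, (U k j)ᵀ * D k j else D k i

theorem gauged_gaugePart (hU : LeftOrthogonal U) (D : Cores n r) : Gauged U (gaugePart U D) := by
  intro k hk
  simp only [gaugePart, hk, if_true, Matrix.mul_sub, Finset.sum_sub_distrib, ← Matrix.mul_assoc]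
  rw [← Finset.sum_mul, hU k hk, Matrix.one_mul, sub_self]

/-- What `gaugePart` removes has the form `U_k B`, and `⟨U_k B, R_k⟩ = tr(Bᵀ ∑ U_kᵀ R_k) = 0` for
gauged `R`. -/
theorem sum_gaugePart_mul (D : Cores n r) {R : Cores n r} (hR : Gauged U R) :
    ∑ j, (gaugePart U D).entry j * R.entry j = ∑ j, D.entry j * R.entry j := by
  rw [sum_entry_mul_entry, sum_entry_mul_entry]
  refine Finset.sum_congr rfl fun k _ => ?_
  by_cases hk : k.val + 1 < d
  · simp only [gaugePart, hk, if_true]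
    simp only [transpose_sub, Matrix.sub_mul, trace_sub, Finset.sum_sub_distrib, transpose_mul,
      Matrix.mul_assoc]
    rw [← trace_sum (f := fun x => _ * ((U k x)ᵀ * R k x)), ← Finset.mul_sum, hR k hk]
    simp
  · simp [gaugePart, hk]

theorem tangentMap_mem_tangentSpace {X : Tensor n} (hX : X ∈ fixedRank n r) {S : Cores n r}
    (h : IsOrthogonalization X U V S) (i₀ : (k : Fin d) → Fin (n k)) (R : Cores n r) :
    tangentMap U V R ∈ tangentSpace (fixedRank n r) X := by
  have : tangentMap U V R = ∑ k, (WithLp.toLp 2 (tangentTerm U V R k) : Tensor n) := by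
    ext i
    simp [tangentMap_apply]
  rw [this]
  exact Submodule.sum_mem _ fun k _ => tangentTerm_mem_tangentSpace hX h i₀ R k

/-- Velocities have a gauged form by the linearized rank conditions; gauged cores form a subspace,
so the span adds nothing new. -/
theorem exists_gauged_of_mem_tangentSpace (hd : 0 < d) {X : Tensor n} (hX : X ∈ fixedRank n r)
    {S : Cores n r} (h : IsOrthogonalization X U V S) (i₀ : (k : Fin d) → Fin (n k))
    {w : Tensor n} (hw : w ∈ tangentSpace (fixedRank n r) X) :
    ∃ R, Gauged U R ∧ w = tangentMap U V R := by
  induction hw using Submodule.span_induction with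
  | mem w hw =>
    obtain ⟨γ, h0, hγ, hmem, rfl⟩ := hw
    obtain ⟨R, hR, hR'⟩ := exists_gauged (V := V) hd h.1 i₀ (deriv γ 0) fun k hk =>
      projection_velocity_eq_zero hX h i₀ h0 (hγ.differentiableAt (by simp)) hmem k hk
    exact ⟨R, hR, by ext i; exact hR' i⟩
  | zero => exact ⟨0, fun k _ => by simp, by simp⟩
  | add x y _ _ hx hy =>
    obtain ⟨R, hR, rfl⟩ := hx
    obtain ⟨R', hR', rfl⟩ := hy
    refine ⟨R + R', fun k hk => ?_, by rw [map_add]⟩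
    simp [Matrix.mul_add, Finset.sum_add_distrib, hR k hk, hR' k hk]
  | smul c x _ hx =>
    obtain ⟨R, hR, rfl⟩ := hx
    refine ⟨c • R, fun k hk => ?_, by rw [map_smul]⟩
    simp [← Finset.smul_sum, hR k hk]

theorem inner_tangentMap (u : Tensor n) {D : Cores n r}
    (hD : ∀ j, D.entry j = inner ℝ u (tangentMap U V (Cores.ofEntries (Pi.single j 1))))
    (R : Cores n r) : inner ℝ u (tangentMap U V R) = ∑ j, D.entry j * R.entry j := by
  have h1 : R = ofEntriesLinear n r (∑ j, R.entry j • Pi.single j 1) := by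
    have : (∑ j, R.entry j • Pi.single j (1 : ℝ)) = R.entry := by
      funext l
      simp [Finset.sum_apply, Pi.single_apply]
    rw [this]
    rfl
  conv_lhs => rw [h1]
  simp only [map_sum, map_smul, inner_sum, inner_smul_right]
  refine Finset.sum_congr rfl fun j _ => ?_
  rw [hD j, mul_comm]
  rfl

/-- For gauged `R`, `⟨u, T_X(R)⟩ = ⟨D, R⟩ = ⟨gaugePart D, R⟩ = ⟨T_X(gaugePart D), T_X(R)⟩`. Hence `u
- T_X(gaugePart D)` is orthogonal to the tangent space, to which `T_X(gaugePart D)` belongs. -/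
theorem tensor_blockCores_gaugePart (hd : 0 < d) {X : Tensor n} (hX : X ∈ fixedRank n r)
    {S : Cores n r} (h : IsOrthogonalization X U V S) (i₀ : (k : Fin d) → Fin (n k))
    (u : Tensor n) {D : Cores n r}
    (hD : ∀ j, D.entry j = inner ℝ u (tangentMap U V (Cores.ofEntries (Pi.single j 1)))) :
    tensor (blockCores (gaugePart U D) U V) =
      (tangentSpace (fixedRank n r) X).starProjection u := by
  rw [tensor_blockCores_eq hd]
  refine (Submodule.eq_starProjection_of_mem_of_inner_eq_zero
    (tangentMap_mem_tangentSpace hX h i₀ _) fun w hw => ?_).symm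
  obtain ⟨R, hR, rfl⟩ := exists_gauged_of_mem_tangentSpace hd hX h i₀ hw
  rw [inner_sub_left, inner_tangentMap u hD, inner_tangentMap_of_gauged h.1 h.2.1 i₀
    (gauged_gaugePart h.1 D) hR, sum_gaugePart_mul D hR, sub_self]

theorem tangentMap_basePoint {X : Tensor n} (hd : 0 < d) {S : Cores n r}
    (h : IsOrthogonalization X U V S) : tangentMap U V (Cores.ofEntries (basePoint S)) = X := by
  have hX := h.2.2 ⟨0, hd⟩
  rw [← hX]
  ext i
  rw [tangentMap_apply, Finset.sum_eq_single ⟨0, hd⟩]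
  · change _ = tensor (mixedCores U S V ⟨0, hd⟩) i
    rw [tensor_mixedCores]
    unfold tangentTerm
    congr 2
  · intro k _ hk
    have hk0 : k.val ≠ 0 := fun e => hk (Fin.ext e)
    have : Cores.ofEntries (basePoint S) k (i k) = 0 := by
      ext a b
      simp [Cores.ofEntries, basePoint, hk0]
    rw [tangentTerm, this, zero_mulVec, dotProduct_zero]
  · simp

theorem hasFDerivAt_comp_tangentMap {X : Tensor n} (hd : 0 < d) {S : Cores n r}
    (h : IsOrthogonalization X U V S) {f : Tensor n → ℝ} (hf : DifferentiableAt ℝ f X) :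
    HasFDerivAt (fun R => f (tensor (blockCores (Cores.ofEntries R) U V)))
      ((fderiv ℝ f X).comp
        (LinearMap.toContinuousLinearMap (tangentMap U V ∘ₗ ofEntriesLinear n r)))
      (basePoint S) := by
  simp only [tensor_blockCores_eq hd]
  have h1 := (LinearMap.toContinuousLinearMap (tangentMap U V ∘ₗ ofEntriesLinear n r)).hasFDerivAt
    (x := basePoint S)
  refine HasFDerivAt.comp (basePoint S) (f := fun R => tangentMap U V (Cores.ofEntries R)) ?_ h1
  rw [tangentMap_basePoint hd h]
  exact hf.hasFDerivAt

theorem fderiv_comp_tangentMap {X : Tensor n} (hd : 0 < d) {S : Cores n r}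
    (h : IsOrthogonalization X U V S) {f : Tensor n → ℝ} (hf : DifferentiableAt ℝ f X)
    (v : CoreIdx n r → ℝ) :
    fderiv ℝ (fun R => f (tensor (blockCores (Cores.ofEntries R) U V))) (basePoint S) v =
      inner ℝ (gradient f X) (tangentMap U V (Cores.ofEntries v)) := by
  rw [(hasFDerivAt_comp_tangentMap hd h hf).fderiv]
  rw [← InnerProductSpace.toDual_apply_apply (𝕜 := ℝ), toDual_gradient]
  rfl

end RiemannianGradient

end TTGrad

namespace TTGrad

open Code

/-! ### Loops of accumulations -/

section Loops

variable {R α β γ : Type}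

/-- Nested loops become one loop over a product list, to which `runs_parallel` applies. -/
theorem flatMap_flatMap_eq (l₁ : List α) (l₂ : List β) (body : α → β → List γ) :
    (l₁.flatMap fun a => l₂.flatMap fun b => body a b) =
      (l₁ ×ˢ l₂).flatMap fun x => body x.1 x.2 := by
  simp [SProd.sprod, List.product, List.flatMap_assoc, List.flatMap_map]

theorem flatMap_flatMap_flatMap_eq {δ : Type} (l₁ : List α) (l₂ : List β) (l₃ : List γ)
    (body : α → β → γ → List δ) :
    (l₁.flatMap fun a => l₂.flatMap fun b => l₃.flatMap fun c => body a b c) =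
      (l₁ ×ˢ l₂ ×ˢ l₃).flatMap fun x => body x.1 x.2.1 x.2.2 := by
  simp [SProd.sprod, List.product, List.flatMap_assoc, List.flatMap_map]

theorem Code.Runs.of_eq {c c' : Code R} {m : R → ℝ} {Q : (R → ℝ) → Prop} (h : c = c')
    (hc : Runs c' m Q) : Runs c m Q :=
  h ▸ hc

theorem runs_sumProds (l : List α) (hl : l.Nodup) {dst : α → R} {tmp : R}
    (hdst : Function.Injective dst) (htmp : ∀ a, dst a ≠ tmp) (pairs : α → List (R × R))
    (hpairs : ∀ a, ∀ xy ∈ pairs a, (∀ b, xy.1 ≠ dst b) ∧ xy.1 ≠ tmp ∧ (∀ b, xy.2 ≠ dst b) ∧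
      xy.2 ≠ tmp) (m : R → ℝ) :
    Runs (l.flatMap fun a => sumProd (dst a) tmp (pairs a)) m fun m' =>
      (∀ a ∈ l, m' (dst a) = ((pairs a).map fun xy => m xy.1 * m xy.2).sum) ∧
      ∀ x, (∀ a ∈ l, x ≠ dst a) → x ≠ tmp → m' x = m x := by
  refine runs_parallel l hl _ dst hdst {tmp} htmp _ m fun a ha m' h1 h2 => ?_
  refine (runs_sumProd (pairs a) (htmp a) (fun xy hxy => ?_) m').mono fun m'' h => ⟨?_, h.2⟩
  · obtain ⟨p1, p2, p3, p4⟩ := hpairs a xy hxy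
    exact ⟨p1 a, p2, p3 a, p4⟩
  · rw [h.1]
    congr 1
    refine List.map_congr_left fun xy hxy => ?_
    obtain ⟨p1, p2, p3, p4⟩ := hpairs a xy hxy
    rw [h1 _ p1 p2, h1 _ p3 p4]

theorem runs_subProds (l : List α) (hl : l.Nodup) {dst : α → R} {tmp : R}
    (hdst : Function.Injective dst) (htmp : ∀ a, dst a ≠ tmp) (pairs : α → List (R × R))
    (hpairs : ∀ a, ∀ xy ∈ pairs a, (∀ b, xy.1 ≠ dst b) ∧ xy.1 ≠ tmp ∧ (∀ b, xy.2 ≠ dst b) ∧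
      xy.2 ≠ tmp) (m : R → ℝ) :
    Runs (l.flatMap fun a => subProd (dst a) tmp (pairs a)) m fun m' =>
      (∀ a ∈ l, m' (dst a) = m (dst a) - ((pairs a).map fun xy => m xy.1 * m xy.2).sum) ∧
      ∀ x, (∀ a ∈ l, x ≠ dst a) → x ≠ tmp → m' x = m x := by
  refine runs_parallel l hl _ dst hdst {tmp} htmp _ m fun a ha m' h1 h2 => ?_
  refine (runs_subProd (pairs a) (htmp a) (fun xy hxy => ?_) m').mono fun m'' h => ⟨?_, h.2⟩
  · obtain ⟨p1, p2, p3, p4⟩ := hpairs a xy hxy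
    exact ⟨p1 a, p2, p3 a, p4⟩
  · rw [h.1, h2]
    congr 2
    refine List.map_congr_left fun xy hxy => ?_
    obtain ⟨p1, p2, p3, p4⟩ := hpairs a xy hxy
    rw [h1 _ p1 p2, h1 _ p3 p4]

end Loops

/-! ### One step of each orthogonalization sweep -/

section Algorithm

open Matrix

variable {d : ℕ} {n : Fin d → ℕ} {r : Fin (d - 1) → ℕ}

theorem mem_allEntries (j : CoreIdx n r) : j ∈ allEntries n r := by
  simp only [allEntries, coreEntries, List.mem_flatMap, List.mem_map, List.mem_finRange, true_and]
  exact ⟨j.k, j.a, j.i, j.b, rfl⟩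

theorem linearIndependent_of_dotProduct {μ : Type} {s : ℕ} {v : Fin s → μ → ℝ}
    (h : ∀ y : Fin s → ℝ, (∀ x, ∑ b, y b * v b x = 0) → y = 0) : LinearIndependent ℝ v := by
  rw [Fintype.linearIndependent_iff]
  intro y hy b
  rw [h y fun x => by simpa using congrFun hy x]
  rfl

/-- The code that multiplies the left core by the triangular factor in the sweep to the left. -/
theorem runs_mulLeft (k : Fin (d - 1)) (m : Reg n r → ℝ) :
    Runs ((List.finRange (bond r (lo k).val)).flatMap fun a =>
      (List.finRange (n (lo k))).flatMap fun i =>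
        (List.finRange (bond r (k.val + 1))).flatMap fun b =>
          sumProd (Reg.W ⟨lo k, a, i, b⟩) Reg.tmp
            ((List.finRange (bond r (k.val + 1))).map fun c =>
              (Reg.G ⟨lo k, a, i, c⟩, Reg.L k b c))) m fun m' =>
      (∀ a i (b : Fin (bond r (k.val + 1))), m' (Reg.W ⟨lo k, a, i, b⟩) =
        ∑ c : Fin (bond r (k.val + 1)), m (Reg.G ⟨lo k, a, i, c⟩) * m (Reg.L k b c)) ∧
      ∀ x, (∀ a i (b : Fin (bond r (k.val + 1))), x ≠ Reg.W ⟨lo k, a, i, b⟩) → x ≠ Reg.tmp →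
        m' x = m x := by
  refine Runs.of_eq (flatMap_flatMap_flatMap_eq _ _ _ _) ?_
  refine (runs_sumProds _ (((List.nodup_finRange _).product ((List.nodup_finRange _).product
    (List.nodup_finRange _))))
    (dst := fun x : Fin (bond r (lo k).val) × Fin (n (lo k)) × Fin (bond r (k.val + 1)) =>
      Reg.W ⟨lo k, x.1, x.2.1, x.2.2⟩) (tmp := Reg.tmp) ?_ (fun _ => nofun) _ ?_ m).mono ?_
  · rintro ⟨a, i, b⟩ ⟨a', i', b'⟩ h
    simp only [Reg.W.injEq, CoreIdx.mk.injEq, heq_eq_eq, true_and] at h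
    obtain ⟨rfl, rfl, rfl⟩ := h
    rfl
  · intro a xy hxy
    obtain ⟨c, -, rfl⟩ := List.mem_map.1 hxy
    exact ⟨nofun, nofun, nofun, nofun⟩
  · rintro m' ⟨h1, h2⟩
    refine ⟨fun a i b => ?_, fun x hx ht => h2 x (fun y _ => hx _ _ _) ht⟩
    refine (h1 (a, i, b) (by simp)).trans ?_
    exact (congrArg List.sum List.map_map).trans (Fin.sum_univ_def _).symm

/-- The code that multiplies the right core by the triangular factor in the sweep to the right. -/
theorem runs_mulRight (k : Fin (d - 1)) (m : Reg n r → ℝ) :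
    Runs ((List.finRange (bond r (k.val + 1))).flatMap fun a =>
      (List.finRange (n (hi k))).flatMap fun i =>
        (List.finRange (bond r ((hi k).val + 1))).flatMap fun b =>
          sumProd (Reg.S ⟨hi k, a, i, b⟩) Reg.tmp
            ((List.finRange (bond r (k.val + 1))).map fun c =>
              (Reg.T k a c, Reg.V ⟨hi k, c, i, b⟩))) m fun m' =>
      (∀ (a : Fin (bond r (k.val + 1))) i b, m' (Reg.S ⟨hi k, a, i, b⟩) =
        ∑ c : Fin (bond r (k.val + 1)), m (Reg.T k a c) * m (Reg.V ⟨hi k, c, i, b⟩)) ∧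
      ∀ x, (∀ (a : Fin (bond r (k.val + 1))) i b, x ≠ Reg.S ⟨hi k, a, i, b⟩) → x ≠ Reg.tmp →
        m' x = m x := by
  refine Runs.of_eq (flatMap_flatMap_flatMap_eq _ _ _ _) ?_
  refine (runs_sumProds _ (((List.nodup_finRange _).product ((List.nodup_finRange _).product
    (List.nodup_finRange _))))
    (dst := fun x : Fin (bond r (k.val + 1)) × Fin (n (hi k)) × Fin (bond r ((hi k).val + 1)) =>
      Reg.S ⟨hi k, x.1, x.2.1, x.2.2⟩) (tmp := Reg.tmp) ?_ (fun _ => nofun) _ ?_ m).mono ?_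
  · rintro ⟨a, i, b⟩ ⟨a', i', b'⟩ h
    simp only [Reg.S.injEq, CoreIdx.mk.injEq, heq_eq_eq, true_and] at h
    obtain ⟨rfl, rfl, rfl⟩ := h
    rfl
  · intro a xy hxy
    obtain ⟨c, -, rfl⟩ := List.mem_map.1 hxy
    exact ⟨nofun, nofun, nofun, nofun⟩
  · rintro m' ⟨h1, h2⟩
    refine ⟨fun a i b => ?_, fun x hx ht => h2 x (fun y _ => hx _ _ _) ht⟩
    refine (h1 (a, i, b) (by simp)).trans ?_
    exact (congrArg List.sum List.map_map).trans (Fin.sum_univ_def _).symm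

/-- The cores held in registers. -/
def coresIn {s : Fin (d - 1) → ℕ} (x : CoreIdx n s → Reg n r) (m : Reg n r → ℝ) : Cores n s :=
  Cores.ofEntries fun j => m (x j)

theorem coresIn_congr {s : Fin (d - 1) → ℕ} {x : CoreIdx n s → Reg n r} {m m' : Reg n r → ℝ}
    (k : Fin d) (h : ∀ a i b, m' (x ⟨k, a, i, b⟩) = m (x ⟨k, a, i, b⟩)) :
    coresIn x m' k = coresIn x m k := by
  funext i
  ext a b
  exact h a i b

theorem coresIn_apply {s : Fin (d - 1) → ℕ} (x : CoreIdx n s → Reg n r) (m : Reg n r → ℝ)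
    (k : Fin d) (i : Fin (n k)) (a b) : coresIn x m k i a b = m (x ⟨k, a, i, b⟩) := rfl

/-- The state of the sweep from the right to the left when it has reached the core `k`. -/
structure RightSweep (G : Cores n r) (k : ℕ) (m : Reg n r → ℝ) : Prop where
  cores : ∀ j, m (Reg.G j) = G.entry j
  orthogonal : ∀ j : Fin d, k < j.val → ∑ i, coresIn Reg.V m j i * (coresIn Reg.V m j i)ᵀ = 1
  represents : ∀ μ : Fin d, μ.val = k →
    tensor (mixedCores G (coresIn Reg.W m) (coresIn Reg.V m) μ) = tensor G

/-- Gram-Schmidt writes the right core as `Lᵀ V`, and `Lᵀ` is absorbed into the left core. The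
product of the two cores, and hence the tensor, is unchanged. -/
theorem RightSweep.step {G : Cores n r} (hG : tensor G ∈ fixedRank n r)
    (i₀ : (k : Fin d) → Fin (n k)) (k : Fin (d - 1)) {m : Reg n r → ℝ}
    (hm : RightSweep G (k.val + 1) m) :
    Runs (gramSchmidt (List.finRange (n (hi k)) ×ˢ List.finRange (bond r ((hi k).val + 1)))
      (bond r (k.val + 1))
      (fun x a => Reg.W ⟨hi k, a, x.1, x.2⟩) (fun x a => Reg.V ⟨hi k, a, x.1, x.2⟩)
      (Reg.L k) Reg.tmp ++
      (List.finRange (bond r (lo k).val)).flatMap fun a =>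
      (List.finRange (n (lo k))).flatMap fun i =>
        (List.finRange (bond r (k.val + 1))).flatMap fun b =>
          sumProd (Reg.W ⟨lo k, a, i, b⟩) Reg.tmp
            ((List.finRange (bond r (k.val + 1))).map fun c =>
              (Reg.G ⟨lo k, a, i, c⟩, Reg.L k b c))) m (RightSweep G k) := by
  have regs : GramSchmidtRegs (R := Reg n r)
      (fun (x : Fin (n (hi k)) × Fin (bond r ((hi k).val + 1))) (a : Fin (bond r (k.val + 1))) =>
        Reg.W ⟨hi k, a, x.1, x.2⟩)
      (fun x a => Reg.V ⟨hi k, a, x.1, x.2⟩) (Reg.L k) Reg.tmp := by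
    constructor
    case injQ =>
      rintro ⟨i, b⟩ a ⟨i', b'⟩ a' h
      simp only [Reg.V.injEq, CoreIdx.mk.injEq, heq_eq_eq, true_and] at h
      obtain ⟨rfl, rfl, rfl⟩ := h
      exact ⟨rfl, rfl⟩
    case injT =>
      intro a b c e h
      simpa using h
    all_goals intros; nofun
  have hT := hm.represents (hi k) rfl
  have hli : LinearIndependent ℝ (column (fun (x : Fin (n (hi k)) × Fin (bond r ((hi k).val + 1)))
      (a : Fin (bond r (k.val + 1))) => Reg.W ⟨hi k, a, x.1, x.2⟩) m) := by
    -- A linear relation among the rows of the right core would annihilate every suffix product at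
    -- this bond, against minimality of the rank.
    refine linearIndependent_of_dotProduct fun y hy => ?_
    refine eq_zero_of_dotProduct_suffixProd (hT ▸ hG) i₀ k (hi k).isLt.le y fun i => ?_
    have e := suffixProd_eq (mixedCores G (coresIn Reg.W m) (coresIn Reg.V m) (hi k)) i (hi k)
    refine (congrArg (fun w => y ⬝ᵥ w) e).trans ?_
    refine (dotProduct_mulVec _ _ _).trans ?_
    have : y ᵥ* mixedCores G (coresIn Reg.W m) (coresIn Reg.V m) (hi k) (hi k) (i (hi k)) = 0 := by
      have e : mixedCores G (coresIn Reg.W m) (coresIn Reg.V m) (hi k) (hi k) =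
          coresIn Reg.W m (hi k) := by simp [mixedCores]
      rw [e]
      funext b
      exact hy (i (hi k), b)
    exact (congrArg (· ⬝ᵥ _) this).trans (zero_dotProduct _)
  refine (runs_gramSchmidt regs ((List.nodup_finRange _).product (List.nodup_finRange _))
    (by simp) m hli).append ?_
  rintro m₁ ⟨hQ, hA, hf⟩
  refine (runs_mulLeft k m₁).mono ?_
  rintro m₂ ⟨hW, hf₂⟩
  have hG₁ : ∀ j, m₁ (Reg.G j) = m (Reg.G j) := fun j => hf _ nofun nofun nofun
  have hV₂ : ∀ j, m₂ (Reg.V j) = m₁ (Reg.V j) := fun j => hf₂ _ nofun nofun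
  have hV : ∀ j : Fin d, j ≠ hi k → coresIn Reg.V m₂ j = coresIn Reg.V m j := by
    intro j hj
    refine coresIn_congr j fun a i b => ?_
    rw [hV₂]
    refine hf (Reg.V ⟨j, a, i, b⟩) (fun x c e => hj ?_) nofun nofun
    exact congrArg CoreIdx.k (Reg.V.inj e)
  refine ⟨fun j => ?_, fun j hj => ?_, fun μ hμ => ?_⟩
  · rw [hf₂ (Reg.G j) nofun nofun, hG₁, hm.cores]
  · by_cases hjk : j = hi k
    · subst hjk
      ext a b
      have := hQ a b
      rw [Fintype.sum_prod_type] at this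
      simp only [Matrix.sum_apply, Matrix.mul_apply, transpose_apply, coresIn_apply, hV₂]
      rw [Matrix.one_apply]
      exact this
    · rw [hV j hjk]
      refine hm.orthogonal j ?_
      have : j.val ≠ k.val + 1 := fun e => hjk (Fin.ext e)
      omega
  · obtain rfl : μ = lo k := Fin.ext hμ
    rw [← hT]
    refine tensor_eq_of_mul_eq k ?_ ?_
    · intro j hj hj' i
      have h1 : j < lo k ↔ j < hi k := by
        have : j.val ≠ k.val := fun e => hj (Fin.ext e)
        simp only [Fin.lt_def, lo, hi]
        omega
      simp only [mixedCores, h1, hj, hj', if_false, hV j hj']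
    · intro i i' a b
      have h1 : lo k < hi k := by simp [Fin.lt_def, lo, hi]
      have h2 : ¬ hi k < lo k := h1.not_gt
      simp only [mixedCores, h1, h1.ne', h2, lt_irrefl, if_true, if_false]
      have e1 : ∀ c, coresIn Reg.W m₂ (lo k) i a c =
          ∑ e, G (lo k) i a e * m₁ (Reg.L k c e) := by
        intro c
        refine (hW a i c).trans ?_
        refine Finset.sum_congr rfl fun e _ => ?_
        rw [hG₁, hm.cores]
        rfl
      have e2 : ∀ c, coresIn Reg.W m (hi k) i' c b =
          ∑ e, m₂ (Reg.V ⟨hi k, e, i', b⟩) * m₁ (Reg.L k e c) := by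
        intro c
        refine (hA (i', b) c).trans ?_
        exact Finset.sum_congr rfl fun e _ => by rw [hV₂]
      refine (Finset.sum_congr rfl fun c _ => congrArg (· * _) (e1 c)).trans
        (Eq.trans ?_ (Finset.sum_congr rfl fun c _ => congrArg (_ * ·) (e2 c)).symm)
      simp only [Finset.sum_mul, Finset.mul_sum]
      refine Finset.sum_comm.trans ?_
      refine Finset.sum_congr rfl fun e _ => Finset.sum_congr rfl fun c _ => ?_
      exact (mul_assoc _ _ _).trans (congrArg (_ * ·) (mul_comm _ _))

/-- The state of the sweep from the left to the right when it has reached the core `k`. -/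
structure LeftSweep (X : Tensor n) (V : Cores n r) (k : ℕ) (m : Reg n r → ℝ) : Prop where
  right : coresIn Reg.V m = V
  orthogonal : ∀ j : Fin d, j.val < k → ∑ i, (coresIn Reg.U m j i)ᵀ * coresIn Reg.U m j i = 1
  represents : ∀ μ : Fin d, μ.val ≤ k →
    tensor (mixedCores (coresIn Reg.U m) (coresIn Reg.S m) V μ) = X

/-- Here `S_k = U_k T` and `S_{k+1} = T V_{k+1}`, so the orthogonality center moves by one core. The
representations with earlier centers persist, because the cores `U` and `S` they use are not written
again. -/
theorem LeftSweep.step {X : Tensor n} (hX : X ∈ fixedRank n r) {V : Cores n r}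
    (i₀ : (k : Fin d) → Fin (n k)) (k : Fin (d - 1)) {m : Reg n r → ℝ}
    (hm : LeftSweep X V k m) :
    Runs (gramSchmidt (List.finRange (bond r (lo k).val) ×ˢ List.finRange (n (lo k)))
      (bond r (k.val + 1))
      (fun x b => Reg.S ⟨lo k, x.1, x.2, b⟩) (fun x b => Reg.U ⟨lo k, x.1, x.2, b⟩)
      (Reg.T k) Reg.tmp ++
      (List.finRange (bond r (k.val + 1))).flatMap fun a =>
      (List.finRange (n (hi k))).flatMap fun i =>
        (List.finRange (bond r ((hi k).val + 1))).flatMap fun b =>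
          sumProd (Reg.S ⟨hi k, a, i, b⟩) Reg.tmp
            ((List.finRange (bond r (k.val + 1))).map fun c =>
              (Reg.T k a c, Reg.V ⟨hi k, c, i, b⟩))) m (LeftSweep X V (k.val + 1)) := by
  have regs : GramSchmidtRegs (R := Reg n r)
      (fun (x : Fin (bond r (lo k).val) × Fin (n (lo k))) (b : Fin (bond r (k.val + 1))) =>
        Reg.S ⟨lo k, x.1, x.2, b⟩)
      (fun x b => Reg.U ⟨lo k, x.1, x.2, b⟩) (Reg.T k) Reg.tmp := by
    constructor
    case injQ =>
      rintro ⟨a, i⟩ b ⟨a', i'⟩ b' h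
      simp only [Reg.U.injEq, CoreIdx.mk.injEq, heq_eq_eq, true_and] at h
      obtain ⟨rfl, rfl, rfl⟩ := h
      exact ⟨rfl, rfl⟩
    case injT =>
      intro a b c e h
      simpa using h
    all_goals intros; nofun
  have hT := hm.represents (lo k) le_rfl
  have hli : LinearIndependent ℝ (column (fun (x : Fin (bond r (lo k).val) × Fin (n (lo k)))
      (b : Fin (bond r (k.val + 1))) => Reg.S ⟨lo k, x.1, x.2, b⟩) m) := by
    refine linearIndependent_of_dotProduct fun y hy => ?_
    refine eq_zero_of_partialProd_dotProduct (hT ▸ hX) i₀ k (hi k).isLt.le y fun i => ?_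
    have e := partialProd_succ (mixedCores (coresIn Reg.U m) (coresIn Reg.S m) V (lo k)) i (lo k)
    refine (congrArg (fun w => w ⬝ᵥ y) e).trans ?_
    refine (dotProduct_mulVec _ _ _).symm.trans ?_
    have : mixedCores (coresIn Reg.U m) (coresIn Reg.S m) V (lo k) (lo k) (i (lo k)) *ᵥ y = 0 := by
      have e : mixedCores (coresIn Reg.U m) (coresIn Reg.S m) V (lo k) (lo k) =
          coresIn Reg.S m (lo k) := by simp [mixedCores]
      rw [e]
      funext a
      exact (Finset.sum_congr rfl fun b _ => mul_comm _ _).trans (hy (a, i (lo k)))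
    exact (congrArg (_ ⬝ᵥ ·) this).trans (dotProduct_zero _)
  refine (runs_gramSchmidt regs ((List.nodup_finRange _).product (List.nodup_finRange _))
    (by simp) m hli).append ?_
  rintro m₁ ⟨hQ, hA, hf⟩
  refine (runs_mulRight k m₁).mono ?_
  rintro m₂ ⟨hS, hf₂⟩
  have hV₁ : ∀ j, m₁ (Reg.V j) = V.entry j := fun j => by
    rw [hf (Reg.V j) nofun nofun nofun, ← hm.right]
    rfl
  have hU₂ : ∀ j, m₂ (Reg.U j) = m₁ (Reg.U j) := fun j => hf₂ _ nofun nofun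
  have hU : ∀ j : Fin d, j ≠ lo k → coresIn Reg.U m₂ j = coresIn Reg.U m j := by
    intro j hj
    refine coresIn_congr j fun a i b => ?_
    rw [hU₂]
    refine hf (Reg.U ⟨j, a, i, b⟩) (fun x c e => hj ?_) nofun nofun
    exact congrArg CoreIdx.k (Reg.U.inj e)
  have hS' : ∀ j : Fin d, j ≠ hi k → coresIn Reg.S m₂ j = coresIn Reg.S m j := by
    intro j hj
    refine coresIn_congr j fun a i b => ?_
    rw [hf₂ (Reg.S ⟨j, a, i, b⟩) (fun a' i' b' e => hj ?_) nofun,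
      hf (Reg.S ⟨j, a, i, b⟩) nofun nofun nofun]
    exact congrArg CoreIdx.k (Reg.S.inj e)
  refine ⟨?_, fun j hj => ?_, fun μ hμ => ?_⟩
  · rw [← hm.right]
    funext j
    exact coresIn_congr j fun a i b => (hf₂ (Reg.V ⟨j, a, i, b⟩) nofun nofun).trans
      (hf (Reg.V ⟨j, a, i, b⟩) nofun nofun nofun)
  · by_cases hjk : j = lo k
    · subst hjk
      ext a b
      have := hQ a b
      rw [Fintype.sum_prod_type, Finset.sum_comm] at this
      simp only [Matrix.sum_apply, Matrix.mul_apply, transpose_apply, coresIn_apply, hU₂]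
      rw [Matrix.one_apply]
      exact this
    · rw [hU j hjk]
      refine hm.orthogonal j ?_
      have : j.val ≠ k.val := fun e => hjk (Fin.ext e)
      omega
  · by_cases hμk : μ.val ≤ k.val
    · rw [← hm.represents μ hμk]
      refine tensor_congr fun j i => ?_
      rcases lt_trichotomy j μ with h | h | h
      · have : j ≠ lo k := fun e => by simp [e, Fin.lt_def, lo] at h; omega
        simp only [mixedCores, h, if_true, hU j this]
      · have : j ≠ hi k := fun e => by rw [← h, e] at hμk; simp [hi] at hμk
        subst h
        simp only [mixedCores, lt_irrefl, if_true, if_false, hS' j this]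
      · simp only [mixedCores, h.not_gt, h.ne', if_false]
    obtain rfl : μ = hi k := Fin.ext (by simp only [hi]; omega)
    rw [← hT]
    refine tensor_eq_of_mul_eq k ?_ ?_
    · intro j hj hj' i
      have h1 : j < lo k ↔ j < hi k := by
        have : j.val ≠ k.val := fun e => hj (Fin.ext e)
        simp only [Fin.lt_def, lo, hi]
        omega
      simp only [mixedCores, h1, hj, hj', if_false, hU j hj]
    · intro i i' a b
      have h1 : lo k < hi k := by simp [Fin.lt_def, lo, hi]
      have h2 : ¬ hi k < lo k := h1.not_gt
      simp only [mixedCores, h1, h1.ne', h2, lt_irrefl, if_true, if_false]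
      have e1 : ∀ c, coresIn Reg.S m₂ (hi k) i' c b =
          ∑ e, m₁ (Reg.T k c e) * V (hi k) i' e b := by
        intro c
        refine (hS c i' b).trans (Finset.sum_congr rfl fun e _ => ?_)
        rw [hV₁]
        rfl
      have e2 : ∀ c, coresIn Reg.S m (lo k) i a c =
          ∑ e, m₂ (Reg.U ⟨lo k, a, i, e⟩) * m₁ (Reg.T k e c) := by
        intro c
        have := hA (a, i) c
        refine this.trans ?_
        exact Finset.sum_congr rfl fun e _ => by rw [hU₂]
      refine (Finset.sum_congr rfl fun c _ => congrArg (_ * ·) (e1 c)).trans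
        (Eq.trans ?_ (Finset.sum_congr rfl fun c _ => congrArg (· * _) (e2 c)).symm)
      simp only [Finset.sum_mul, Finset.mul_sum]
      refine Finset.sum_comm.trans ?_
      refine Finset.sum_congr rfl fun e _ => Finset.sum_congr rfl fun c _ => ?_
      exact (mul_assoc _ _ _).symm

end Algorithm

end TTGrad

namespace TTGrad

open Code

/-! ### The complete orthogonalization -/

section Orthogonalize

variable {d : ℕ} {n : Fin d → ℕ} {r : Fin (d - 1) → ℕ}

/-- A conditional copy loop is a parallel assignment over a filtered list, as `runs_map` requires.
-/
theorem flatMap_ite_eq {α β : Type} (l : List α) (P : α → Prop) [DecidablePred P] (f : α → β) :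
    (l.flatMap fun a => if P a then [f a] else []) = (l.filter fun a => P a).map f := by
  induction l with
  | nil => rfl
  | cons a l ih =>
    rw [List.flatMap_cons, ih, List.filter_cons]
    by_cases h : P a <;> simp [h]

theorem runs_orthogonalize (hd : 0 < d) {G : Cores n r} (hG : tensor G ∈ fixedRank n r)
    (i₀ : (k : Fin d) → Fin (n k)) (m : Reg n r → ℝ) (hm : ∀ j, m (Reg.G j) = G.entry j) :
    Runs (orthogonalize n r) m fun m' =>
      IsOrthogonalization (tensor G) (coresIn Reg.U m') (coresIn Reg.V m') (coresIn Reg.S m') := by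
  unfold orthogonalize
  rw [flatMap_ite_eq, flatMap_ite_eq]
  simp only [List.append_assoc]
  refine (runs_map _ Reg.W (fun a b h => Reg.W.inj h) (fun j => Op.copy (Reg.G j))
    (fun _ _ _ => trivial) m (fun j _ m' h => h (Reg.G j) nofun)).append fun m₁ ⟨h1, f1⟩ => ?_
  refine (runs_finRange_reverse _ (RightSweep G) (fun k m' h => h.step hG i₀ k) ?_).append
    fun m₂ h2 => ?_
  -- The sweep starts at the last core, whose index is `d - 1`: there is no core to its right, and
  -- its `W` is a copy of `G`.
  · refine ⟨fun j => (f1 (Reg.G j) nofun).trans (hm j), fun j hj => ?_, fun μ hμ => ?_⟩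
    · exact absurd j.isLt (by omega)
    · refine tensor_congr fun j i => ?_
      have hj : j.val < d := j.isLt
      rcases lt_trichotomy j μ with h | h | h
      · simp [mixedCores, h]
      · subst h
        simp only [mixedCores, lt_irrefl, if_true, if_false]
        ext a b
        rw [coresIn_apply, h1 ⟨j, a, i, b⟩]
        · exact hm _
        · simp only [List.mem_filter, mem_allEntries, true_and, decide_eq_true_eq]
          omega
      · rw [Fin.lt_def] at h
        omega
  refine (runs_map _ Reg.S (fun a b h => Reg.S.inj h) (fun j => Op.copy (Reg.W j))
    (fun _ _ _ => trivial) m₂ (fun j _ m' h => h (Reg.W j) nofun)).append fun m₃ ⟨h3, f3⟩ => ?_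
  refine (runs_finRange _ (LeftSweep (tensor G) (coresIn Reg.V m₂))
    (fun k m' h => h.step hG i₀ k) ?_).mono fun m₄ h4 => ?_
  · have hV : coresIn Reg.V m₃ = coresIn Reg.V m₂ :=
      funext fun j => coresIn_congr j fun a i b => f3 _ nofun
    -- The final state of the first sweep, with `S₁ = W₁`, is the initial state of the second.
    refine ⟨hV, fun j hj => absurd hj (Nat.not_lt_zero _), fun μ hμ => ?_⟩
    rw [← h2.represents μ (by omega)]
    refine tensor_congr fun j i => ?_
    rcases lt_trichotomy j μ with h | h | h
    · rw [Fin.lt_def] at h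
      omega
    · subst h
      simp only [mixedCores, lt_irrefl, if_true, if_false]
      ext a b
      rw [coresIn_apply, h3 ⟨j, a, i, b⟩]
      · rfl
      · simp only [List.mem_filter, mem_allEntries, true_and, decide_eq_true_eq]
        omega
    · simp only [mixedCores, h.not_gt, h.ne', if_false]
  · refine ⟨fun k hk => h4.orthogonal k (by omega), fun k hk => ?_, fun μ => ?_⟩
    · rw [h4.right]
      exact h2.orthogonal k hk
    · rw [h4.right]
      exact h4.represents μ (by have := μ.isLt; omega)

end Orthogonalize

/-! ### The program of `g` -/

section GProgram

variable {d : ℕ} {n : Fin d → ℕ} {r : Fin (d - 1) → ℕ}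

theorem Op.args_rename {R R' : Type} (φ : R → R') (o : Op R) :
    (o.rename φ).args = o.args.map φ := by
  cases o <;> rfl

/-- The first part of the program of `g` reads only inputs, so no assignment can follow a read of an
intermediate variable there. -/
theorem singleAssignment_append {ι ν : Type} {c₁ c₂ : List (ν × Op (ι ⊕ ν))}
    (hargs : ∀ vo ∈ c₁, ∀ w, Sum.inr w ∉ vo.2.args) (hnodup : (c₁.map Prod.fst).Nodup)
    (hdisj : ∀ vo ∈ c₁, ∀ yo ∈ c₂, yo.1 ≠ vo.1) (h : SingleAssignment c₂) :
    SingleAssignment (c₁ ++ c₂) := by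
  induction c₁ with
  | nil => exact h
  | cons vo c ih =>
    rw [List.map_cons, List.nodup_cons] at hnodup
    refine ⟨fun w hw => absurd hw (hargs vo List.mem_cons_self w), fun yo hyo => ?_,
      ih (fun vo h => hargs vo (List.mem_cons_of_mem _ h)) hnodup.2
        fun vo h => hdisj vo (List.mem_cons_of_mem _ h)⟩
    rcases List.mem_append.1 hyo with hyo | hyo
    · exact fun e => hnodup.1 (e ▸ List.mem_map_of_mem hyo)
    · exact hdisj vo List.mem_cons_self yo hyo

theorem SingleAssignment.map_inr {ι κ ν : Type} {c : List (ν × Op (κ ⊕ ν))}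
    (h : SingleAssignment c) : SingleAssignment (ι := ι) (ν := κ ⊕ ν)
      (c.map fun vo => (Sum.inr vo.1, vo.2.rename Sum.inr)) := by
  induction c with
  | nil => trivial
  | cons vo c ih =>
    obtain ⟨v, o⟩ := vo
    obtain ⟨h1, h2, h3⟩ := h
    refine ⟨?_, ?_, ih h3⟩
    · intro w hw
      rw [Op.args_rename, List.mem_map] at hw
      obtain ⟨x, hx, hxw⟩ := hw
      obtain rfl := Sum.inr_injective hxw
      rcases x with i | x
      · refine ⟨nofun, fun yo hyo => ?_⟩
        obtain ⟨zo, -, rfl⟩ := List.mem_map.1 hyo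
        exact nofun
      · refine ⟨fun e => (h1 x hx).1 (Sum.inr_injective e), fun yo hyo => ?_⟩
        obtain ⟨zo, hzo, rfl⟩ := List.mem_map.1 hyo
        exact fun e => (h1 x hx).2 zo hzo (Sum.inr_injective e)
    · intro yo hyo
      obtain ⟨zo, hzo, rfl⟩ := List.mem_map.1 hyo
      exact fun e => h2 zo hzo (Sum.inr_injective e)

theorem nodup_allEntries (n : Fin d → ℕ) (r : Fin (d - 1) → ℕ) : (allEntries n r).Nodup := by
  unfold allEntries coreEntries
  simp only [List.nodup_flatMap, List.nodup_finRange, List.mem_finRange, true_and, forall_const]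
  have hpw : ∀ {s : ℕ} {α : Type} (f : Fin s → List α), (∀ a b, a ≠ b → List.Disjoint (f a) (f b)) →
      List.Pairwise (Function.onFun List.Disjoint f) (List.finRange s) := fun f hf =>
    (List.nodup_finRange _).imp fun h => hf _ _ h
  refine ⟨fun k => ⟨fun a => ⟨fun i => ?_, hpw _ ?_⟩, hpw _ ?_⟩, hpw _ ?_⟩
  · refine (List.nodup_finRange _).map fun b b' h => ?_
    simpa using h
  all_goals
    intro a b hab x hx hx'
    simp only [List.mem_flatMap, List.mem_map, List.mem_finRange, true_and] at hx hx'
  · obtain ⟨_, rfl⟩ := hx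
    obtain ⟨_, h⟩ := hx'
    simp only [CoreIdx.mk.injEq, heq_eq_eq, true_and] at h
    exact hab h.1.symm
  · obtain ⟨_, _, rfl⟩ := hx
    obtain ⟨_, _, h⟩ := hx'
    simp only [CoreIdx.mk.injEq, heq_eq_eq, true_and] at h
    exact hab h.1.symm
  · obtain ⟨_, _, _, rfl⟩ := hx
    obtain ⟨_, _, _, h⟩ := hx'
    exact hab (congrArg CoreIdx.k h).symm

theorem blockOp_defined {R : Type} (δ U V : CoreIdx n r → R) (j : CoreIdx n (2 • r)) (m : R → ℝ) :
    (blockOp δ U V j).Defined m := by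
  unfold blockOp blockEntry
  split <;> trivial

theorem blockOp_eval {R : Type} (δ U V : CoreIdx n r → R) (j : CoreIdx n (2 • r)) (m : R → ℝ) :
    (blockOp δ U V j).eval m = blockEntry 0 (m ∘ δ) (m ∘ U) (m ∘ V) j := by
  unfold blockOp blockEntry
  rcases splitBond r j.k.val j.a with _ | _ <;>
    rcases splitBond r (j.k.val + 1) j.b with _ | _ <;> rfl

theorem blockOp_eval_congr {R : Type} {δ U V : CoreIdx n r → R} (j : CoreIdx n (2 • r))
    {m m' : R → ℝ} (hδ : ∀ l, m' (δ l) = m (δ l)) (hU : ∀ l, m' (U l) = m (U l))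
    (hV : ∀ l, m' (V l) = m (V l)) : (blockOp δ U V j).eval m' = (blockOp δ U V j).eval m := by
  rw [blockOp_eval, blockOp_eval, show m' ∘ δ = m ∘ δ from funext hδ,
    show m' ∘ U = m ∘ U from funext hU, show m' ∘ V = m ∘ V from funext hV]

theorem mem_args_blockOp {R : Type} {δ U V : CoreIdx n r → R} {j : CoreIdx n (2 • r)} {x : R}
    (h : x ∈ (blockOp δ U V j).args) : ∃ l, x = δ l ∨ x = U l ∨ x = V l := by
  unfold blockOp blockEntry at h
  split at h <;> simp only [Op.args, List.mem_cons, List.not_mem_nil, or_false] at h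
  · exact ⟨_, .inr (.inr h)⟩
  · exact ⟨_, .inl h⟩
  · exact ⟨_, .inr (.inl h)⟩

/-- `U_d` and `V_1` never occur: the bond `0` has only the second block and the bond `d` only the
first. Their registers, which are never computed, may therefore hold anything. -/
theorem blockEntry_congr (hd : 0 < d) {α : Type} {zero : α} {δ U V δ' U' V' : CoreIdx n r → α}
    (hδ : ∀ j, δ j = δ' j) (hU : ∀ j, j.k.val + 1 < d → U j = U' j)
    (hV : ∀ j, 0 < j.k.val → V j = V' j) (j : CoreIdx n (2 • r)) :
    blockEntry zero δ U V j = blockEntry zero δ' U' V' j := by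
  obtain ⟨k, a, i, b⟩ := j
  unfold blockEntry
  rcases ha : splitBond r k.val a with a' | a' <;>
    rcases hb : splitBond r (k.val + 1) b with b' | b' <;> dsimp only
  · refine hV _ (Nat.pos_of_ne_zero fun e => ?_)
    have : ∀ (l : ℕ) (x : Fin (bond (2 • r) l)) y, l = 0 → splitBond r l x ≠ .inl y := by
      rintro l x y rfl h
      obtain ⟨c, hc⟩ := splitBond_zero r x
      rw [hc] at h
      cases h
    exact this _ _ _ e ha
  · exact hδ _
  · refine hU _ (lt_of_le_of_ne k.isLt fun e => ?_)
    have : ∀ (l : ℕ) (x : Fin (bond (2 • r) l)) y, l = d → splitBond r l x ≠ .inr y := by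
      rintro l x y rfl h
      obtain ⟨c, hc⟩ := splitBond_self hd r x
      rw [hc] at h
      cases h
    exact this _ _ _ e hb

theorem gProgram_singleAssignment {p : Program (CoreIdx n (2 • r)) ℕ} (hp : p.WellFormed) :
    SingleAssignment (gProgram p).code := by
  refine singleAssignment_append ?_ ?_ ?_ hp.singleAssignment.map_inr
  · intro vo hvo w hw
    obtain ⟨j, -, rfl⟩ := List.mem_map.1 hvo
    dsimp only at hw
    obtain ⟨l, h | h | h⟩ := mem_args_blockOp hw <;> cases h
  · rw [List.map_map]
    exact (nodup_allEntries n (2 • r)).map Sum.inl_injective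
  · intro vo hvo yo hyo
    obtain ⟨j, -, rfl⟩ := List.mem_map.1 hvo
    obtain ⟨l, -, rfl⟩ := List.mem_map.1 hyo
    exact nofun

/-- The cores formed by the program of `g`. -/
noncomputable def gCores (z : GInput n r ⊕ (CoreIdx n (2 • r) ⊕ ℕ) → ℝ) : Cores n (2 • r) :=
  blockCores (Cores.ofEntries fun j => z (.inl (.R j))) (Cores.ofEntries fun j => z (.inl (.U j)))
    (Cores.ofEntries fun j => z (.inl (.V j)))

/-- After the copying phase the inputs of `p` hold the block cores, and well-formedness makes the
other registers of `z` irrelevant. -/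
theorem gProgram_spec {p : Program (CoreIdx n (2 • r)) ℕ} (hp : p.WellFormed)
    (z : GInput n r ⊕ (CoreIdx n (2 • r) ⊕ ℕ) → ℝ) :
    (Code.Defined (gProgram p).toCode z ↔ p.Defined (gCores z).entry) ∧
      exec (gProgram p).toCode z (gProgram p).out = p.eval (gCores z).entry := by
  have e : (gProgram p).toCode = (allEntries n (2 • r)).map (fun j => (Sum.inr (Sum.inl j),
      blockOp (fun j => .inl (.R j)) (fun j => .inl (.U j)) (fun j => .inl (.V j)) j)) ++
      p.toCode.rename Sum.inr := by
    simp only [Program.toCode, gProgram, List.map_append, List.map_map, Code.rename]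
    rfl
  have h1 := runs_map (allEntries n (2 • r))
    (fun j => (Sum.inr (Sum.inl j) : GInput n r ⊕ (CoreIdx n (2 • r) ⊕ ℕ)))
    (fun a b h => Sum.inl_injective (Sum.inr_injective h))
    (blockOp (fun j => .inl (.R j)) (fun j => .inl (.U j)) (fun j => .inl (.V j)))
    (fun a _ m => blockOp_defined _ _ _ _ _) z (by
      intro j _ m' hm'
      exact blockOp_eval_congr j (fun l => hm' _ nofun) (fun l => hm' _ nofun)
        (fun l => hm' _ nofun))
  obtain ⟨h1d, h1v, -⟩ := h1
  rw [e, defined_append, exec_append, defined_rename _ Sum.inr_injective]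
  set z₁ := exec ((allEntries n (2 • r)).map (fun j => ((Sum.inr (Sum.inl j) :
    GInput n r ⊕ (CoreIdx n (2 • r) ⊕ ℕ)),
      blockOp (fun j => .inl (.R j)) (fun j => .inl (.U j)) (fun j => .inl (.V j)) j))) z
  have h2 := congrFun (exec_rename (Sum.inr : _ → GInput n r ⊕ (CoreIdx n (2 • r) ⊕ ℕ))
    Sum.inr_injective p.toCode z₁) p.out
  have h3 := hp.exec_congr (z₁ ∘ Sum.inr) (Program.initial (gCores z).entry) (by
    intro j
    refine (h1v j (mem_allEntries j)).trans ?_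
    rw [blockOp_eval]
    rfl)
  refine ⟨?_, ?_⟩
  · rw [Program.Defined, ← h3.1]
    exact ⟨fun h => h.2, fun h => ⟨h1d, h⟩⟩
  · rw [Program.eval, ← h3.2]
    exact h2

end GProgram

end TTGrad

namespace TTGrad

open Code

/-! ### Correctness of the derivatives, the gauge projection and the whole algorithm -/

section Correctness

variable {d : ℕ} {n : Fin d → ℕ} {r : Fin (d - 1) → ℕ}

theorem gCores_eq (hd : 0 < d) {U V : Cores n r} {w : CoreIdx n r → ℝ}
    {z : GInput n r ⊕ (CoreIdx n (2 • r) ⊕ ℕ) → ℝ} (hR : ∀ j, z (.inl (.R j)) = w j)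
    (hU : ∀ j : CoreIdx n r, j.k.val + 1 < d → z (.inl (.U j)) = U.entry j)
    (hV : ∀ j : CoreIdx n r, 0 < j.k.val → z (.inl (.V j)) = V.entry j) :
    gCores z = blockCores (Cores.ofEntries w) U V := by
  funext k i
  ext a b
  exact blockEntry_congr hd hR hU hV ⟨k, a, i, b⟩

/-- One entry of `R` is moved along a line, and two derivatives of the output are compared: the one
from `Code.hasGradAt` and the one from the chain rule for `f ∘ T_X`. -/
theorem grad_gProgram (hd : 0 < d) {Ω : Set (Tensor n)} (hΩ : IsOpen Ω) {f : Tensor n → ℝ}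
    {X : Tensor n} (hX : X ∈ Ω) (hf : DifferentiableAt ℝ f X) {U V S : Cores n r}
    (h : IsOrthogonalization X U V S) {p : Program (CoreIdx n (2 • r)) ℕ} (hp : p.WellFormed)
    (hpf : ∀ G : Cores n (2 • r), tensor G ∈ Ω → p.Defined G.entry ∧ p.eval G.entry = f (tensor G))
    {z : GInput n r ⊕ (CoreIdx n (2 • r) ⊕ ℕ) → ℝ} (hR : ∀ j, z (.inl (.R j)) = basePoint S j)
    (hU : ∀ j : CoreIdx n r, j.k.val + 1 < d → z (.inl (.U j)) = U.entry j)
    (hV : ∀ j : CoreIdx n r, 0 < j.k.val → z (.inl (.V j)) = V.entry j) :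
    Code.Defined (gProgram p).toCode z ∧
      ∀ j, grad (gProgram p).out (gProgram p).toCode z (.inl (.R j)) =
        fderiv ℝ (fun R => f (tensor (blockCores (Cores.ofEntries R) U V))) (basePoint S)
          (Pi.single j 1) := by
  classical
  have hbase : tensor (blockCores (Cores.ofEntries (basePoint S)) U V) = X := by
    rw [tensor_blockCores_eq hd, tangentMap_basePoint hd h]
  have hdef : Code.Defined (gProgram p).toCode z := by
    rw [(gProgram_spec hp z).1, gCores_eq hd hR hU hV]
    exact (hpf _ (hbase.symm ▸ hX)).1
  refine ⟨hdef, fun j => ?_⟩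
  have h1 := Code.hasGradAt (gProgram p).out (gProgram p).toCode hdef {.inl (.R j)}
    (fun t => Function.update z (.inl (.R j)) (z (.inl (.R j)) + t)) (Pi.single (.inl (.R j)) 1)
    (by simp) (by
      intro x
      by_cases hx : x = .inl (.R j)
      · subst hx
        simpa using (hasDerivAt_id (0 : ℝ)).const_add _
      · simpa [hx] using hasDerivAt_const (0 : ℝ) (z x)) (by
      intro x hx
      rw [Finset.mem_singleton] at hx
      simp [hx])
  simp only [Finset.sum_singleton, Pi.single_eq_same, mul_one] at h1
  have hw : ∀ t : ℝ, gCores (Function.update z (.inl (.R j)) (z (.inl (.R j)) + t)) =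
      blockCores (Cores.ofEntries (basePoint S + t • Pi.single j 1)) U V := by
    intro t
    refine gCores_eq hd (fun l => ?_) (fun l hl => ?_) (fun l hl => ?_)
    · by_cases hl : l = j
      · subst hl
        simp [hR]
      · simp [hl, hR]
    · simpa using hU l hl
    · simpa using hV l hl
  have hcurve : HasDerivAt (fun t : ℝ => basePoint S + t • (Pi.single j 1 : CoreIdx n r → ℝ))
      (Pi.single j 1) 0 := by
    simpa using ((hasDerivAt_id (0 : ℝ)).smul_const (Pi.single j 1 : CoreIdx n r → ℝ)).const_add
      (basePoint S)
  have h2 : HasDerivAt (fun t : ℝ =>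
      f (tensor (blockCores (Cores.ofEntries (basePoint S + t • Pi.single j 1)) U V)))
      (fderiv ℝ (fun R => f (tensor (blockCores (Cores.ofEntries R) U V))) (basePoint S)
        (Pi.single j 1)) 0 := by
    have h3 : HasFDerivAt (fun R => f (tensor (blockCores (Cores.ofEntries R) U V)))
        (fderiv ℝ (fun R => f (tensor (blockCores (Cores.ofEntries R) U V))) (basePoint S))
        (basePoint S + (0 : ℝ) • (Pi.single j 1 : CoreIdx n r → ℝ)) := by
      simpa using (hasFDerivAt_comp_tangentMap hd h hf).differentiableAt.hasFDerivAt
    exact h3.comp_hasDerivAt (0 : ℝ) hcurve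
  -- The two functions agree only while the tensor lies in `Ω`; openness of `Ω` makes this a
  -- neighbourhood of `t = 0`.
  refine h1.unique (h2.congr_of_eventuallyEq ?_)
  have hcont : ContinuousAt (fun t : ℝ =>
      tensor (blockCores (Cores.ofEntries (basePoint S + t • Pi.single j 1)) U V)) 0 := by
    simp only [tensor_blockCores_eq hd]
    refine ContinuousAt.comp (g := fun R => tangentMap U V (Cores.ofEntries R))
      (f := fun t : ℝ => basePoint S + t • (Pi.single j 1 : CoreIdx n r → ℝ)) ?_
      hcurve.continuousAt
    exact (tangentMap U V ∘ₗ ofEntriesLinear n r).continuous_of_finiteDimensional.continuousAt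
  have hmem := hcont.eventually (hΩ.mem_nhds (by simpa [hbase] using hX))
  filter_upwards [hmem] with t ht
  rw [(gProgram_spec hp _).2, hw]
  exact (hpf _ ht).2

theorem runs_gaugeProjection (m : Reg n r → ℝ) :
    Runs (gaugeProjection n r) m fun m' =>
      coresIn Reg.delta m' = gaugePart (coresIn Reg.U m) (coresIn Reg.D m) ∧
      ∀ x, (∀ j, x ≠ Reg.delta j) → (∀ k a b, x ≠ Reg.M k a b) → x ≠ Reg.tmp → m' x = m x := by
  unfold gaugeProjection
  refine (runs_map _ Reg.delta (fun a b h => Reg.delta.inj h) (fun j => Op.copy (Reg.D j))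
    (fun _ _ _ => trivial) m (fun j _ m' h => h (Reg.D j) nofun)).append fun m₁ ⟨h1, f1⟩ => ?_
  set Γ := gaugePart (coresIn Reg.U m) (coresIn Reg.D m) with hΓ
  -- Invariant: the deltas of the first `k` cores are final, the others are still copies of the
  -- derivatives. The loop has `d - 1` passes, so the last core remains a copy.
  refine (runs_finRange _ (fun k m' =>
    (∀ j : CoreIdx n r, m' (Reg.delta j) = if j.k.val < k then Γ.entry j else m (Reg.D j)) ∧
      ∀ x, (∀ j, x ≠ Reg.delta j) → (∀ k a b, x ≠ Reg.M k a b) → x ≠ Reg.tmp → m' x = m x)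
    ?_ ?_).mono ?_
  · rintro k m₂ ⟨h2, f2⟩
    have hk : (lo k).val + 1 < d := by
      have := k.isLt
      simp only [lo]
      omega
    rw [flatMap_flatMap_eq]
    refine (runs_sumProds _ ((List.nodup_finRange _).product (List.nodup_finRange _))
      (dst := fun x : Fin (bond r (k.val + 1)) × Fin (bond r (k.val + 1)) => Reg.M k x.1 x.2)
      (tmp := Reg.tmp) ?_ (fun _ => nofun) _ ?_ m₂).append ?_
    · rintro ⟨a, b⟩ ⟨a', b'⟩ h
      simpa using h
    · intro a xy hxy
      obtain ⟨c, -, rfl⟩ := List.mem_map.1 hxy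
      exact ⟨nofun, nofun, nofun, nofun⟩
    rintro m₃ ⟨h3, f3⟩
    have hM : ∀ c b, m₃ (Reg.M k c b) =
        (∑ i, (coresIn Reg.U m (lo k) i).transpose * coresIn Reg.D m (lo k) i) c b := by
      intro c b
      refine (h3 (c, b) (by simp)).trans ?_
      rw [List.map_map]
      refine (sum_map_of_nodup ((List.nodup_finRange _).product (List.nodup_finRange _))
        (by simp) _).trans ?_
      rw [Fintype.sum_prod_type, Finset.sum_comm]
      refine Eq.trans ?_ (Matrix.sum_apply _ _ _ _).symm
      refine Finset.sum_congr rfl fun i _ => Finset.sum_congr rfl fun a _ => ?_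
      exact congrArg₂ (· * ·) (f2 _ nofun nofun nofun) (f2 _ nofun nofun nofun)
    refine Runs.of_eq (flatMap_flatMap_flatMap_eq _ _ _ _) ?_
    refine (runs_subProds _ (((List.nodup_finRange _).product ((List.nodup_finRange _).product
      (List.nodup_finRange _))))
      (dst := fun x : Fin (bond r (lo k).val) × Fin (n (lo k)) × Fin (bond r (k.val + 1)) =>
        Reg.delta ⟨lo k, x.1, x.2.1, x.2.2⟩) (tmp := Reg.tmp) ?_ (fun _ => nofun) _ ?_ m₃).mono ?_
    · rintro ⟨a, i, b⟩ ⟨a', i', b'⟩ h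
      simp only [Reg.delta.injEq, CoreIdx.mk.injEq, heq_eq_eq, true_and] at h
      obtain ⟨rfl, rfl, rfl⟩ := h
      rfl
    · intro a xy hxy
      obtain ⟨c, -, rfl⟩ := List.mem_map.1 hxy
      exact ⟨nofun, nofun, nofun, nofun⟩
    rintro m₄ ⟨h4, f4⟩
    refine ⟨?_, fun x hx hx' ht => ?_⟩
    · intro j
      by_cases hj : j.k = lo k
      · obtain ⟨_, a, i, b⟩ := j
        obtain rfl := hj
        rw [if_pos (by simp [lo])]
        refine (h4 (a, i, b) (List.mem_product.2 ⟨List.mem_finRange _,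
          List.mem_product.2 ⟨List.mem_finRange _, List.mem_finRange _⟩⟩)).trans ?_
        have hΓj : Γ.entry ⟨lo k, a, i, b⟩ = coresIn Reg.D m (lo k) i a b -
            ∑ c, coresIn Reg.U m (lo k) i a c *
            (∑ i, (coresIn Reg.U m (lo k) i).transpose * coresIn Reg.D m (lo k) i) c b := by
          rw [hΓ]
          have e : gaugePart (coresIn Reg.U m) (coresIn Reg.D m) (lo k) i = _ := if_pos hk
          exact congrFun (congrFun e a) b
        rw [hΓj, f3 (Reg.delta ⟨lo k, a, i, b⟩) (fun _ _ => nofun) nofun, h2, if_neg (by simp [lo])]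
        refine congrArg (_ - ·) ?_
        refine (congrArg List.sum List.map_map).trans ((Fin.sum_univ_def _).symm.trans ?_)
        refine Finset.sum_congr rfl fun c _ => congrArg₂ (· * ·) ?_ (hM c b)
        exact (f3 (Reg.U ⟨lo k, a, i, c⟩) (fun _ _ => nofun) nofun).trans
          (f2 (Reg.U ⟨lo k, a, i, c⟩) nofun nofun nofun)
      · rw [f4 (Reg.delta j) (fun x _ e => hj (congrArg CoreIdx.k (Reg.delta.inj e))) nofun,
          f3 (Reg.delta j) (fun _ _ => nofun) nofun, h2]
        have : j.k.val ≠ k.val := fun e => hj (Fin.ext e)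
        congr 1
        exact propext (by omega)
    · rw [f4 x (fun y _ => hx _) ht, f3 x (fun y _ => hx' _ _ _) ht, f2 x hx hx' ht]
  · refine ⟨fun j => ?_, fun x hx _ _ => f1 x fun j _ => hx j⟩
    rw [if_neg (Nat.not_lt_zero _)]
    exact h1 j (mem_allEntries j)
  · rintro m' ⟨h2, f2⟩
    refine ⟨?_, f2⟩
    funext k i
    ext a b
    refine (h2 ⟨k, a, i, b⟩).trans ?_
    by_cases hk : k.val < d - 1
    · rw [if_pos hk]
      rfl
    · rw [if_neg hk, hΓ, gaugePart, if_neg (by omega)]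
      rfl

/-- The specifications of the stages are chained; their frame conditions show that `U`, `V`, `S`,
`D` and `delta` survive from their computation to the final memory. -/
theorem runs_riemannianGradient (hd : 0 < d) {Ω : Set (Tensor n)} (hΩ : IsOpen Ω)
    {f : Tensor n → ℝ} {G : Cores n r} (hG : tensor G ∈ fixedRank n r) (hX : tensor G ∈ Ω)
    (hf : DifferentiableAt ℝ f (tensor G)) (i₀ : (k : Fin d) → Fin (n k))
    {p : Program (CoreIdx n (2 • r)) ℕ} (hp : p.WellFormed)
    (hpf : ∀ G : Cores n (2 • r), tensor G ∈ Ω → p.Defined G.entry ∧ p.eval G.entry = f (tensor G))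
    (m₀ : Reg n r → ℝ) (hm : ∀ j, m₀ (Reg.G j) = G.entry j) :
    Runs (riemannianGradient p) m₀ fun m =>
      IsOrthogonalization (tensor G) (coresIn Reg.U m) (coresIn Reg.V m) (coresIn Reg.S m) ∧
      (∀ j, (coresIn Reg.D m).entry j = fderiv ℝ (fun R => f (tensor (blockCores
        (Cores.ofEntries R) (coresIn Reg.U m) (coresIn Reg.V m)))) (basePoint (coresIn Reg.S m))
          (Pi.single j 1)) ∧
      coresIn Reg.delta m = gaugePart (coresIn Reg.U m) (coresIn Reg.D m) ∧
      coresIn Reg.grad m =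
        blockCores (coresIn Reg.delta m) (coresIn Reg.U m) (coresIn Reg.V m) := by
  have had : Function.Injective (Reg.ad : _ → Reg n r) := fun a b h => Reg.ad.inj h
  unfold riemannianGradient
  simp only [List.append_assoc]
  refine (runs_orthogonalize hd hG i₀ m₀ hm).append fun m₁ h1 => ?_
  refine (runs_map (gInputs n r) (fun x => Reg.ad (.val (.inl x)))
    (fun a b h => Sum.inl_injective (ADReg.val.inj (Reg.ad.inj h))) loadOp ?_ m₁ ?_).append
    fun m₂ ⟨h2, f2⟩ => ?_
  · rintro (j | j | j) _ m'
    · by_cases hj : j.k.val = 0 <;> simp [loadOp, hj, Op.Defined]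
    · trivial
    · trivial
  · rintro (j | j | j) _ m' hm'
    · by_cases hj : j.k.val = 0
      · simpa [loadOp, hj, Op.eval] using hm' (Reg.S j) nofun
      · simp [loadOp, hj, Op.eval]
    · exact hm' (Reg.U j) nofun
    · exact hm' (Reg.V j) nofun
  have hR : ∀ j, GInput.R j ∈ gInputs n r := fun j => by simp [gInputs, mem_allEntries]
  obtain ⟨hdef, hgrad⟩ := grad_gProgram (z := fun x => m₂ (Reg.ad (.val x))) hd hΩ hX hf h1 hp hpf
    (fun j => by
      refine (h2 _ (hR j)).trans ?_
      by_cases hj : j.k.val = 0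
      · simp only [loadOp, basePoint, hj, if_true]
        rfl
      · simp [loadOp, basePoint, hj, Op.eval])
    (fun j hj => h2 _ (by simp [gInputs, mem_allEntries, hj]))
    (fun j hj => h2 _ (by simp [gInputs, mem_allEntries, hj]))
  have had₂ := runs_reverseAD (gInputs n r) (gProgram p) (gProgram_singleAssignment hp)
    (m₂ ∘ Reg.ad) hdef
  -- The differentiation code is renamed into the registers `Reg.ad`, so all other registers keep
  -- their content.
  refine (show Runs _ m₂ (fun m => (∀ i ∈ gInputs n r, m (Reg.ad (.adj (.inl i))) =
      grad (gProgram p).out (gProgram p).toCode ((m₂ ∘ Reg.ad) ∘ ADReg.val) (.inl i)) ∧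
      ∀ x, (∀ y, Reg.ad y ≠ x) → m x = m₂ x) from
    ⟨(defined_rename _ had _ _).2 had₂.1, fun i hi => ?_,
      fun x hx => exec_rename_of_notMem _ _ _ _ hx⟩).append fun m₃ ⟨h3, f3⟩ => ?_
  · rw [← had₂.2 i hi, ← exec_rename _ had]
    rfl
  refine (runs_map (allEntries n r) Reg.D (fun a b h => Reg.D.inj h)
    (fun j => Op.copy (Reg.ad (.adj (.inl (.R j))))) (fun _ _ _ => trivial) m₃
    (fun j _ m' h => h (Reg.ad (.adj (.inl (.R j)))) nofun)).append fun m₄ ⟨h4, f4⟩ => ?_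
  refine (runs_gaugeProjection m₄).append fun m₅ ⟨h5, f5⟩ => ?_
  refine (runs_map (allEntries n (2 • r)) Reg.grad (fun a b h => Reg.grad.inj h)
    (blockOp Reg.delta Reg.U Reg.V) (fun _ _ _ => blockOp_defined _ _ _ _ _) m₅
    (fun j _ m' h => blockOp_eval_congr j (fun l => h _ nofun) (fun l => h _ nofun)
      (fun l => h _ nofun))).mono fun m₆ ⟨h6, f6⟩ => ?_
  have eU : ∀ j, m₆ (Reg.U j) = m₄ (Reg.U j) := fun j =>
    (f6 (Reg.U j) nofun).trans (f5 (Reg.U j) nofun nofun nofun)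
  have eU' : ∀ j, m₄ (Reg.U j) = m₁ (Reg.U j) := fun j =>
    (f4 (Reg.U j) nofun).trans ((f3 (Reg.U j) nofun).trans (f2 (Reg.U j) nofun))
  have eV : ∀ j, m₆ (Reg.V j) = m₁ (Reg.V j) := fun j =>
    (f6 (Reg.V j) nofun).trans ((f5 (Reg.V j) nofun nofun nofun).trans
      ((f4 (Reg.V j) nofun).trans ((f3 (Reg.V j) nofun).trans (f2 (Reg.V j) nofun))))
  have eS : ∀ j, m₆ (Reg.S j) = m₁ (Reg.S j) := fun j =>
    (f6 (Reg.S j) nofun).trans ((f5 (Reg.S j) nofun nofun nofun).trans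
      ((f4 (Reg.S j) nofun).trans ((f3 (Reg.S j) nofun).trans (f2 (Reg.S j) nofun))))
  have eD : ∀ j, m₆ (Reg.D j) = m₄ (Reg.D j) := fun j =>
    (f6 (Reg.D j) nofun).trans (f5 (Reg.D j) nofun nofun nofun)
  have cU : coresIn Reg.U m₆ = coresIn Reg.U m₁ := funext fun k =>
    coresIn_congr k fun a i b => (eU _).trans (eU' _)
  have cU' : coresIn Reg.U m₆ = coresIn Reg.U m₄ := funext fun k =>
    coresIn_congr k fun a i b => eU _
  have cV : coresIn Reg.V m₆ = coresIn Reg.V m₁ := funext fun k =>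
    coresIn_congr k fun a i b => eV _
  have cS : coresIn Reg.S m₆ = coresIn Reg.S m₁ := funext fun k =>
    coresIn_congr k fun a i b => eS _
  have cD : coresIn Reg.D m₆ = coresIn Reg.D m₄ := funext fun k =>
    coresIn_congr k fun a i b => eD _
  refine ⟨?_, ?_, ?_, ?_⟩
  · rw [cU, cV, cS]
    exact h1
  · intro j
    rw [cU, cV, cS, cD, ← hgrad j]
    exact (h4 j (mem_allEntries j)).trans (h3 _ (hR j))
  · rw [cU', cD, ← h5]
    funext k
    exact coresIn_congr k fun a i b => f6 (Reg.delta ⟨k, a, i, b⟩) nofun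
  · funext k i
    ext a b
    refine (h6 ⟨k, a, i, b⟩ (mem_allEntries _)).trans ?_
    rw [blockOp_eval, show m₅ ∘ Reg.delta = m₆ ∘ Reg.delta from
      funext fun j => (f6 (Reg.delta j) nofun).symm,
      show m₅ ∘ Reg.U = m₆ ∘ Reg.U from
      funext fun j => (f6 (Reg.U j) nofun).symm,
      show m₅ ∘ Reg.V = m₆ ∘ Reg.V from
      funext fun j => (f6 (Reg.V j) nofun).symm]
    rfl

end Correctness

end TTGrad

namespace TTGrad

/-! ### The number of operations -/

section Cost

/-- A monomial of degree `e` gains the factor `2 ^ e ≤ 2 ^ q`; nonnegative coefficients allow the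
estimate term by term. -/
theorem eval_two_mul_le {σ : Type*} [Fintype σ] (F : MvPolynomial σ ℝ≥0) {q : ℕ}
    (hF : F.totalDegree ≤ q) (x : σ → ℝ≥0) :
    MvPolynomial.eval (fun k => 2 * x k) F ≤ 2 ^ q * MvPolynomial.eval x F := by
  rw [MvPolynomial.eval_eq', MvPolynomial.eval_eq', Finset.mul_sum]
  refine Finset.sum_le_sum fun e he => ?_
  have h1 : ∑ i, e i ≤ q := by
    refine le_trans ?_ ((MvPolynomial.le_totalDegree he).trans hF)
    rw [Finsupp.sum_fintype _ _ fun _ => rfl]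
  simp only [mul_pow, Finset.prod_mul_distrib, Finset.prod_pow_eq_pow_sum]
  calc _ = 2 ^ (∑ i, e i) * (F.coeff e * ∏ i, x i ^ e i) := by ring
    _ ≤ _ := by gcongr; norm_num

theorem length_flatMap_le {α β : Type*} (l : List α) (f : α → List β) (B : ℕ)
    (h : ∀ a, (f a).length ≤ B) : (l.flatMap f).length ≤ l.length * B := by
  induction l with
  | nil => simp
  | cons a l ih =>
    rw [List.flatMap_cons, List.length_append, List.length_cons, Nat.succ_mul, add_comm]
    exact Nat.add_le_add ih (h a)

theorem length_finRange_flatMap_le {β : Type*} {s B S : ℕ} (f : Fin s → List β) (hs : s ≤ S)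
    (h : ∀ a, (f a).length ≤ B) : ((List.finRange s).flatMap f).length ≤ S * B := by
  refine (length_flatMap_le _ f B h).trans ?_
  rw [List.length_finRange]
  exact Nat.mul_le_mul_right _ hs

theorem length_subProd {R : Type} (dst tmp : R) (l : List (R × R)) :
    (subProd dst tmp l).length = 2 * l.length := by
  induction l with
  | nil => rfl
  | cons a l ih =>
    rw [subProd, List.flatMap_cons, List.length_append, List.length_cons]
    change _ + (subProd dst tmp l).length = _
    rw [ih]
    simp only [List.length_cons, List.length_nil]
    ring

theorem length_sumProd {R : Type} (dst tmp : R) (l : List (R × R)) :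
    (sumProd dst tmp l).length = 2 * l.length + 1 := by
  induction l with
  | nil => rfl
  | cons a l ih =>
    simp only [sumProd, List.flatMap_cons, List.length_cons, List.length_append,
      List.length_nil] at ih ⊢
    omega

/-- A projection step costs `4 * rows.length + 1`: two operations per row for the coefficient, two
for the update, and one initialization. Normalization costs `3 * rows.length + 2`. -/
theorem length_gramSchmidt_le {R μ : Type} (rows : List μ) (s : ℕ) (A Q : μ → Fin s → R)
    (T : Fin s → Fin s → R) (tmp : R) :
    (gramSchmidt rows s A Q T tmp).length ≤
      s * (rows.length + s * (4 * rows.length + 2)) := by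
  refine length_finRange_flatMap_le _ le_rfl fun b => ?_
  rw [List.length_append, List.length_map]
  refine Nat.add_le_add_left (length_finRange_flatMap_le _ le_rfl fun c => ?_) _
  split_ifs
  · have := length_flatMap_le rows (fun x => subProd (Q x b) tmp [(T c b, Q x c)]) 2
      fun x => (length_subProd _ _ _).le
    rw [List.length_append, length_sumProd, List.length_map]
    omega
  · simp only [List.length_append, length_sumProd, List.length_map, List.length_cons,
      List.length_nil]
    omega
  · simp

theorem length_pullback_le {ι ν : Type} (v : ν) (o : Op (ι ⊕ ν)) : (pullback v o).length ≤ 4 := by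
  cases o <;> simp [pullback]

/-- Each instruction is charged once in the forward pass, once for clearing its adjoint, and at most
four times in the backward pass. The final `1` seeds the output adjoint. -/
theorem length_reverseAD_le {ι ν : Type} (inputs : List ι) (p : Program ι ν) :
    (reverseAD inputs p).length ≤ 6 * p.cost + inputs.length + 1 := by
  have := length_flatMap_le p.code.reverse (fun vo => pullback vo.1 vo.2) 4
    fun vo => length_pullback_le _ _
  rw [List.length_reverse] at this
  simp only [reverseAD, Program.toCode, Code.rename, Program.cost, List.length_append,
    List.length_map, List.length_cons, List.length_nil]
  omega

variable {d : ℕ} {n : Fin d → ℕ} {r : Fin (d - 1) → ℕ} {N ρ : ℕ}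

theorem bond_le (hρ : 1 ≤ ρ) (hr : ∀ k, r k ≤ ρ) (k : ℕ) : bond r k ≤ ρ := by
  unfold bond
  split_ifs
  exacts [hr _, hρ]

theorem length_coreEntries_le (hn : ∀ k, n k ≤ N) (hr : ∀ k, bond r k ≤ ρ) (k : Fin d) :
    (coreEntries n r k).length ≤ ρ * (N * ρ) := by
  refine length_finRange_flatMap_le _ (hr _) fun a => ?_
  refine length_finRange_flatMap_le _ (hn _) fun i => ?_
  rw [List.length_map, List.length_finRange]
  exact hr _

theorem length_allEntries_le (hn : ∀ k, n k ≤ N) (hr : ∀ k, bond r k ≤ ρ) :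
    (allEntries n r).length ≤ d * (ρ * (N * ρ)) :=
  length_finRange_flatMap_le _ le_rfl fun _ => length_coreEntries_le hn hr _

theorem length_gramSchmidt_core_le {R μ : Type} {rows : List μ} {s : ℕ} (A Q : μ → Fin s → R)
    (T : Fin s → Fin s → R) (tmp : R) (hN : 1 ≤ N) (hrows : rows.length ≤ N * ρ) (hs : s ≤ ρ) :
    (gramSchmidt rows s A Q T tmp).length ≤ 7 * (N * ρ ^ 3) := by
  refine (length_gramSchmidt_le rows s A Q T tmp).trans ?_
  have hρ3 : ρ ^ 2 ≤ ρ ^ 3 := by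
    rcases Nat.eq_zero_or_pos ρ with rfl | h
    · simp
    · exact Nat.pow_le_pow_right h (by norm_num)
  calc s * (rows.length + s * (4 * rows.length + 2))
      ≤ ρ * (N * ρ + ρ * (4 * (N * ρ) + 2)) := by gcongr
    _ = 1 * (N * ρ ^ 2) + 4 * (N * ρ ^ 3) + 2 * (1 * ρ ^ 2) := by ring
    _ ≤ 1 * (N * ρ ^ 3) + 4 * (N * ρ ^ 3) + 2 * (N * ρ ^ 3) := by gcongr
    _ = 7 * (N * ρ ^ 3) := by ring

theorem length_sumProds_le {R : Type} {p q s t : ℕ} (dst : Fin p → Fin q → Fin s → R) (tmp : R)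
    (f : Fin p → Fin q → Fin s → Fin t → R × R) (hρ : 1 ≤ ρ) (hp : p ≤ ρ) (hq : q ≤ N) (hs : s ≤ ρ)
    (ht : t ≤ ρ) :
    ((List.finRange p).flatMap fun a => (List.finRange q).flatMap fun i =>
      (List.finRange s).flatMap fun b => sumProd (dst a i b) tmp
        ((List.finRange t).map (f a i b))).length ≤ 3 * (N * ρ ^ 3) := by
  calc _ ≤ ρ * (N * (ρ * (3 * ρ))) := by
        refine length_finRange_flatMap_le _ hp fun a => length_finRange_flatMap_le _ hq fun i =>
          length_finRange_flatMap_le _ hs fun b => ?_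
        rw [length_sumProd, List.length_map, List.length_finRange]
        omega
    _ = _ := by ring

theorem length_subProds_le {R : Type} {p q s t : ℕ} (dst : Fin p → Fin q → Fin s → R) (tmp : R)
    (f : Fin p → Fin q → Fin s → Fin t → R × R) (hp : p ≤ ρ) (hq : q ≤ N) (hs : s ≤ ρ)
    (ht : t ≤ ρ) :
    ((List.finRange p).flatMap fun a => (List.finRange q).flatMap fun i =>
      (List.finRange s).flatMap fun b => subProd (dst a i b) tmp
        ((List.finRange t).map (f a i b))).length ≤ 2 * (N * ρ ^ 3) := by
  calc _ ≤ ρ * (N * (ρ * (2 * ρ))) := by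
        refine length_finRange_flatMap_le _ hp fun a => length_finRange_flatMap_le _ hq fun i =>
          length_finRange_flatMap_le _ hs fun b => ?_
        rw [length_subProd, List.length_map, List.length_finRange]
        omega
    _ = _ := by ring

theorem length_orthogonalize_le (hN : 1 ≤ N) (hρ : 1 ≤ ρ) (hn : ∀ k, n k ≤ N)
    (hr : ∀ k, bond r k ≤ ρ) :
    (orthogonalize n r).length ≤ 2 * (d * (ρ * (N * ρ))) + 20 * (d * (N * ρ ^ 3)) := by
  have h1 := length_allEntries_le hn hr
  have hd : d - 1 ≤ d := Nat.sub_le _ _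
  have h2 : ∀ P : CoreIdx n r → Prop, ∀ _ : DecidablePred P,
      ((allEntries n r).filter fun j => P j).length ≤ d * (ρ * (N * ρ)) :=
    fun P _ => (List.length_filter_le _ _).trans h1
  unfold orthogonalize
  rw [flatMap_ite_eq, flatMap_ite_eq]
  simp only [List.length_append, List.length_map]
  have h3 : ∀ f : Fin (d - 1) → Code (Reg n r), (∀ k, (f k).length ≤ 10 * (N * ρ ^ 3)) →
      ((List.finRange (d - 1)).reverse.flatMap f).length ≤ d * (10 * (N * ρ ^ 3)) := by
    intro f hf
    refine (length_flatMap_le _ f _ hf).trans ?_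
    rw [List.length_reverse, List.length_finRange]
    exact Nat.mul_le_mul_right _ hd
  have h4 : ∀ f : Fin (d - 1) → Code (Reg n r), (∀ k, (f k).length ≤ 10 * (N * ρ ^ 3)) →
      ((List.finRange (d - 1)).flatMap f).length ≤ d * (10 * (N * ρ ^ 3)) :=
    fun f hf => length_finRange_flatMap_le _ hd hf
  -- In each of the two sweeps a bond costs at most `7` units for Gram-Schmidt and `3` for absorbing
  -- the triangular factor.
  have h5 : d * (10 * (N * ρ ^ 3)) + d * (10 * (N * ρ ^ 3)) = 20 * (d * (N * ρ ^ 3)) := by ring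
  refine (Nat.add_le_add (Nat.add_le_add (Nat.add_le_add (h2 _ _) (h3 _ fun k => ?_)) (h2 _ _))
    (h4 _ fun k => ?_)).trans ?_
  · rw [List.length_append]
    refine (Nat.add_le_add (length_gramSchmidt_core_le _ _ _ _ hN ?_ (hr _))
      (length_sumProds_le _ _ _ hρ (hr _) (hn _) (hr _) (hr _))).trans (by omega)
    rw [List.length_product, List.length_finRange, List.length_finRange]
    exact Nat.mul_le_mul (hn _) (hr _)
  · rw [List.length_append]
    refine (Nat.add_le_add (length_gramSchmidt_core_le _ _ _ _ hN ?_ (hr _))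
      (length_sumProds_le _ _ _ hρ (hr _) (hn _) (hr _) (hr _))).trans (by omega)
    rw [List.length_product, List.length_finRange, List.length_finRange, mul_comm]
    exact Nat.mul_le_mul (hn _) (hr _)
  · omega

theorem length_gaugeProjection_le (hN : 1 ≤ N) (hρ : 1 ≤ ρ) (hn : ∀ k, n k ≤ N)
    (hr : ∀ k, bond r k ≤ ρ) :
    (gaugeProjection n r).length ≤ d * (ρ * (N * ρ)) + 5 * (d * (N * ρ ^ 3)) := by
  unfold gaugeProjection
  rw [List.length_append, List.length_map]
  refine Nat.add_le_add (length_allEntries_le hn hr) ?_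
  calc _ ≤ d * (3 * (N * ρ ^ 3) + 2 * (N * ρ ^ 3)) := by
        refine length_finRange_flatMap_le _ (Nat.sub_le _ _) fun k => ?_
        rw [List.length_append]
        refine Nat.add_le_add ?_ (length_subProds_le _ _ _ (hr _) (hn _) (hr _) (hr _))
        calc _ ≤ ρ * (ρ * (3 * (N * ρ))) := by
              refine length_finRange_flatMap_le _ (hr _) fun c =>
                length_finRange_flatMap_le _ (hr _) fun b => ?_
              rw [length_sumProd, List.length_map, List.length_product, List.length_finRange,
                List.length_finRange]
              have h1 : bond r (lo k).val * n (lo k) ≤ N * ρ := by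
                rw [mul_comm]
                exact Nat.mul_le_mul (hn _) (hr _)
              have h2 : 1 ≤ N * ρ := Nat.mul_pos hN hρ
              omega
          _ = _ := by ring
    _ = _ := by ring

theorem length_riemannianGradient_le (hd : 1 ≤ d) (hN : 1 ≤ N) (hρ : 1 ≤ ρ) (hn : ∀ k, n k ≤ N)
    (hr : ∀ k, r k ≤ ρ) (p : Program (CoreIdx n (2 • r)) ℕ) :
    (riemannianGradient p).length ≤ 64 * (d * (N * ρ ^ 3)) + 6 * p.cost := by
  have hb := bond_le hρ hr
  have hb2 : ∀ k, bond (2 • r) k ≤ 2 * ρ := fun k =>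
    (bond_two_nsmul_le r k).trans (Nat.mul_le_mul_left _ (hb k))
  have h1 := length_allEntries_le hn hb
  have h2 := length_allEntries_le hn hb2
  have h3 := length_orthogonalize_le hN hρ hn hb
  have h4 := length_gaugeProjection_le hN hρ hn hb
  have h5 := length_reverseAD_le (gInputs n r) (gProgram p)
  have h6 : (gProgram p).cost = (allEntries n (2 • r)).length + p.cost := by
    simp [gProgram, Program.cost]
  have h7 : (gInputs n r).length ≤ 3 * (d * (ρ * (N * ρ))) := by
    have e1 := (List.length_filter_le (fun j : CoreIdx n r => decide (j.k.val + 1 < d))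
      (allEntries n r)).trans h1
    have e2 := (List.length_filter_le (fun j : CoreIdx n r => decide (0 < j.k.val))
      (allEntries n r)).trans h1
    simp only [gInputs, List.length_append, List.length_map]
    omega
  have h8 : d * (ρ * (N * ρ)) ≤ d * (N * ρ ^ 3) := by
    calc _ = d * (N * ρ ^ 2) := by ring
      _ ≤ _ := by gcongr <;> omega
  have h9 : d * (2 * ρ * (N * (2 * ρ))) = 4 * (d * (ρ * (N * ρ))) := by ring
  have h10 : 1 ≤ d * (N * ρ ^ 3) := Nat.mul_pos hd (Nat.mul_pos hN (Nat.pow_pos hρ))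
  simp only [riemannianGradient, List.length_append, List.length_map, Code.rename]
  -- In units of `d N ρ³`, with core entries counted by `h8`: `22` for orthogonalization, `3` for
  -- loading, `24 + 3 + 1` for differentiation apart from `6 * p.cost`, `1` for copying `D`, `6` for
  -- the gauge projection, `4` for the output; in total `64`.
  omega

end Cost

end TTGrad

/-! ### Correctness and cost combined -/

theorem mainTheorem1 (q : ℕ) :
    ∃ C : ℝ, ∀ (d : ℕ) (_hd : 2 ≤ d) (n : Fin d → ℕ)
      -- the function, smooth on an open set
      (Ω : Set (Tensor n)) (_hΩ : IsOpen Ω)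
      (f : Tensor n → ℝ) (_hf : ContDiffOn ℝ ∞ f Ω)
      -- the program, for cores of any sizes, and its polynomial number of operations
      (p : (s : Fin (d - 1) → ℕ) → Program (CoreIdx n s) ℕ)
      (F : MvPolynomial (Fin (d - 1)) ℝ≥0) (_hF : F.totalDegree ≤ q)
      (_hp : ∀ s : Fin (d - 1) → ℕ, (∀ k, 0 < s k) →
        (p s).WellFormed ∧
        ((p s).cost : ℝ) ≤ (MvPolynomial.eval (fun k => (s k : ℝ≥0)) F : ℝ≥0) ∧
        ∀ G : Cores n s, tensor G ∈ Ω →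
          (p s).Defined G.entry ∧ (p s).eval G.entry = f (tensor G))
      -- the point of the manifold, given by its cores
      (r : Fin (d - 1) → ℕ) (_hr : ∀ k, 0 < r k)
      (G : Cores n r) (_hX : tensor G ∈ fixedRank n r) (_hXΩ : tensor G ∈ Ω)
      -- the initial memory, which contains the cores
      (m₀ : Reg n r → ℝ) (_hm₀ : ∀ j, m₀ (Reg.G j) = G.entry j),
      let alg := riemannianGradient (p (2 • r))
      let m := alg.exec m₀
      let U := Cores.ofEntries fun j => m (Reg.U j)
      let V := Cores.ofEntries fun j => m (Reg.V j)
      let S := Cores.ofEntries fun j => m (Reg.S j)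
      let D := Cores.ofEntries fun j => m (Reg.D j)
      let δ := Cores.ofEntries fun j => m (Reg.delta j)
      let g : (CoreIdx n r → ℝ) → ℝ :=
        fun R => f (tensor (blockCores (Cores.ofEntries R) U V))
      -- the number of operations
      (alg.length : ℝ) ≤
        C * ((MvPolynomial.eval (fun k => (r k : ℝ≥0)) F : ℝ≥0) +
          d * (Finset.univ.sup n : ℕ) * (Finset.univ.sup r : ℕ) ^ 3) ∧
      -- all operations are legal
      alg.Defined m₀ ∧
      -- the orthogonalization
      IsOrthogonalization (tensor G) U V S ∧
      -- the derivatives of `g` at `(S₁, 0, …, 0)`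
      (∀ j, D.entry j = fderiv ℝ g (basePoint S) (Pi.single j 1)) ∧
      -- their projection onto the gauge conditions
      (∀ (k : Fin d) (i : Fin (n k)), δ k i =
        if k.val + 1 < d then D k i - U k i * ∑ j, (U k j).transpose * D k j else D k i) ∧
      (∀ k : Fin d, k.val + 1 < d → ∑ i, (U k i).transpose * δ k i = 0) ∧
      -- the computed cores are those of the Riemannian gradient
      Cores.ofEntries (fun j => m (Reg.grad j)) = blockCores δ U V ∧
      tensor (Cores.ofEntries fun j => m (Reg.grad j)) =
        (tangentSpace (fixedRank n r) (tensor G)).starProjection (gradient f (tensor G)) := by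
  -- `64` bounds the work outside `p`; `6` is the overhead of reverse mode and `2 ^ q` the effect of
  -- running `p` on doubled ranks.
  refine ⟨64 + 6 * 2 ^ q, ?_⟩
  intro d hd n Ω hΩ f hf p F hF hp r hr G hX hXΩ m₀ hm₀
  have hd0 : 0 < d := by omega
  obtain ⟨i₀⟩ := nonempty_index hX hd hr
  have hr2 : ∀ k, 0 < (2 • r) k := fun k => by simpa using hr k
  obtain ⟨hwf, hcost, hspec⟩ := hp (2 • r) hr2
  have hfX : DifferentiableAt ℝ f (tensor G) :=
    (hf.contDiffAt (hΩ.mem_nhds hXΩ)).differentiableAt (by simp)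
  obtain ⟨hdef, horth, hD, hδ, hgrad⟩ :=
    runs_riemannianGradient hd0 hΩ hX hXΩ hfX i₀ hwf hspec m₀ hm₀
  refine ⟨?_, hdef, horth, hD, fun k i => congrFun (congrFun hδ k) i, ?_, hgrad, ?_⟩
  · have hN : 1 ≤ Finset.univ.sup n :=
      (Nat.one_le_iff_ne_zero.2 (i₀ ⟨0, hd0⟩).pos.ne').trans (Finset.le_sup (Finset.mem_univ _))
    have hρ : 1 ≤ Finset.univ.sup r :=
      (hr ⟨0, by omega⟩).trans_le (Finset.le_sup (Finset.mem_univ _))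
    have hlen := length_riemannianGradient_le hd0 hN hρ (fun k => Finset.le_sup (Finset.mem_univ k))
      (fun k => Finset.le_sup (Finset.mem_univ k)) (p (2 • r))
    have hF2 := eval_two_mul_le F hF fun k => (r k : ℝ≥0)
    have hcost' : ((p (2 • r)).cost : ℝ) ≤
        2 ^ q * (MvPolynomial.eval (fun k => (r k : ℝ≥0)) F : ℝ≥0) := by
      refine hcost.trans ?_
      have e : (fun k => (((2 • r) k : ℕ) : ℝ≥0)) = fun k => 2 * (r k : ℝ≥0) := by
        funext k
        simp
      rw [e]
      exact_mod_cast hF2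
    have hlen' : ((riemannianGradient (p (2 • r))).length : ℝ) ≤
        64 * (d * ((Finset.univ.sup n : ℕ) * (Finset.univ.sup r : ℕ) ^ 3)) +
          6 * (p (2 • r)).cost := by
      exact_mod_cast hlen
    refine hlen'.trans ?_
    have h1 : (0 : ℝ) ≤ (MvPolynomial.eval (fun k => (r k : ℝ≥0)) F : ℝ≥0) := NNReal.coe_nonneg _
    have h2 : (0 : ℝ) ≤ d * ((Finset.univ.sup n : ℕ) * (Finset.univ.sup r : ℕ) ^ 3) := by
      positivity
    have h3 : (0 : ℝ) ≤ 6 * 2 ^ q := by positivity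
    have h4 := mul_nonneg h3 h2
    rw [mul_assoc (d : ℝ)]
    linarith
  · have := gauged_gaugePart horth.1 (coresIn Reg.D (Code.exec (riemannianGradient (p (2 • r))) m₀))
    rw [← hδ] at this
    exact this
  · refine (congrArg tensor hgrad).trans ?_
    rw [hδ]
    refine tensor_blockCores_gaugePart hd0 hX horth i₀ _ fun j => ?_
    rw [hD j]
    exact fderiv_comp_tangentMap hd0 horth hfX _
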